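/- **Definitions.** For a dimension $d\ge 1$ write $|B_1|$ for the volume of the unit ball of $\mathbb R^d$ and $C_d=2^{d+1}/|B_1|$. A *Swiss-cheese packing with $M$ scales* consists of radii $0<R_1<\dots<R_M$ with $R_{k+1}>(1+4\sqrt d\,|B_1|)R_k$, a period $\ell>8\sqrt d\,|B_1|(M+C_d)R_M$, and a finite family $\mathcal B$ of closed balls with radii in $\{R_1,\dots,R_M\}$, contained in the cube $[-\ell/2,\ell/2]^d$, such that the balls of the periodized family $F=\{B+p: B\in\mathcal B,\ p\in(\ell\mathbb Z)^d\}$ are pairwise disjoint and such that for each $i$ the balls of $\mathcal B$ of radius $R_i$ cover a fraction $c_i$ of the cube with $\frac1{M+C_d+1}<c_i<\frac1{M+C_d}$. For $\omega=(t,y)$ in $\Omega=\{(t,y):\ t\in[\tfrac12,\tfrac32],\ y\in[-\tfrac{t\ell}2,\tfrac{t\ell}2]^d\}$ let $F_\omega=\{tA+y: A\in F\}$, a $(t\ell\mathbb Z)^d$-periodic packing by balls of radii $tR_1,\dots,tR_M$. A Borel kernel $g:\mathbb R^d\to[0,\infty]$ is *positive definite* if $\iint g(x-y)\,d\sigma(x)d\sigma(y)\ge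 0$ for all $\sigma=\mu-\nu$ with $\mu,\nu$ finite Borel measures of finite energy $\iint g(x-y)\,d\mu d\mu$, $\iint g(x-y)\,d\nu d\nu$. For a probability measure $\mu$ on $\mathbb R^d$ and $n\in\mathbb N$ let $$F_{n,g}(\mu)=\inf_\gamma\int\sum_{1\le i\ne j\le n}g(x_i-x_j)\,d\gamma(x_1,\dots,x_n),$$ the infimum over permutation-invariant probability measures $\gamma$ on $(\mathbb R^d)^n$ with all marginals equal to $\mu$ (so $F_{0,g}=F_{1,g}=0$), and for real $N\ge 2$ let $$F_{\mathrm{GC},N,g}(\mu)=\inf\Big\{\sum_{n\ge 0}\alpha_nF_{n,g}(\mu_n):\ \alpha_n\ge0,\ \sum_{n\ge 0}\alpha_n=1,\ \mu_n\in\mathcal P(\mathbb R^d),\ \sum_{n\ge1}n\alpha_n\mu_n=N\mu\Big\}.$$ Set $E^{\mathrm{xc}}_{N,g}(\mu)=F_{N,g}(\mu)-N^2\iint g(x-y)\,d\mu d\mu$ (for integer $N$) and $E^{\mathrm{xc}}_{\mathrm{GC},N,g}(\mu)=F_{\mathrm{GC},N,g}(\mu)-N^2\iint g(x-y)\,d\mu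 d\mu$. **Proposition (Fefferman–Gregg decomposition).** Let $d\ge1$ and $0<\epsilon<d/2$. There are constants $C,C'>0$ depending only on $d$ and $\epsilon$ such that for all $M\in\mathbb N_+$, all $\epsilon\le s\le d-\epsilon$ and all $R_1>0$ there exist a Swiss-cheese packing with $M$ scales and smallest radius $R_1$, a probability measure $\mathbb P$ on the corresponding $\Omega$, and a Borel function $w:\mathbb R^d\to[0,\infty]$ with $w(0)=\infty$, such that for all $x,y\in\mathbb R^d$ $$\frac1{|x-y|^{s}}=\frac{M}{M+C}\left\{\int_\Omega\Big(\sum_{A\in F_\omega}\frac{1_A(x)1_A(y)}{|x-y|^{s}}\Big)d\mathbb P(\omega)+w(x-y)\right\}$$ (with $|0|^{-s}=\infty$ and $0\cdot\infty=0$), and 1. $w$ is positive definite; 2. for every probability measure $\mu$ on $\mathbb R^d$ with a density $\rho\in L^{1+s/d}(\mathbb R^d)$ one has $E^{\mathrm{xc}}_{N,w}(\mu)\ge E^{\mathrm{xc}}_{\mathrm{GC},N,w}(\mu)$ for all integers $N\ge2$, and for all real $N\ge2$ $$E^{\mathrm{xc}}_{\mathrm{GC},N,w}(\mu)\ \ge\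 -\frac{C'}{M}N^{1+s/d}\int_{\mathbb R^d}\rho^{1+s/d}\,dx-\frac{C'}{M}R_1^{-s}(N-1).$$ -/

import Mathlib

open MeasureTheory Metric
open scoped ENNReal

noncomputable section

namespace FeffermanGregg

/-- The Euclidean space `ℝ^d`. -/
abbrev Euc (d : ℕ) : Type := EuclideanSpace ℝ (Fin d)

/-- The closed cube `[-a/2, a/2]^d`. -/
def cube (d : ℕ) (a : ℝ) : Set (Euc d) := {x | ∀ i, |x i| ≤ a / 2}

/-- The volume `|B_1|` of the unit ball of `ℝ^d`. -/
def unitBallVol (d : ℕ) : ℝ := (volume (closedBall (0 : Euc d) 1)).toReal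

/-- The constant `C_d = 2^(d+1) / |B_1|`. -/
def cheeseConst (d : ℕ) : ℝ := 2 ^ (d + 1) / unitBallVol d

/-- The point `ℓ p` of the lattice `(ℓ ℤ)^d`. -/
def latticePoint {d : ℕ} (ℓ : ℝ) (p : Fin d → ℤ) : Euc d :=
  WithLp.toLp 2 (fun i => ℓ * (p i : ℝ))

/-- A "Swiss cheese" packing of `ℝ^d` with `M` scales, periodic with respect to `(ℓ ℤ)^d`:
the radii `R_1 < ... < R_M` grow at least geometrically, the period `ℓ` is large compared to them,
`centers i` is the finite set of the centres of the balls of radius `R i` that lie in the cube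
`[-ℓ/2, ℓ/2]^d`, all balls of the periodized family are disjoint, and for each scale `i` the balls
of radius `R i` cover a fraction between `1 / (M + C_d + 1)` and `1 / (M + C_d)` of the cube. -/
structure SwissCheese (d M : ℕ) where
  R : Fin M → ℝ
  ℓ : ℝ
  centers : Fin M → Finset (Euc d)
  R_pos : ∀ i, 0 < R i
  R_growth : ∀ i j : Fin M, (i : ℕ) + 1 = j →
    (1 + 4 * √(d : ℝ) * unitBallVol d) * R i < R j
  ℓ_large : ∀ i, 8 * √(d : ℝ) * unitBallVol d * (M + cheeseConst d) * R i < ℓ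
  subset_cube : ∀ i, ∀ x ∈ centers i, closedBall x (R i) ⊆ cube d ℓ
  disjoint : ∀ i j, ∀ x ∈ centers i, ∀ y ∈ centers j, ∀ p q : Fin d → ℤ,
    (i, x, p) ≠ (j, y, q) →
      Disjoint (closedBall (x + latticePoint ℓ p) (R i)) (closedBall (y + latticePoint ℓ q) (R j))
  fraction_lower : ∀ i, 1 / (M + cheeseConst d + 1) <
    ((centers i).card : ℝ) * (volume (closedBall (0 : Euc d) (R i))).toReal / ℓ ^ d
  fraction_upper : ∀ i,
    ((centers i).card : ℝ) * (volume (closedBall (0 : Euc d) (R i))).toReal / ℓ ^ d <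
      1 / (M + cheeseConst d)

namespace SwissCheese

variable {d M : ℕ}

/-- For `ω = (t, y)`, the family `F_ω` of the balls `t • B + y`, where `B` ranges over all balls of
the periodized packing: the packing dilated by `t` and then translated by `y`. -/
def family (S : SwissCheese d M) (ω : ℝ × Euc d) : Set (Set (Euc d)) :=
  {A | ∃ i, ∃ x ∈ S.centers i, ∃ p : Fin d → ℤ,
    A = closedBall (ω.1 • (x + latticePoint S.ℓ p) + ω.2) (ω.1 * S.R i)}

/-- The parameters `ω = (t, y)`: dilation factors `t ∈ [1/2, 3/2]`, and translations `y` in the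
periodicity cube `[-tℓ/2, tℓ/2]^d` of the dilated packing. -/
def params (S : SwissCheese d M) : Set (ℝ × Euc d) :=
  {ω | 1 / 2 ≤ ω.1 ∧ ω.1 ≤ 3 / 2 ∧ ω.2 ∈ cube d (ω.1 * S.ℓ)}

end SwissCheese

/-- The kernel `|x|^(-s)` with values in `[0, ∞]`, equal to `∞` at `x = 0` when `s > 0`. -/
def riesz {d : ℕ} (s : ℝ) (x : Euc d) : ℝ≥0∞ := ‖x‖ₑ ^ (-s)

/-- The interaction energy `∬ g(x - y) dμ(x) dν(y)`. -/
def energy {d : ℕ} (g : Euc d → ℝ≥0∞) (μ ν : Measure (Euc d)) : ℝ≥0∞ :=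
  ∫⁻ x, ∫⁻ y, g (x - y) ∂ν ∂μ

/-- A kernel `g : ℝ^d → [0, ∞]` is positive definite if `∬ g(x - y) dσ(x) dσ(y) ≥ 0` for all signed
measures `σ = μ - ν`, with `μ, ν` finite measures of finite energy. The inequality is
written with the negative (mixed) terms moved to the other side; it is void if `μ` or `ν` has
infinite energy. -/
def IsPositiveDefinite {d : ℕ} (g : Euc d → ℝ≥0∞) : Prop :=
  ∀ (μ ν : Measure (Euc d)), IsFiniteMeasure μ → IsFiniteMeasure ν →
    energy g μ ν + energy g ν μ ≤ energy g μ μ + energy g ν ν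

/-- `γ` is a symmetric probability measure on `(ℝ^d)^N` all of whose marginals equal `μ`. -/
structure IsPlan {d : ℕ} (N : ℕ) (μ : Measure (Euc d)) (γ : Measure (Fin N → Euc d)) : Prop where
  prob : IsProbabilityMeasure γ
  symm : ∀ σ : Equiv.Perm (Fin N), γ.map (fun x i => x (σ i)) = γ
  marginal : ∀ i, γ.map (fun x => x i) = μ

/-- The `N`-marginal optimal transport cost
`F_N(μ) = inf_γ ∫ ∑_{i ≠ j} g(x_i - x_j) dγ`, the infimum over the symmetric plans with marginals
`μ`. For `N = 0, 1` and a probability measure `μ` the sum is empty, and the value is `0`. -/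
def optTransport {d : ℕ} (N : ℕ) (g : Euc d → ℝ≥0∞) (μ : Measure (Euc d)) : ℝ≥0∞ :=
  ⨅ (γ : Measure (Fin N → Euc d)) (_ : IsPlan N μ γ),
    ∫⁻ x, ∑ i, ∑ j ∈ Finset.univ.erase i, g (x i - x j) ∂γ

/-- Competitors of the grand-canonical problem: weights `α_n ≥ 0` and probability measures `ν_n`
with `∑ α_n = 1` and `∑ n α_n ν_n = N μ`. -/
structure IsGCCompetitor {d : ℕ} (N : ℝ) (μ : Measure (Euc d)) (α : ℕ → ℝ≥0∞)
    (ν : ℕ → Measure (Euc d)) : Prop where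
  prob : ∀ n, IsProbabilityMeasure (ν n)
  sum_weights : ∑' n, α n = 1
  sum_marginals : Measure.sum (fun n : ℕ => ((n : ℝ≥0∞) * α n) • ν n) = ENNReal.ofReal N • μ

/-- The grand-canonical optimal transport cost `inf ∑_n α_n F_n(ν_n)`
(the terms `n = 0, 1` vanish). -/
def optTransportGC {d : ℕ} (N : ℝ) (g : Euc d → ℝ≥0∞) (μ : Measure (Euc d)) : ℝ≥0∞ :=
  ⨅ (α : ℕ → ℝ≥0∞) (ν : ℕ → Measure (Euc d)) (_ : IsGCCompetitor N μ α ν),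
    ∑' n, α n * optTransport n g (ν n)

/-- The exchange-correlation energy `F_N(μ) - N² ∬ g(x - y) dμ(x) dμ(y)`, as an extended real
(it is `-∞` if the subtracted term is infinite). -/
def excEnergy {d : ℕ} (N : ℕ) (g : Euc d → ℝ≥0∞) (μ : Measure (Euc d)) : EReal :=
  (optTransport N g μ : EReal) - (((N : ℝ≥0∞) ^ 2 * energy g μ μ : ℝ≥0∞) : EReal)

/-- The grand-canonical exchange-correlation energy. -/
def excEnergyGC {d : ℕ} (N : ℝ) (g : Euc d → ℝ≥0∞) (μ : Measure (Euc d)) : EReal :=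
  (optTransportGC N g μ : EReal) - ((ENNReal.ofReal N ^ 2 * energy g μ μ : ℝ≥0∞) : EReal)

end FeffermanGregg

end

/-! The remainder is a positive superposition of indicators: w(x-y) = ∫ 1_B(x) 1_B(y) dm(B), where B
runs over the balls of ℝ^(2d+1), into which ℝ^d is embedded isometrically. Both properties of w
follow from this form. Energies become ∫ μ(B) ν(B) dm(B), so positive definiteness is 2ab ≤ a² + b².
For the exchange bound, let X be the number of points in B and G = N μ(B). The pairs contribute X² -
X ≥ 2GX - G² - X, whose average over a grand-canonical competitor is G² - G. Using this where G > 1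
and positivity of the cost elsewhere, the exchange energy is at least -∫ min(G, G²) dm
(`energy_le_optTransportGC`).

To reach this form, average over translations: the packing term becomes u^(-s) ∑ c_i h(u/(t R_i))
with u = |x-y|, where h is the normalised overlap of two unit balls of ℝ^d. The dilation t is given
a density proportional to t^(s-1) B(t), with B a smooth bump near 1. Let p be the overlap profile of
balls of ℝ^(2d+1). Because this dimension is odd, repeated integration by parts gives B(u) = ∫ α(r)
p(u/r) dr with a signed weight α (`exists_smooth_representation`). A change of variables
(`rpow_mul_integral_eq`) then gives u^(-s) ∫ t^(s-1) B(t) g(u/t) dt = ∫ p(u/x) x^(-s-1) (∫ α(r) r^s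
g(x/r) dr) dx for bounded g. With g = (M+C)/M - ∑ c_i h(·/R_i), the remainder is a mixture of the
p(·/x) with weight a(x) = x^(-s-1) ((M+C)/M c₀ - ∑ c_i A(x/R_i)).

Here A is the average of h: it is c₀ + O(x) near 0 and vanishes beyond 3. As c_i ≤ 1/M and the radii
grow geometrically, the errors O(x/R_i) sum to O(1/M), which the constant C absorbs; so a(x) ≥
x^(-s-1)/M. Since ∑ c_i ≥ 1 - O(1/M), also a(x) ≤ O(1/M) x^(-s-1) (1 + #{i : R_i < x})
(`exists_weight`). In the exchange bound the first term, after cutting the density at height r^(-d),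
yields ∫ ρ^(1+s/d); the count yields the geometric sum of the R_i^(-s).

The packings are built greedily on grids from the largest radius down, with a large integer ratio of
radii (`exists_swissCheese`). -/

noncomputable section

namespace FeffermanGregg

/-! ### Superpositions of indicators: positive definiteness and the exchange bound -/

section

lemma ennreal_two_mul_le_add_sq (a b : ℝ≥0∞) : a * b + a * b ≤ a ^ 2 + b ^ 2 := by
  rcases le_total a b with h | h
  all_goals
    obtain ⟨c, rfl⟩ := exists_add_of_le h
    ring_nf
    exact le_self_add

section IndicatorKernel

variable {d : ℕ} {T : Type*} [MeasurableSpace T] {m : Measure T} [SFinite m]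
  {Ψ : T → Euc d → ℝ≥0∞} {w : Euc d → ℝ≥0∞}

lemma energy_eq_lintegral (hΨ : Measurable (Function.uncurry Ψ))
    (hw : ∀ x y, w (x - y) = ∫⁻ t, Ψ t x * Ψ t y ∂m) (μ ν : Measure (Euc d))
    [SFinite μ] [SFinite ν] :
    energy w μ ν = ∫⁻ t, (∫⁻ x, Ψ t x ∂μ) * (∫⁻ x, Ψ t x ∂ν) ∂m := by
  have hΨ1 : ∀ t, Measurable (Ψ t) := fun t => hΨ.of_uncurry_left
  have hΨ2 : ∀ x, Measurable (fun t => Ψ t x) := fun x => hΨ.of_uncurry_right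
  have h1 : ∀ x, ∫⁻ y, w (x - y) ∂ν = ∫⁻ t, Ψ t x * ∫⁻ y, Ψ t y ∂ν ∂m := by
    intro x
    simp_rw [hw]
    rw [lintegral_lintegral_swap]
    · refine lintegral_congr fun t => ?_
      rw [lintegral_const_mul _ (hΨ1 t)]
    · apply Measurable.aemeasurable
      have e1 : Measurable (fun p : Euc d × T => Ψ p.2 x) := (hΨ2 x).comp measurable_snd
      have e2 : Measurable (fun p : Euc d × T => Ψ p.2 p.1) := hΨ.comp measurable_swap
      exact e1.mul e2
  have hν : Measurable (fun t => ∫⁻ y, Ψ t y ∂ν) := hΨ.lintegral_prod_right'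
  unfold energy
  simp_rw [h1]
  rw [lintegral_lintegral_swap]
  · refine lintegral_congr fun t => ?_
    rw [lintegral_mul_const _ (hΨ1 t)]
  · apply Measurable.aemeasurable
    have e2 : Measurable (fun p : Euc d × T => Ψ p.2 p.1) := hΨ.comp measurable_swap
    exact e2.mul (hν.comp measurable_snd)

lemma isPositiveDefinite_of_indicator (hΨ : Measurable (Function.uncurry Ψ))
    (hw : ∀ x y, w (x - y) = ∫⁻ t, Ψ t x * Ψ t y ∂m) : IsPositiveDefinite w := by
  intro μ ν hμ hν
  have h1 : ∀ ν : Measure (Euc d), SFinite ν → Measurable (fun t => ∫⁻ y, Ψ t y ∂ν) :=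
    fun ν _ => hΨ.lintegral_prod_right'
  have mμ := h1 μ inferInstance
  have mν := h1 ν inferInstance
  simp_rw [energy_eq_lintegral hΨ hw]
  rw [← lintegral_add_left (by fun_prop), ← lintegral_add_left (by fun_prop)]
  refine lintegral_mono fun t => ?_
  have := ennreal_two_mul_le_add_sq (∫⁻ x, Ψ t x ∂μ) (∫⁻ x, Ψ t x ∂ν)
  simpa [sq, mul_comm] using this

lemma sum_pairs_add_sum {n : ℕ} (a : Fin n → ℝ≥0∞) (h01 : ∀ i, a i = 0 ∨ a i = 1) :
    ∑ i, ∑ j ∈ Finset.univ.erase i, a i * a j + ∑ i, a i = (∑ i, a i) ^ 2 := by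
  rw [sq, Finset.sum_mul_sum, ← Finset.sum_add_distrib]
  refine Finset.sum_congr rfl fun i _ => ?_
  rw [← Finset.sum_erase_add _ _ (Finset.mem_univ i)]
  congr 1
  rcases h01 i with h | h <;> simp [h]

/-- Let X = ∑ Ψ_t(x_i). Since Ψ takes the values 0 and 1, the off-diagonal pairs sum to X² - X, and
2XG ≤ X² + G²; the marginals give the mean of X. Negative terms are moved across to stay in [0, ∞].
The set `Z` is left free so that the estimate can be used only where it beats the trivial lower
bound zero. -/
lemma lintegral_counting_le (hΨ : Measurable (Function.uncurry Ψ))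
    (h01 : ∀ t x, Ψ t x = 0 ∨ Ψ t x = 1)
    (hw : ∀ x y, w (x - y) = ∫⁻ t, Ψ t x * Ψ t y ∂m)
    {G : T → ℝ≥0∞} (hG : Measurable G) {Z : Set T} (n : ℕ)
    (ν : Measure (Euc d)) [IsProbabilityMeasure ν] :
    ∫⁻ t in Z, 2 * G t * (n * ∫⁻ x, Ψ t x ∂ν) ∂m ≤
      optTransport n w ν + ∫⁻ t in Z, (n * ∫⁻ x, Ψ t x ∂ν) + G t ^ 2 ∂m := by
  have hΨ1 : ∀ t, Measurable (Ψ t) := fun t => hΨ.of_uncurry_left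
  have hν : Measurable (fun t => ∫⁻ y, Ψ t y ∂ν) := hΨ.lintegral_prod_right'
  unfold optTransport
  rw [ENNReal.iInf_add]
  refine le_iInf fun γ => ?_
  rw [ENNReal.iInf_add]
  refine le_iInf fun hγ => ?_
  have := hγ.prob
  have hS : ∀ t, ∫⁻ x, ∑ i, Ψ t (x i) ∂γ = n * ∫⁻ x, Ψ t x ∂ν := by
    intro t
    rw [lintegral_finsetSum _ (fun i _ => by have := hΨ1 t; fun_prop)]
    have : ∀ i, ∫⁻ x : Fin n → Euc d, Ψ t (x i) ∂γ = ∫⁻ x, Ψ t x ∂ν := by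
      intro i
      rw [← hγ.marginal i, lintegral_map (hΨ1 t) (measurable_pi_apply i)]
    simp [this]
  have mΨi : ∀ i : Fin n, Measurable (fun p : (Fin n → Euc d) × T => Ψ p.2 (p.1 i)) := fun i =>
    hΨ.comp (measurable_snd.prodMk ((measurable_pi_apply i).comp measurable_fst))
  have mP : Measurable (fun p : (Fin n → Euc d) × T =>
      ∑ i, ∑ j ∈ Finset.univ.erase i, Ψ p.2 (p.1 i) * Ψ p.2 (p.1 j)) :=
    Finset.measurable_sum _ fun i _ => Finset.measurable_sum _ fun j _ => (mΨi i).mul (mΨi j)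
  have hcost : ∫⁻ x, ∑ i, ∑ j ∈ Finset.univ.erase i, w (x i - x j) ∂γ =
      ∫⁻ t, ∫⁻ x, ∑ i, ∑ j ∈ Finset.univ.erase i, Ψ t (x i) * Ψ t (x j) ∂γ ∂m := by
    rw [← lintegral_lintegral_swap mP.aemeasurable]
    refine lintegral_congr fun x => ?_
    have mm : ∀ i j, Measurable (fun t => Ψ t (x i) * Ψ t (x j)) := fun i j =>
      (hΨ.of_uncurry_right).mul (hΨ.of_uncurry_right)
    rw [lintegral_finsetSum _ (fun i _ => Finset.measurable_sum _ fun j _ => mm i j)]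
    refine Finset.sum_congr rfl fun i _ => ?_
    rw [lintegral_finsetSum _ (fun j _ => mm i j)]
    exact Finset.sum_congr rfl fun j _ => hw _ _
  rw [hcost]
  -- Off `Z` the cost is bounded below by zero.
  refine le_trans ?_ (add_le_add_left (setLIntegral_le_lintegral Z _) _)
  rw [← lintegral_add_right _ (by fun_prop)]
  refine lintegral_mono fun t => ?_
  simp only
  have hΨt := hΨ1 t
  have mS : Measurable (fun x : Fin n → Euc d => ∑ i, Ψ t (x i)) :=
    Finset.measurable_sum _ fun i _ => by fun_prop
  rw [← hS t, ← lintegral_const_mul _ mS]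
  have e : G t ^ 2 = ∫⁻ x : Fin n → Euc d, G t ^ 2 ∂γ := by simp
  rw [e, ← lintegral_add_right _ measurable_const,
    ← lintegral_add_right _ (by fun_prop)]
  refine lintegral_mono fun x => ?_
  simp only
  rw [← add_assoc, sum_pairs_add_sum _ (fun i => h01 t (x i))]
  have := ennreal_two_mul_le_add_sq (∑ i, Ψ t (x i)) (G t)
  calc _ = (∑ i, Ψ t (x i)) * G t + (∑ i, Ψ t (x i)) * G t := by ring
    _ ≤ _ := this

/-- Averaging the counting inequality over a competitor replaces ∑ n α_n ν_n by N μ. With G = N ∫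
Ψ_t dμ, the cost is thus at least the integral of G² - G over G > 1. Where G ≤ 1 the whole of G² is
counted as error. -/
lemma energy_le_optTransportGC (hΨ : Measurable (Function.uncurry Ψ))
    (h01 : ∀ t x, Ψ t x = 0 ∨ Ψ t x = 1)
    (hw : ∀ x y, w (x - y) = ∫⁻ t, Ψ t x * Ψ t y ∂m)
    (μ : Measure (Euc d)) [IsProbabilityMeasure μ] (hE : energy w μ μ ≠ ⊤) (N : ℝ) :
    ENNReal.ofReal N ^ 2 * energy w μ μ ≤ optTransportGC N w μ +
      ∫⁻ t, min (ENNReal.ofReal N * ∫⁻ x, Ψ t x ∂μ) ((ENNReal.ofReal N * ∫⁻ x, Ψ t x ∂μ) ^ 2) ∂m := by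
  have hm : ∀ ν : Measure (Euc d), SFinite ν → Measurable (fun t => ∫⁻ y, Ψ t y ∂ν) :=
    fun ν _ => hΨ.lintegral_prod_right'
  have hμ := hm μ inferInstance
  set G : T → ℝ≥0∞ := fun t => ENNReal.ofReal N * ∫⁻ x, Ψ t x ∂μ with hGdef
  have hG : Measurable G := hμ.const_mul _
  have hGE : ENNReal.ofReal N ^ 2 * energy w μ μ = ∫⁻ t, G t ^ 2 ∂m := by
    rw [energy_eq_lintegral hΨ hw, ← lintegral_const_mul _ (by fun_prop)]
    refine lintegral_congr fun t => ?_
    simp only [hGdef]; ring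
  have hGfin : ∫⁻ t, G t ^ 2 ∂m ≠ ⊤ := by
    rw [← hGE]; exact ENNReal.mul_ne_top (by simp) hE
  let Z : Set T := {t | 1 < G t}
  have hZ : MeasurableSet Z := measurableSet_lt measurable_const hG
  have key : ∀ (α : ℕ → ℝ≥0∞) (ν : ℕ → Measure (Euc d)), IsGCCompetitor N μ α ν →
      ∫⁻ t in Z, G t ^ 2 ∂m ≤ ∑' n, α n * optTransport n w (ν n) + ∫⁻ t in Z, G t ∂m := by
    intro α ν h
    have hp := h.prob
    have hsum : ∀ t, ∑' n : ℕ, α n * (n * ∫⁻ x, Ψ t x ∂(ν n)) = G t := by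
      intro t
      have := congrArg (fun κ => ∫⁻ x, Ψ t x ∂κ) h.sum_marginals
      simp only [lintegral_sum_measure, lintegral_smul_measure, smul_eq_mul] at this
      simp only [hGdef]
      rw [← this]
      exact tsum_congr fun n => by ring
    have h1 : ∑' n : ℕ, α n * ∫⁻ t in Z, 2 * G t * (n * ∫⁻ x, Ψ t x ∂(ν n)) ∂m =
        ∫⁻ t in Z, G t ^ 2 + G t ^ 2 ∂m := by
      have e : ∀ n : ℕ, α n * ∫⁻ t in Z, 2 * G t * (n * ∫⁻ x, Ψ t x ∂(ν n)) ∂m =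
          ∫⁻ t in Z, 2 * G t * (α n * (n * ∫⁻ x, Ψ t x ∂(ν n))) ∂m := fun n => by
        have := hm (ν n) inferInstance
        rw [← lintegral_const_mul _ (by fun_prop)]
        exact lintegral_congr fun t => by ring
      simp_rw [e]
      rw [← lintegral_tsum (fun n => by have := hm (ν n) inferInstance; fun_prop)]
      refine lintegral_congr fun t => ?_
      rw [ENNReal.tsum_mul_left, hsum]; ring
    have h2 : ∑' n : ℕ, α n * ∫⁻ t in Z, (n * ∫⁻ x, Ψ t x ∂(ν n)) + G t ^ 2 ∂m =
        ∫⁻ t in Z, G t ∂m + ∫⁻ t in Z, G t ^ 2 ∂m := by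
      have e : ∀ n : ℕ, α n * ∫⁻ t in Z, (n * ∫⁻ x, Ψ t x ∂(ν n)) + G t ^ 2 ∂m =
          ∫⁻ t in Z, α n * (n * ∫⁻ x, Ψ t x ∂(ν n)) + α n * G t ^ 2 ∂m := fun n => by
        have := hm (ν n) inferInstance
        rw [← lintegral_const_mul _ (by fun_prop)]
        exact lintegral_congr fun t => by ring
      simp_rw [e]
      rw [← lintegral_tsum (fun n => by have := hm (ν n) inferInstance; fun_prop),
        ← lintegral_add_left hG]
      refine lintegral_congr fun t => ?_
      rw [ENNReal.tsum_add, ENNReal.tsum_mul_right, hsum, h.sum_weights, one_mul]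
    have h3 : ∫⁻ t in Z, G t ^ 2 + G t ^ 2 ∂m ≤ ∑' n, α n * optTransport n w (ν n) +
        (∫⁻ t in Z, G t ∂m + ∫⁻ t in Z, G t ^ 2 ∂m) := by
      rw [← h1, ← h2, ← ENNReal.tsum_add]
      refine ENNReal.tsum_le_tsum fun n => ?_
      rw [← mul_add]
      exact mul_le_mul_right (lintegral_counting_le hΨ h01 hw hG n (ν n)) _
    rw [lintegral_add_left (hG.pow_const 2), ← add_assoc] at h3
    -- Cancelling the integral of `G ^ 2` is legitimate because the energy is finite.
    refine (ENNReal.add_le_add_iff_right (ne_top_of_le_ne_top hGfin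
      (setLIntegral_le_lintegral Z _))).1 h3
  have h4 : ∫⁻ t in Z, G t ^ 2 ∂m ≤ optTransportGC N w μ + ∫⁻ t in Z, G t ∂m := by
    unfold optTransportGC
    simp_rw [ENNReal.iInf_add]
    exact le_iInf fun α => le_iInf fun ν => le_iInf fun h => key α ν h
  rw [hGE, ← lintegral_add_compl _ hZ, ← lintegral_add_compl (fun t => min (G t) (G t ^ 2)) hZ,
    ← add_assoc]
  have e1 : ∫⁻ t in Z, min (G t) (G t ^ 2) ∂m = ∫⁻ t in Z, G t ∂m := by
    refine setLIntegral_congr_fun hZ fun t ht => ?_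
    refine min_eq_left ?_
    have ht' : 1 ≤ G t := le_of_lt ht
    calc G t = G t * 1 := by rw [mul_one]
      _ ≤ G t * G t := by gcongr
      _ = G t ^ 2 := by ring
  have e2 : ∫⁻ t in Zᶜ, min (G t) (G t ^ 2) ∂m = ∫⁻ t in Zᶜ, G t ^ 2 ∂m := by
    refine setLIntegral_congr_fun hZ.compl fun t ht => ?_
    refine min_eq_right ?_
    have ht' : G t ≤ 1 := not_lt.1 ht
    calc G t ^ 2 = G t * G t := by ring
      _ ≤ G t * 1 := by gcongr
      _ = G t := mul_one _
  rw [e1, e2]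
  gcongr

end IndicatorKernel

/-- The competitor puts all its weight on `n = N`. -/
lemma optTransportGC_le {d : ℕ} (N : ℕ) (w : Euc d → ℝ≥0∞) (μ : Measure (Euc d))
    [IsProbabilityMeasure μ] : optTransportGC (N : ℝ) w μ ≤ optTransport N w μ := by
  refine (iInf₂_le (fun n => if n = N then 1 else 0) (fun _ => μ)).trans ?_
  refine (iInf_le _ ?_).trans ?_
  · refine ⟨fun _ => inferInstance, by simp, ?_⟩
    ext s hs
    rw [Measure.sum_apply _ hs, tsum_eq_single N]
    · simp
    · intro n hn; simp [hn]
  · rw [tsum_eq_single N]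
    · simp
    · intro n hn; simp [hn]

lemma excEnergyGC_le_excEnergy {d : ℕ} (N : ℕ) (w : Euc d → ℝ≥0∞) (μ : Measure (Euc d))
    [IsProbabilityMeasure μ] : excEnergyGC N w μ ≤ excEnergy N w μ := by
  unfold excEnergyGC excEnergy
  rw [ENNReal.ofReal_natCast]
  exact EReal.sub_le_sub (by exact_mod_cast optTransportGC_le N w μ) le_rfl

lemma le_excEnergyGC {d : ℕ} {N : ℝ} {w : Euc d → ℝ≥0∞} {μ : Measure (Euc d)}
    (hE : energy w μ μ ≠ ⊤) {B : ℝ} (hB : 0 ≤ B)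
    (h : ENNReal.ofReal N ^ 2 * energy w μ μ ≤ optTransportGC N w μ + ENNReal.ofReal B) :
    ((-B : ℝ) : EReal) ≤ excEnergyGC N w μ := by
  unfold excEnergyGC
  have hfin : ENNReal.ofReal N ^ 2 * energy w μ μ ≠ ⊤ := ENNReal.mul_ne_top (by simp) hE
  generalize ENNReal.ofReal N ^ 2 * energy w μ μ = X at *
  lift X to NNReal using hfin
  rcases eq_or_ne (optTransportGC N w μ) ⊤ with ho | ho
  · rw [ho]
    simp
  · generalize optTransportGC N w μ = Y at *
    lift Y to NNReal using ho
    have h' : (X : ℝ) ≤ Y + B := by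
      have := ENNReal.toReal_mono (by simp) h
      rwa [ENNReal.toReal_add (by simp) (by simp), ENNReal.toReal_ofReal hB] at this
    have e : (((Y : ℝ≥0∞) : EReal) - ((X : ℝ≥0∞) : EReal)) = (((Y : ℝ) - (X : ℝ) : ℝ) : EReal) := by
      rfl
    rw [e]
    exact_mod_cast (by linarith : -B ≤ (Y : ℝ) - X)

end

/-! ### Overlaps of two balls -/

section

open scoped Pointwise

lemma unitBallVol_pos (m : ℕ) : 0 < unitBallVol m :=
  ENNReal.toReal_pos (measure_closedBall_pos _ _ one_pos).ne' measure_closedBall_lt_top.ne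

lemma volume_closedBall_euc {m : ℕ} (x : Euc m) {R : ℝ} (hR : 0 ≤ R) :
    volume (closedBall x R) = ENNReal.ofReal (R ^ m * unitBallVol m) := by
  rw [Measure.addHaar_closedBall' _ _ hR, finrank_euclideanSpace, Fintype.card_fin, unitBallVol,
    ENNReal.ofReal_mul (by positivity), ENNReal.ofReal_toReal measure_closedBall_lt_top.ne]

lemma exists_linearIsometryEquiv_map {F : Type*} [NormedAddCommGroup F] [InnerProductSpace ℝ F]
    [CompleteSpace F] {v w : F} (h : ‖v‖ = ‖w‖) : ∃ f : F ≃ₗᵢ[ℝ] F, f v = w :=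
  ⟨_, Submodule.reflection_sub h⟩

/-- A reflection carries `b - a` to `b' - a'`, which has the same norm. Combined with translations
it is a volume-preserving isometry matching the two pairs of centres. -/
lemma volume_inter_closedBall_congr {m : ℕ} {a b a' b' : Euc m} (h : dist a b = dist a' b')
    (r : ℝ) : volume (closedBall a r ∩ closedBall b r) =
      volume (closedBall a' r ∩ closedBall b' r) := by
  have h' : ‖b - a‖ = ‖b' - a'‖ := by
    rw [← dist_eq_norm, ← dist_eq_norm, dist_comm, h, dist_comm]
  obtain ⟨f, hf⟩ := exists_linearIsometryEquiv_map h'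
  have mp : MeasurePreserving (fun x : Euc m => f (x - a) + a') volume volume :=
    (measurePreserving_add_right volume a').comp
      (f.measurePreserving.comp (measurePreserving_sub_right volume a))
  rw [← mp.measure_preimage
    ((isClosed_closedBall (x := a')).inter (isClosed_closedBall (x := b'))).nullMeasurableSet]
  congr 1
  ext x
  have e1 : dist (f (x - a) + a') a' = dist x a := by
    rw [dist_eq_norm, dist_eq_norm, add_sub_cancel_right, f.norm_map]
  have e2 : dist (f (x - a) + a') b' = dist x b := by
    rw [dist_eq_norm, dist_eq_norm, ← f.norm_map (x - b)]
    congr 1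
    have : x - b = (x - a) - (b - a) := by abel
    rw [this, f.map_sub (x - a), hf]; abel
  simp only [Set.mem_inter_iff, mem_closedBall, Set.mem_preimage, e1, e2]

lemma volume_inter_closedBall_smul {m : ℕ} (a b : Euc m) {t : ℝ} (ht : 0 < t) (r : ℝ) :
    volume (closedBall (t • a) (t * r) ∩ closedBall (t • b) (t * r)) =
      ENNReal.ofReal (t ^ m) * volume (closedBall a r ∩ closedBall b r) := by
  have e : ∀ c : Euc m, closedBall (t • c) (t * r) = t • closedBall c r := fun c => by
    rw [smul_closedBall' ht.ne', Real.norm_of_nonneg ht.le]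
  rw [e, e, ← Set.smul_set_inter₀ ht.ne', Measure.addHaar_smul, finrank_euclideanSpace,
    Fintype.card_fin, abs_of_pos (by positivity)]

/-- A vector of norm `1`, if `m` is positive. -/
def unitVec (m : ℕ) : Euc m := WithLp.toLp 2 (fun _ => (√(m : ℝ))⁻¹)

lemma norm_unitVec {m : ℕ} (hm : 0 < m) : ‖unitVec m‖ = 1 := by
  have : (0 : ℝ) < m := by exact_mod_cast hm
  rw [EuclideanSpace.norm_eq]
  simp [unitVec, this.ne']

/-- The normalised volume of the intersection of two unit balls of `ℝ^m` whose centres have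
distance `u`. -/
def ballOverlap (m : ℕ) (u : ℝ) : ℝ :=
  (volume (closedBall (0 : Euc m) 1 ∩ closedBall (u • unitVec m) 1)).toReal / unitBallVol m

lemma volume_inter_closedBall {m : ℕ} (hm : 0 < m) (a b : Euc m) {R : ℝ} (hR : 0 < R) :
    volume (closedBall a R ∩ closedBall b R) =
      ENNReal.ofReal (R ^ m * unitBallVol m * ballOverlap m (dist a b / R)) := by
  have h1 : volume (closedBall a R ∩ closedBall b R) = ENNReal.ofReal (R ^ m) *
      volume (closedBall (0 : Euc m) 1 ∩ closedBall ((dist a b / R) • unitVec m) 1) := by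
    rw [← volume_inter_closedBall_smul _ _ hR, mul_one]
    refine volume_inter_closedBall_congr ?_ R
    rw [smul_zero, dist_zero_left, smul_smul, norm_smul, norm_unitVec hm, mul_one,
      mul_div_cancel₀ _ hR.ne', Real.norm_of_nonneg dist_nonneg]
  have hfin : volume (closedBall (0 : Euc m) 1 ∩ closedBall ((dist a b / R) • unitVec m) 1) ≠ ⊤ :=
    ne_top_of_le_ne_top measure_closedBall_lt_top.ne (measure_mono Set.inter_subset_left)
  rw [h1, mul_assoc, ENNReal.ofReal_mul (by positivity), ballOverlap,
    mul_div_cancel₀ _ (unitBallVol_pos m).ne', ENNReal.ofReal_toReal hfin]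

lemma ballOverlap_nonneg (m : ℕ) (u : ℝ) : 0 ≤ ballOverlap m u :=
  div_nonneg ENNReal.toReal_nonneg (unitBallVol_pos m).le

lemma ballOverlap_le_one (m : ℕ) (u : ℝ) : ballOverlap m u ≤ 1 := by
  rw [ballOverlap, div_le_one (unitBallVol_pos m)]
  exact ENNReal.toReal_mono measure_closedBall_lt_top.ne (measure_mono Set.inter_subset_left)

lemma ballOverlap_zero (m : ℕ) : ballOverlap m 0 = 1 := by
  simp only [ballOverlap, zero_smul, Set.inter_self]
  exact div_self (unitBallVol_pos m).ne'

lemma ballOverlap_eq_zero {m : ℕ} (hm : 0 < m) {u : ℝ} (hu : 2 < u) : ballOverlap m u = 0 := by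
  have : Disjoint (closedBall (0 : Euc m) 1) (closedBall (u • unitVec m) 1) := by
    apply closedBall_disjoint_closedBall
    rw [dist_zero_left, norm_smul, norm_unitVec hm, mul_one, Real.norm_of_nonneg (by linarith)]
    linarith
  simp [ballOverlap, this.inter_eq]

/-- For `u ≤ 1` the ball of radius `1 - u` about the origin lies in both balls, and Bernoulli's
inequality bounds its volume from below. This linear behaviour at 0 is what makes the errors of the
different scales summable. -/
lemma one_sub_ballOverlap_le {m : ℕ} (hm : 0 < m) {u : ℝ} (hu : 0 ≤ u) :
    1 - ballOverlap m u ≤ m * u := by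
  rcases le_total 1 u with h1 | h1
  · have := ballOverlap_nonneg m u
    have : (1 : ℝ) ≤ m := by exact_mod_cast hm
    nlinarith
  have hsub : closedBall (0 : Euc m) (1 - u) ⊆
      closedBall (0 : Euc m) 1 ∩ closedBall (u • unitVec m) 1 := by
    have : dist (0 : Euc m) (u • unitVec m) = u := by
      rw [dist_zero_left, norm_smul, norm_unitVec hm, mul_one, Real.norm_of_nonneg hu]
    refine Set.subset_inter (closedBall_subset_closedBall (by linarith)) ?_
    exact closedBall_subset_closedBall' (by linarith)
  have h2 := ENNReal.toReal_mono (ne_top_of_le_ne_top measure_closedBall_lt_top.ne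
    (measure_mono Set.inter_subset_left)) (measure_mono (μ := volume) hsub)
  rw [volume_closedBall_euc _ (by linarith), ENNReal.toReal_ofReal (mul_nonneg
    (pow_nonneg (by linarith) _) (unitBallVol_pos m).le)] at h2
  have h3 : (1 - u) ^ m ≤ ballOverlap m u := by
    rw [ballOverlap, le_div_iff₀ (unitBallVol_pos m)]; exact h2
  have h4 := one_add_mul_le_pow (a := -u) (by linarith) m
  rw [← sub_eq_add_neg] at h4
  linarith

lemma measurable_ballOverlap (m : ℕ) : Measurable (ballOverlap m) := by
  have hs : MeasurableSet {p : ℝ × Euc m | p.2 ∈ closedBall (0 : Euc m) 1 ∧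
      dist p.2 (p.1 • unitVec m) ≤ 1} := by
    have h1 : IsClosed {p : ℝ × Euc m | dist p.2 0 ≤ 1} := isClosed_le (by fun_prop) (by fun_prop)
    have h2 : IsClosed {p : ℝ × Euc m | dist p.2 (p.1 • unitVec m) ≤ 1} :=
      isClosed_le (by fun_prop) (by fun_prop)
    exact (h1.inter h2).measurableSet
  exact (measurable_measure_prodMk_left (ν := (volume : Measure (Euc m))) hs).ennreal_toReal.div_const _

/-- The integral `∫_u^1 (1 - v²)^n dv` for `u ≤ 1`, and `0` for `1 ≤ u`. -/
def capIntegral (n : ℕ) (u : ℝ) : ℝ := ∫ v in (min u 1)..1, (1 - v ^ 2) ^ n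

/-- In even dimension the volume is a power of `t` itself, since (√t)^(2n) = t^n. Positivity of `n`
makes the right side vanish for negative `t`. -/
lemma volume_sum_sq_le (n : ℕ) (hn : 0 < n) (t : ℝ) :
    volume {q : Fin (2 * n) → ℝ | ∑ i, q i ^ 2 ≤ t} =
      ENNReal.ofReal (unitBallVol (2 * n) * (max 0 t) ^ n) := by
  rcases lt_or_ge t 0 with ht | ht
  · have : {q : Fin (2 * n) → ℝ | ∑ i, q i ^ 2 ≤ t} = ∅ := by
      ext q
      simp only [Set.mem_ofPred_eq, Set.mem_empty_iff_false, iff_false, not_le]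
      exact ht.trans_le (Finset.sum_nonneg fun i _ => sq_nonneg _)
    rw [this, max_eq_left ht.le]
    simp [hn.ne']
  · have mp := EuclideanSpace.volume_preserving_symm_measurableEquiv_toLp (Fin (2 * n))
    have hc : IsClosed {q : Fin (2 * n) → ℝ | ∑ i, q i ^ 2 ≤ t} :=
      isClosed_le (by fun_prop) (by fun_prop)
    rw [← mp.measure_preimage hc.nullMeasurableSet, max_eq_right ht]
    have : (MeasurableEquiv.toLp 2 (Fin (2 * n) → ℝ)).symm ⁻¹'
        {q : Fin (2 * n) → ℝ | ∑ i, q i ^ 2 ≤ t} = closedBall (0 : Euc (2 * n)) (√t) := by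
      ext x
      simp only [Set.mem_preimage, Set.mem_ofPred_eq, mem_closedBall, dist_zero_right,
        EuclideanSpace.norm_eq]
      rw [Real.sqrt_le_sqrt_iff ht]
      simp
    rw [this, volume_closedBall_euc _ (Real.sqrt_nonneg _), pow_mul, Real.sq_sqrt ht, mul_comm]

lemma integral_cap (n : ℕ) (hn : 0 < n) {u : ℝ} (hu : 0 ≤ u) :
    ∫ v : ℝ, (max 0 (1 - (|v| + u) ^ 2)) ^ n = 2 * capIntegral n u := by
  rw [integral_comp_abs (f := fun v => (max 0 (1 - (v + u) ^ 2)) ^ n)]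
  congr 1
  have h1 := (measurePreserving_add_right volume u).setIntegral_preimage_emb
    (measurableEmbedding_addRight u) (fun v : ℝ => (max 0 (1 - v ^ 2)) ^ n) (Set.Ioi u)
  simp only [Set.preimage_add_const_Ioi, sub_self] at h1
  rw [h1, capIntegral]
  have hz : ∀ v : ℝ, 1 < v → (max 0 (1 - v ^ 2)) ^ n = 0 := fun v hv => by
    rw [max_eq_left (by nlinarith), zero_pow hn.ne']
  rcases le_total 1 u with hu1 | hu1
  · rw [min_eq_right hu1, intervalIntegral.integral_same]
    exact setIntegral_eq_zero_of_forall_eq_zero fun v hv => hz v (hu1.trans_lt hv)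
  · rw [min_eq_left hu1, intervalIntegral.integral_of_le hu1,
      setIntegral_eq_of_subset_of_forall_sdiff_eq_zero (s := Set.Ioc u 1) measurableSet_Ioi
        (fun v hv => hv.1) (fun v hv => hz v (by
          by_contra h
          exact hv.2 ⟨hv.1, not_lt.1 h⟩))]
    refine setIntegral_congr_fun measurableSet_Ioc fun v hv => ?_
    have h0 : 0 < v := hu.trans_lt hv.1
    have : v ^ 2 ≤ 1 := by nlinarith [hv.2]
    rw [max_eq_right (by linarith)]

/-- With the centres at ±u on the first axis, the slice at height v is a ball of ℝ^(2n) of squared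
radius 1 - (|v| + u)²: the farther centre decides. -/
lemma volume_lens (n : ℕ) (hn : 0 < n) {u : ℝ} (hu : 0 ≤ u) :
    volume (closedBall (EuclideanSpace.single 0 u : Euc (2 * n + 1)) 1 ∩
      closedBall (EuclideanSpace.single 0 (-u) : Euc (2 * n + 1)) 1) =
      ENNReal.ofReal (2 * unitBallVol (2 * n) * capIntegral n u) := by
  have mp1 := PiLp.volume_preserving_ofLp (Fin (2 * n + 1))
  have mp2 := volume_preserving_piFinSuccAbove (fun _ : Fin (2 * n + 1) => ℝ) 0
  have mp := mp2.comp mp1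
  let S : Set (ℝ × (Fin (2 * n) → ℝ)) := {p | ∑ i, p.2 i ^ 2 ≤ 1 - (|p.1| + u) ^ 2}
  have hS : IsClosed S := isClosed_le (by fun_prop) (by fun_prop)
  have e : (closedBall (EuclideanSpace.single 0 u : Euc (2 * n + 1)) 1 ∩
      closedBall (EuclideanSpace.single 0 (-u) : Euc (2 * n + 1)) 1) =
      ((MeasurableEquiv.piFinSuccAbove (fun _ : Fin (2 * n + 1) => ℝ) 0) ∘ WithLp.ofLp) ⁻¹' S := by
    ext x
    have hx : ∀ c : ℝ, dist x (EuclideanSpace.single 0 c) ≤ 1 ↔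
        ∑ i : Fin (2 * n), x i.succ ^ 2 ≤ 1 - (x 0 - c) ^ 2 := by
      intro c
      rw [EuclideanSpace.dist_eq, Real.sqrt_le_one, Fin.sum_univ_succ]
      simp only [PiLp.single_apply, if_true, Fin.succ_ne_zero, if_false, Real.dist_eq,
        sq_abs, sub_zero]
      constructor <;> intro h <;> linarith
    simp only [Set.mem_inter_iff, mem_closedBall, hx, Set.mem_preimage, Function.comp, S,
      Set.mem_ofPred_eq]
    have h3 : ∀ i : Fin (2 * n), (MeasurableEquiv.piFinSuccAbove (fun _ : Fin (2 * n + 1) => ℝ) 0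
      (WithLp.ofLp x)).2 i = x i.succ := fun i => rfl
    have h4 : (MeasurableEquiv.piFinSuccAbove (fun _ : Fin (2 * n + 1) => ℝ) 0
      (WithLp.ofLp x)).1 = x 0 := rfl
    simp only [h3, h4]
    rcases abs_cases (x 0) with ⟨h, h'⟩ | ⟨h, h'⟩ <;> rw [h] <;> constructor
    · rintro ⟨h1, h2⟩; linarith
    · intro h5; constructor <;> nlinarith
    · rintro ⟨h1, h2⟩; linarith
    · intro h5; constructor <;> nlinarith
  rw [e, mp.measure_preimage hS.nullMeasurableSet, Measure.volume_eq_prod,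
    Measure.prod_apply hS.measurableSet]
  have e2 : ∀ v : ℝ, volume (Prod.mk v ⁻¹' S) =
      ENNReal.ofReal (unitBallVol (2 * n) * (max 0 (1 - (|v| + u) ^ 2)) ^ n) :=
    fun v => volume_sum_sq_le n hn (1 - (|v| + u) ^ 2)
  simp_rw [e2]
  rw [← ofReal_integral_eq_lintegral_ofReal]
  · rw [integral_const_mul, integral_cap n hn hu]
    congr 1; ring
  · refine Integrable.const_mul ?_ _
    refine Continuous.integrable_of_hasCompactSupport (by fun_prop) ?_
    refine HasCompactSupport.intro (isCompact_Icc (a := (-1 : ℝ)) (b := 1)) fun v hv => ?_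
    have : 1 < |v| := by
      by_contra h
      exact hv (abs_le.1 (not_lt.1 h))
    rw [max_eq_left (by nlinarith), zero_pow hn.ne']
  · exact Filter.Eventually.of_forall fun v => mul_nonneg (unitBallVol_pos _).le (by positivity)

lemma capIntegral_nonneg (n : ℕ) (hn : 0 < n) {u : ℝ} (hu : 0 ≤ u) : 0 ≤ capIntegral n u := by
  have := integral_cap n hn hu
  have h2 : 0 ≤ ∫ v : ℝ, (max 0 (1 - (|v| + u) ^ 2)) ^ n :=
    integral_nonneg fun v => by positivity
  linarith

lemma ballOverlap_eq_capIntegral (n : ℕ) (hn : 0 < n) {u : ℝ} (hu : 0 ≤ u) :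
    ballOverlap (2 * n + 1) u =
      2 * unitBallVol (2 * n) / unitBallVol (2 * n + 1) * capIntegral n (u / 2) := by
  rw [ballOverlap, volume_inter_closedBall_congr
    (a' := EuclideanSpace.single 0 (u / 2)) (b' := EuclideanSpace.single 0 (-(u / 2))),
    volume_lens n hn (by positivity), ENNReal.toReal_ofReal]
  · ring
  · exact mul_nonneg (mul_nonneg zero_le_two (unitBallVol_pos _).le)
      (capIntegral_nonneg n hn (by positivity))
  · rw [dist_zero_left, norm_smul, norm_unitVec (by omega), mul_one, Real.norm_of_nonneg hu,
      PiLp.dist_single_same, Real.dist_eq, abs_of_nonneg (by linarith)]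
    ring

end

/-! ### Smooth bumps as signed superpositions of overlap profiles -/

section

open scoped ContDiff in
lemma tsupport_deriv_subset_of {f : ℝ → ℝ} {s : Set ℝ} (h : tsupport f ⊆ s) :
    tsupport (deriv f) ⊆ s :=
  (closure_minimal support_deriv_subset (isClosed_tsupport f)).trans h

lemma hasDerivAt_integral_one_sub_sq (n : ℕ) (x : ℝ) :
    HasDerivAt (fun x => ∫ v in x..1, (1 - v ^ 2) ^ n) (-(1 - x ^ 2) ^ n) x := by
  have hc : Continuous (fun v : ℝ => (1 - v ^ 2) ^ n) := by fun_prop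
  exact intervalIntegral.integral_hasDerivAt_left (hc.intervalIntegrable _ _)
    (hc.stronglyMeasurableAtFilter _ _) hc.continuousAt

/-- The difference of the two sides has zero derivative and vanishes at 1. -/
lemma integral_one_sub_sq_succ (n : ℕ) (x : ℝ) :
    (2 * n + 3) * (∫ v in x..1, (1 - v ^ 2) ^ (n + 1)) + x * (1 - x ^ 2) ^ (n + 1) =
      2 * (n + 1) * ∫ v in x..1, (1 - v ^ 2) ^ n := by
  let f : ℝ → ℝ := fun x => (2 * n + 3) * (∫ v in x..1, (1 - v ^ 2) ^ (n + 1)) +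
    x * (1 - x ^ 2) ^ (n + 1) - 2 * (n + 1) * ∫ v in x..1, (1 - v ^ 2) ^ n
  have hf : ∀ x, HasDerivAt f 0 x := by
    intro x
    have h1 := (hasDerivAt_integral_one_sub_sq (n + 1) x).const_mul (2 * n + 3 : ℝ)
    have h2 := (hasDerivAt_integral_one_sub_sq n x).const_mul (2 * (n + 1) : ℝ)
    have h3 : HasDerivAt (fun x : ℝ => x * (1 - x ^ 2) ^ (n + 1))
        ((1 - x ^ 2) ^ (n + 1) + x * ((n + 1) * (1 - x ^ 2) ^ n * (-(2 * x)))) x := by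
      have h4 : HasDerivAt (fun x : ℝ => 1 - x ^ 2) (-(2 * x)) x := by
        simpa using (hasDerivAt_pow 2 x).const_sub 1
      have h5 := (hasDerivAt_id x).mul (h4.pow (n + 1))
      convert! h5 using 1
      simp
    convert! (h1.add h3).sub h2 using 1
    ring
  have h := is_const_of_deriv_eq_zero (fun x => (hf x).differentiableAt) (fun x => (hf x).deriv) x 1
  have h1 : f 1 = 0 := by simp [f]
  rw [h1] at h
  simp only [f] at h
  linarith

/-- Differentiation in `r` lowers the exponent from `n + 1` to `n`, that is, the dimension from 2n+3
to 2n+1. This recursion drives the induction in `exists_smooth_representation`. -/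
lemma hasDerivAt_pow_mul_integral (n : ℕ) (u : ℝ) {r : ℝ} (hr : 0 < r) :
    HasDerivAt (fun r => r ^ (2 * n + 3) * ∫ v in (u / r)..1, (1 - v ^ 2) ^ (n + 1))
      (2 * (n + 1) * r * (r ^ (2 * n + 1) * ∫ v in (u / r)..1, (1 - v ^ 2) ^ n)) r := by
  have h1 : HasDerivAt (fun r : ℝ => u / r) (-(u / r ^ 2)) r := by
    simpa [div_eq_mul_inv] using (hasDerivAt_inv hr.ne').const_mul u
  have h2 := (hasDerivAt_integral_one_sub_sq (n + 1) (u / r)).comp r h1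
  have h3 := (hasDerivAt_pow (2 * n + 3) r).mul h2
  convert! h3 using 1
  have h4 := integral_one_sub_sq_succ n (u / r)
  have h5 : 2 * (n + 1) * r * (r ^ (2 * n + 1) * ∫ v in (u / r)..1, (1 - v ^ 2) ^ n) =
    r ^ (2 * n + 2) * (2 * (n + 1) * ∫ v in (u / r)..1, (1 - v ^ 2) ^ n) := by ring
  rw [h5, ← h4]
  simp only [Function.comp]
  have h6 : r ^ (2 * n + 3) * (-(1 - (u / r) ^ 2) ^ (n + 1) * -(u / r ^ 2)) =
      r ^ (2 * n + 2) * ((u / r) * (1 - (u / r) ^ 2) ^ (n + 1)) := by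
    field_simp
    ring
  rw [h6]
  push_cast
  rw [mul_add]
  ring

open scoped ContDiff in
-- The base case is Taylor's formula B(u) = ∫ (r - u) B''(r) dr. Each further step divides the
-- weight by 2(n+1)r, which is harmless because the support stays away from 0, and integrates by
-- parts once. The boundary terms vanish: at `b` by the support condition, at `u` because the inner
-- integral runs from 1 to 1.
lemma exists_smooth_representation {a b : ℝ} (ha : 0 < a) {B : ℝ → ℝ} (hB : ContDiff ℝ ∞ B)
    (hs : tsupport B ⊆ Set.Ioo a b) (n : ℕ) :
    ∃ β : ℝ → ℝ, ContDiff ℝ ∞ β ∧ tsupport β ⊆ Set.Ioo a b ∧ ∀ u, 0 < u → u ≤ b →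
      B u = ∫ r in u..b, β r * (r ^ (2 * n + 1) * ∫ v in (u / r)..1, (1 - v ^ 2) ^ n) := by
  have hzero : ∀ {f : ℝ → ℝ}, tsupport f ⊆ Set.Ioo a b → f b = 0 := fun hf =>
    image_eq_zero_of_notMem_tsupport fun h => lt_irrefl _ (hf h).2
  induction n with
  | zero =>
    have h1 : ContDiff ℝ ∞ (deriv B) := (contDiff_infty_iff_deriv.1 hB).2
    have h2 : ContDiff ℝ ∞ (deriv (deriv B)) := (contDiff_infty_iff_deriv.1 h1).2
    have hs1 := tsupport_deriv_subset_of hs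
    refine ⟨_, h2, tsupport_deriv_subset_of hs1, fun u hu hub => ?_⟩
    have e1 : ∫ r in u..b, deriv (deriv B) r * (r ^ (2 * 0 + 1) *
        ∫ v in (u / r)..1, (1 - v ^ 2) ^ 0) = ∫ r in u..b, (r - u) * deriv (deriv B) r := by
      refine intervalIntegral.integral_congr fun r hr => ?_
      rw [Set.uIcc_of_le hub] at hr
      have : r ≠ 0 := (hu.trans_le hr.1).ne'
      simp
      field_simp
    have e2 := intervalIntegral.integral_mul_deriv_eq_deriv_mul (a := u) (b := b)
      (u := fun r => r - u) (v := deriv B) (u' := fun _ => 1) (v' := deriv (deriv B))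
      (fun x _ => (hasDerivAt_id x).sub_const u)
      (fun x _ => (h1.differentiable (by simp) x).hasDerivAt)
      (by simp) (h2.continuous.intervalIntegrable _ _)
    have e3 : ∫ r in u..b, 1 * deriv B r = B b - B u := by
      simp only [one_mul]
      exact intervalIntegral.integral_deriv_eq_sub (fun x _ => hB.differentiable (by simp) x)
        (h1.continuous.intervalIntegrable _ _)
    rw [e1, e2, e3, hzero hs, hzero hs1]
    simp
  | succ n ih =>
    obtain ⟨β, hβ, hβs, h⟩ := ih
    let γ : ℝ → ℝ := fun r => β r * (2 * (n + 1) * r)⁻¹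
    have hγs : tsupport γ ⊆ Set.Ioo a b := (tsupport_mul_subset_left).trans hβs
    have hγ : ContDiff ℝ ∞ γ := by
      rw [contDiff_iff_contDiffAt]
      intro x
      by_cases hx : x ∈ tsupport β
      · have hx0 : 0 < x := ha.trans (hβs hx).1
        refine hβ.contDiffAt.mul (ContDiffAt.inv (by fun_prop) (by positivity))
      · have : γ =ᶠ[nhds x] fun _ => 0 := by
          filter_upwards [notMem_tsupport_iff_eventuallyEq.1 hx] with y hy
          simp [γ, hy]
        exact contDiffAt_const.congr_of_eventuallyEq this
    have hγ' : ContDiff ℝ ∞ (deriv γ) := (contDiff_infty_iff_deriv.1 hγ).2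
    refine ⟨fun r => - deriv γ r, hγ'.neg, ?_, fun u hu hub => ?_⟩
    · have := tsupport_deriv_subset_of hγs
      rwa [← tsupport_neg] at this
    · have e2 := intervalIntegral.integral_mul_deriv_eq_deriv_mul (a := u) (b := b)
        (u := γ) (v := fun r => r ^ (2 * n + 3) * ∫ v in (u / r)..1, (1 - v ^ 2) ^ (n + 1))
        (u' := deriv γ)
        (v' := fun r => 2 * (n + 1) * r * (r ^ (2 * n + 1) * ∫ v in (u / r)..1, (1 - v ^ 2) ^ n))
        (fun x _ => (hγ.differentiable (by simp) x).hasDerivAt)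
        (fun x hx => hasDerivAt_pow_mul_integral n u (by
          rw [Set.uIcc_of_le hub] at hx; exact hu.trans_le hx.1))
        (hγ'.continuous.intervalIntegrable _ _)
        (by
          apply ContinuousOn.intervalIntegrable
          intro r hr
          rw [Set.uIcc_of_le hub] at hr
          have hr0 : r ≠ 0 := (hu.trans_le hr.1).ne'
          have hc : ContinuousAt (fun x : ℝ => ∫ v in x..1, (1 - v ^ 2) ^ n) (u / r) :=
            (hasDerivAt_integral_one_sub_sq n (u / r)).continuousAt
          have hd : ContinuousAt (fun r : ℝ => u / r) r := by fun_prop (disch := assumption)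
          have he := ContinuousAt.comp (f := fun r : ℝ => u / r) (x := r) hc hd
          refine ContinuousAt.continuousWithinAt ?_
          refine ContinuousAt.mul (by fun_prop) (ContinuousAt.mul (by fun_prop) he))
      rw [h u hu hub]
      have e1 : ∫ r in u..b, β r * (r ^ (2 * n + 1) * ∫ v in (u / r)..1, (1 - v ^ 2) ^ n) =
          ∫ r in u..b, γ r * (2 * (n + 1) * r *
            (r ^ (2 * n + 1) * ∫ v in (u / r)..1, (1 - v ^ 2) ^ n)) := by
        refine intervalIntegral.integral_congr fun r hr => ?_
        rw [Set.uIcc_of_le hub] at hr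
        have : r ≠ 0 := (hu.trans_le hr.1).ne'
        have : (n : ℝ) + 1 ≠ 0 := by positivity
        simp only [γ]
        field_simp
      rw [e1, e2, hzero hγs, div_self hu.ne', intervalIntegral.integral_same]
      simp only [zero_mul, mul_zero, sub_zero, zero_sub, neg_mul, intervalIntegral.integral_neg]
      rfl

lemma exists_bump_capIntegral (n : ℕ) :
    ∃ B α : ℝ → ℝ, Continuous B ∧ (∀ x, 0 ≤ B x) ∧ B 1 = 1 ∧
      (∀ x, x ∉ Set.Ioo (1 / 2 : ℝ) (3 / 2) → B x = 0) ∧ Continuous α ∧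
      (∀ x, x ∉ Set.Ioo (1 / 2 : ℝ) (3 / 2) → α x = 0) ∧
      ∀ u, 0 < u → B u = ∫ r in Set.Ioi 0, α r * capIntegral n (u / r) := by
  let f : ContDiffBump (1 : ℝ) := ⟨1 / 8, 1 / 4, by norm_num, by norm_num⟩
  have hs : tsupport f ⊆ Set.Ioo (1 / 2 : ℝ) (3 / 2) := by
    rw [f.tsupport_eq, Real.closedBall_eq_Icc]
    intro x hx
    simp only [f, Set.mem_Icc] at hx
    constructor <;> linarith [hx.1, hx.2]
  obtain ⟨β, hβ, hβs, h⟩ := exists_smooth_representation (by norm_num) f.contDiff hs n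
  have hβ0 : ∀ x, x ∉ Set.Ioo (1 / 2 : ℝ) (3 / 2) → β x = 0 := fun x hx =>
    image_eq_zero_of_notMem_tsupport fun h => hx (hβs h)
  refine ⟨f, fun r => β r * r ^ (2 * n + 1), f.continuous, fun x => f.nonneg,
    f.one_of_mem_closedBall (by simp [f]), fun x hx => image_eq_zero_of_notMem_tsupport
    fun h => hx (hs h), by have := hβ.continuous; fun_prop, fun x hx => by simp [hβ0 x hx],
    fun u hu => ?_⟩
  have hcap : ∀ r, 0 < r → r ≤ u → capIntegral n (u / r) = 0 := fun r hr hru => by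
    rw [capIntegral, min_eq_right ((one_le_div hr).2 hru), intervalIntegral.integral_same]
  rcases le_or_gt u (3 / 2) with hub | hub
  · rw [h u hu hub, intervalIntegral.integral_of_le hub]
    symm
    rw [setIntegral_eq_of_subset_of_forall_sdiff_eq_zero (s := Set.Ioc u (3 / 2))
      measurableSet_Ioi (fun r hr => hu.trans hr.1)]
    · refine setIntegral_congr_fun measurableSet_Ioc fun r hr => ?_
      have hr0 : 0 < r := hu.trans hr.1
      rw [capIntegral, min_eq_left ((div_le_one hr0).2 hr.1.le)]
      ring
    · intro r hr
      rcases le_or_gt r u with h1 | h1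
      · rw [hcap r hr.1 h1, mul_zero]
      · simp [hβ0 r (fun h2 => hr.2 ⟨h1, h2.2.le⟩)]
  · have h0 : f u = 0 := image_eq_zero_of_notMem_tsupport fun h => by linarith [(hs h).2]
    rw [h0]
    symm
    refine setIntegral_eq_zero_of_forall_eq_zero fun r hr => ?_
    rcases le_or_gt r u with h1 | h1
    · rw [hcap r hr h1, mul_zero]
    · simp [hβ0 r (fun h2 => by linarith [h2.2])]

/-- The profile of a radial positive definite kernel: the normalised volume of the intersection of
two balls of radius `1/2` of `ℝ^(2n+1)`, as a function of the distance of their centres. -/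
def profile (n : ℕ) (u : ℝ) : ℝ := ballOverlap (2 * n + 1) (2 * u)

lemma measurable_profile (n : ℕ) : Measurable (profile n) :=
  (measurable_ballOverlap _).comp (measurable_const_mul 2)

lemma profile_nonneg (n : ℕ) (u : ℝ) : 0 ≤ profile n u := ballOverlap_nonneg _ _

lemma profile_le_one (n : ℕ) (u : ℝ) : profile n u ≤ 1 := ballOverlap_le_one _ _

lemma profile_zero (n : ℕ) : profile n 0 = 1 := by simp [profile, ballOverlap_zero]

lemma profile_eq_zero (n : ℕ) {u : ℝ} (hu : 1 < u) : profile n u = 0 :=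
  ballOverlap_eq_zero (by omega) (by linarith)

lemma volume_inter_closedBall_profile (n : ℕ) (a b : Euc (2 * n + 1)) {r : ℝ} (hr : 0 < r) :
    volume (closedBall a (r / 2) ∩ closedBall b (r / 2)) =
      ENNReal.ofReal ((r / 2) ^ (2 * n + 1) * unitBallVol (2 * n + 1) * profile n (dist a b / r)) := by
  rw [volume_inter_closedBall (by omega) a b (by positivity : 0 < r / 2), profile]
  congr 3
  field_simp

/-- A bump function `B` supported in `[1/2, 3/2]`, written as a superposition of rescaled profiles
with a signed continuous weight `α` that is also supported in `[1/2, 3/2]`. -/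
structure BumpRepr (n : ℕ) where
  B : ℝ → ℝ
  α : ℝ → ℝ
  continuous_B : Continuous B
  B_nonneg : ∀ x, 0 ≤ B x
  B_one : B 1 = 1
  B_support : ∀ x, x ∉ Set.Ioo (1 / 2 : ℝ) (3 / 2) → B x = 0
  continuous_α : Continuous α
  α_support : ∀ x, x ∉ Set.Ioo (1 / 2 : ℝ) (3 / 2) → α x = 0
  repr : ∀ u, 0 < u → B u = ∫ r in Set.Ioi 0, α r * profile n (u / r)

lemma nonempty_bumpRepr (n : ℕ) (hn : 0 < n) : Nonempty (BumpRepr n) := by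
  obtain ⟨B, α, h1, h2, h3, h4, h5, h6, h7⟩ := exists_bump_capIntegral n
  set K := 2 * unitBallVol (2 * n) / unitBallVol (2 * n + 1) with hK
  have hKpos : 0 < K := by
    have := unitBallVol_pos (2 * n)
    have := unitBallVol_pos (2 * n + 1)
    positivity
  refine ⟨⟨B, fun r => α r * K⁻¹, h1, h2, h3, h4, by fun_prop, fun x hx => by simp [h6 x hx],
    fun u hu => ?_⟩⟩
  rw [h7 u hu]
  refine setIntegral_congr_fun measurableSet_Ioi fun r hr => ?_
  have hr' : 0 < r := hr
  have : 0 ≤ 2 * (u / r) := by positivity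
  simp only [profile]
  rw [ballOverlap_eq_capIntegral n hn this, ← hK, mul_div_cancel_left₀ _ two_ne_zero]
  field_simp

end

/-! ### The scaling identity and bounds uniform in the exponent -/

section

lemma integral_Ioi_comp_div {c : ℝ} (hc : 0 < c) (f : ℝ → ℝ) :
    ∫ t in Set.Ioi 0, f t = ∫ x in Set.Ioi 0, c * x ^ (-2 : ℝ) * f (c / x) := by
  have h1 := integral_comp_rpow_Ioi (fun x => c * f (c * x)) (p := -1) (by norm_num)
  have h2 := integral_comp_mul_left_Ioi f 0 hc
  rw [mul_zero] at h2
  rw [integral_const_mul, h2, smul_eq_mul, mul_inv_cancel_left₀ hc.ne'] at h1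
  rw [← h1]
  refine setIntegral_congr_fun measurableSet_Ioi fun x hx => ?_
  simp only [abs_neg, abs_one, one_mul, smul_eq_mul, Real.rpow_neg_one, div_eq_mul_inv]
  norm_num
  ring

namespace BumpRepr

variable {n : ℕ} (D : BumpRepr n)

/-- The normalisation `∫ t^(s-1) B(t) dt`. -/
def mass (s : ℝ) : ℝ := ∫ t in Set.Ioi 0, t ^ (s - 1) * D.B t

/-- The probability density `t^(s-1) B(t)`, normalised. -/
def density (s t : ℝ) : ℝ := t ^ (s - 1) * D.B t / D.mass s

/-- The normalised average `∫ α(r) r^s g(x/r) dr`. -/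
def average (s : ℝ) (g : ℝ → ℝ) (x : ℝ) : ℝ :=
  (∫ r in Set.Ioi 0, D.α r * r ^ s * g (x / r)) / D.mass s

lemma integrableOn_of_support {f : ℝ → ℝ} (hf : ContinuousOn f (Set.Icc (1 / 2 : ℝ) (3 / 2)))
    (h0 : ∀ x, x ∉ Set.Ioo (1 / 2 : ℝ) (3 / 2) → f x = 0) : IntegrableOn f (Set.Ioi 0) := by
  refine (hf.integrableOn_compact isCompact_Icc).of_forall_sdiff_eq_zero measurableSet_Ioi
    fun x hx => h0 x fun h => hx.2 ⟨h.1.le, h.2.le⟩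

lemma continuousOn_rpow_Icc (s : ℝ) :
    ContinuousOn (fun t : ℝ => t ^ s) (Set.Icc (1 / 2 : ℝ) (3 / 2)) := fun t ht =>
  (Real.continuousAt_rpow_const t s (Or.inl (by linarith [ht.1] : (0 : ℝ) < t).ne')).continuousWithinAt

lemma integrableOn_rpow_mul_B (s : ℝ) :
    IntegrableOn (fun t => t ^ s * D.B t) (Set.Ioi 0) :=
  integrableOn_of_support ((continuousOn_rpow_Icc s).mul D.continuous_B.continuousOn)
    fun x hx => by simp [D.B_support x hx]

lemma integrableOn_α_mul_rpow (s : ℝ) :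
    IntegrableOn (fun t => D.α t * t ^ s) (Set.Ioi 0) :=
  integrableOn_of_support (D.continuous_α.continuousOn.mul (continuousOn_rpow_Icc s))
    fun x hx => by simp [D.α_support x hx]

lemma integrableOn_average {g : ℝ → ℝ} (hg : Measurable g) {G : ℝ} (hG : ∀ x, |g x| ≤ G)
    (s x : ℝ) : IntegrableOn (fun r => D.α r * r ^ s * g (x / r)) (Set.Ioi 0) := by
  have hm : Measurable (fun r => g (x / r)) := hg.comp (measurable_const.div measurable_id)
  exact (D.integrableOn_α_mul_rpow s).mul_bdd (c := G) hm.aestronglyMeasurable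
    (Filter.Eventually.of_forall fun r => hG _)

/-- Insert the representation of B, exchange the integrals and substitute t = r u / x for fixed r.
Then t/r becomes u/x and u/t becomes x/r, so that g no longer sees u and only the profile does. The
factor t^(s-1) is exactly what cancels the power of u. A second exchange finishes. -/
theorem rpow_mul_integral_eq {g : ℝ → ℝ} (hg : Measurable g) {G : ℝ} (hG : ∀ x, |g x| ≤ G)
    {s u : ℝ} (hs : 0 < s) (hu : 0 < u) :
    u ^ (-s) * ∫ t in Set.Ioi 0, t ^ (s - 1) * D.B t * g (u / t) =
      ∫ x in Set.Ioi 0, profile n (u / x) *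
        (x ^ (-s - 1) * ∫ r in Set.Ioi 0, D.α r * r ^ s * g (x / r)) := by
  have mα := D.continuous_α.measurable
  have mk := measurable_profile n
  have hG0 : 0 ≤ G := (abs_nonneg _).trans (hG 0)
  have hk1 : ∀ x, |profile n x| ≤ 1 := fun x => by
    rw [abs_of_nonneg (profile_nonneg n x)]; exact profile_le_one n x
  have hα : IntegrableOn (fun r => |D.α r|) (Set.Ioi 0) := by
    have := (D.integrableOn_α_mul_rpow 0).abs
    simp only [Real.rpow_zero, mul_one] at this
    exact this
  have step1 : ∫ t in Set.Ioi 0, t ^ (s - 1) * D.B t * g (u / t) =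
      ∫ t in Set.Ioi 0, ∫ r in Set.Ioi 0, t ^ (s - 1) * g (u / t) * (D.α r * profile n (t / r)) := by
    refine setIntegral_congr_fun measurableSet_Ioi fun t ht => ?_
    rw [integral_const_mul, ← D.repr t ht]
    ring
  have int1 : Integrable (Function.uncurry fun t r : ℝ =>
      t ^ (s - 1) * g (u / t) * (D.α r * profile n (t / r)))
      ((volume.restrict (Set.Ioi 0)).prod (volume.restrict (Set.Ioi 0))) := by
    have hi : IntegrableOn (Set.indicator (Set.Ioc 0 (3 / 2)) fun t : ℝ => t ^ (s - 1))
        (Set.Ioi 0) := by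
      apply Integrable.integrableOn
      rw [integrable_indicator_iff measurableSet_Ioc]
      have := intervalIntegral.intervalIntegrable_rpow' (a := 0) (b := 3 / 2)
        (by linarith : -1 < s - 1)
      exact (intervalIntegrable_iff_integrableOn_Ioc_of_le (by norm_num)).1 this
    refine (hi.mul_prod (hα.const_mul G)).mono' ?_ ?_
    · apply Measurable.aestronglyMeasurable
      unfold Function.uncurry
      fun_prop
    · rw [Measure.prod_restrict]
      refine ae_restrict_of_forall_mem (measurableSet_Ioi.prod measurableSet_Ioi) ?_
      rintro ⟨t, r⟩ ⟨ht, hr⟩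
      have ht : 0 < t := ht
      have hr : 0 < r := hr
      simp only [Function.uncurry, Real.norm_eq_abs, abs_mul]
      -- For larger `t`, every `r` in the support of `α` is below `t`, so the profile vanishes.
      by_cases hc : t ≤ 3 / 2
      · rw [Set.indicator_of_mem (show t ∈ Set.Ioc 0 (3 / 2) from ⟨ht, hc⟩),
          abs_of_pos (Real.rpow_pos_of_pos ht _), mul_assoc]
        refine mul_le_mul_of_nonneg_left ?_ (Real.rpow_nonneg ht.le _)
        refine mul_le_mul (hG _) ?_ (by positivity) hG0
        exact mul_le_of_le_one_right (abs_nonneg _) (hk1 _)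
      · have : D.α r * profile n (t / r) = 0 := by
          by_cases h : r ∈ Set.Ioo (1 / 2 : ℝ) (3 / 2)
          · rw [profile_eq_zero n, mul_zero]
            rw [one_lt_div hr]
            linarith [h.2, not_le.1 hc]
          · rw [D.α_support r h, zero_mul]
        rw [← abs_mul (D.α r), this, abs_zero, mul_zero]
        have : 0 ≤ Set.indicator (Set.Ioc 0 (3 / 2)) (fun t : ℝ => t ^ (s - 1)) t :=
          Set.indicator_nonneg (fun t ht => Real.rpow_nonneg ht.1.le _) t
        positivity
  have int2 : Integrable (Function.uncurry fun r x : ℝ =>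
      (D.α r * r ^ s) * (x ^ (-s - 1) * profile n (u / x) * g (x / r)))
      ((volume.restrict (Set.Ioi 0)).prod (volume.restrict (Set.Ioi 0))) := by
    have hi : IntegrableOn (Set.indicator (Set.Ici u) fun t : ℝ => t ^ (-s - 1))
        (Set.Ioi 0) := by
      apply Integrable.integrableOn
      rw [integrable_indicator_iff measurableSet_Ici, integrableOn_Ici_iff_integrableOn_Ioi]
      exact integrableOn_Ioi_rpow_of_lt (by linarith) hu
    refine ((D.integrableOn_α_mul_rpow s).abs.mul_prod (hi.mul_const G)).mono' ?_ ?_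
    · apply Measurable.aestronglyMeasurable
      unfold Function.uncurry
      fun_prop
    · rw [Measure.prod_restrict]
      refine ae_restrict_of_forall_mem (measurableSet_Ioi.prod measurableSet_Ioi) ?_
      rintro ⟨r, x⟩ ⟨hr, hx⟩
      have hr : 0 < r := hr
      have hx : 0 < x := hx
      simp only [Function.uncurry, Real.norm_eq_abs]
      rw [abs_mul]
      refine mul_le_mul_of_nonneg_left ?_ (abs_nonneg _)
      rw [abs_mul]
      refine mul_le_mul ?_ (hG _) (abs_nonneg _) ?_
      · by_cases hc : u ≤ x
        · rw [Set.indicator_of_mem (show x ∈ Set.Ici u from hc), abs_mul,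
            abs_of_pos (Real.rpow_pos_of_pos hx _)]
          exact mul_le_of_le_one_right (Real.rpow_nonneg hx.le _) (hk1 _)
        · rw [profile_eq_zero n ((one_lt_div hx).2 (not_le.1 hc)), mul_zero, abs_zero]
          exact Set.indicator_nonneg (fun t ht => Real.rpow_nonneg (hu.le.trans ht) _) x
      · exact Set.indicator_nonneg (fun t ht => Real.rpow_nonneg (hu.le.trans ht) _) x
  have step2 : ∀ r ∈ Set.Ioi (0 : ℝ),
      ∫ t in Set.Ioi 0, t ^ (s - 1) * g (u / t) * (D.α r * profile n (t / r)) =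
      ∫ x in Set.Ioi 0, u ^ s * ((D.α r * r ^ s) * (x ^ (-s - 1) * profile n (u / x) * g (x / r))) := by
    intro r hr
    have hr : 0 < r := hr
    rw [integral_Ioi_comp_div (mul_pos hr hu : 0 < r * u)]
    refine setIntegral_congr_fun measurableSet_Ioi fun x hx => ?_
    have hx : 0 < x := hx
    have e1 : u / (r * u / x) = x / r := by field_simp
    have e2 : r * u / x / r = u / x := by field_simp
    rw [e1, e2, Real.div_rpow (by positivity) hx.le, Real.mul_rpow hr.le hu.le,
      Real.rpow_sub_one hr.ne', Real.rpow_sub_one hu.ne', Real.rpow_sub_one hx.ne',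
      show (-s - 1 : ℝ) = -2 - (s - 1) by ring, Real.rpow_sub hx, Real.rpow_sub_one hx.ne']
    field_simp
  rw [step1, integral_integral_swap int1, setIntegral_congr_fun measurableSet_Ioi step2]
  simp_rw [integral_const_mul (u ^ s)]
  rw [← mul_assoc, ← Real.rpow_add hu, neg_add_cancel, Real.rpow_zero, one_mul,
    integral_integral_swap int2]
  refine setIntegral_congr_fun measurableSet_Ioi fun x hx => ?_
  rw [← integral_const_mul, ← integral_const_mul]
  refine integral_congr_ae (Filter.Eventually.of_forall fun r => ?_)
  simp only
  ring

lemma exists_le_mass (a : ℝ) : ∃ K, 0 < K ∧ ∀ s, 0 < s → s ≤ a → K ≤ D.mass s := by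
  have hB : 0 < ∫ t, D.B t := by
    refine D.continuous_B.integral_pos_of_hasCompactSupport_nonneg_nonzero ?_ D.B_nonneg
      (x := 1) (by simp [D.B_one])
    exact HasCompactSupport.intro (isCompact_Icc (a := (1 / 2 : ℝ)) (b := 3 / 2))
      fun x hx => D.B_support x fun h => hx ⟨h.1.le, h.2.le⟩
  have hB' : ∫ t in Set.Ioi 0, D.B t = ∫ t, D.B t :=
    setIntegral_eq_integral_of_forall_compl_eq_zero fun x hx =>
      D.B_support x fun h => hx (Set.mem_Ioi.2 (by linarith [h.1]))
  refine ⟨(1 / 2) ^ a * (2 / 3) * ∫ t, D.B t, by positivity, fun s hs hsa => ?_⟩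
  rw [← hB', ← integral_const_mul, mass]
  have hi : IntegrableOn D.B (Set.Ioi 0) := by
    have := D.integrableOn_rpow_mul_B 0
    simpa only [Real.rpow_zero, one_mul] using this
  refine setIntegral_mono_on (hi.const_mul _) (D.integrableOn_rpow_mul_B _) measurableSet_Ioi
    fun t ht => ?_
  by_cases h : t ∈ Set.Ioo (1 / 2 : ℝ) (3 / 2)
  · refine mul_le_mul_of_nonneg_right ?_ (D.B_nonneg t)
    have ht : 0 < t := ht
    have h1 : (1 / 2 : ℝ) ^ a ≤ (1 / 2) ^ s :=
      Real.rpow_le_rpow_of_exponent_ge (by norm_num) (by norm_num) hsa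
    have h2 : (1 / 2 : ℝ) ^ s ≤ t ^ s := Real.rpow_le_rpow (by norm_num) h.1.le hs.le
    rw [Real.rpow_sub_one ht.ne', div_eq_mul_inv]
    refine mul_le_mul (h1.trans h2) ?_ (by norm_num) (by positivity)
    rw [le_inv_comm₀ (by norm_num) ht]
    linarith [h.2]
  · simp [D.B_support t h]

/-- Only the values of `g` at `x / r` with `r` in the support of `α` matter, and the mass is bounded
below uniformly in `s`, so `K` does not depend on `s`. -/
lemma exists_average_bound (a : ℝ) : ∃ K, 0 < K ∧ ∀ s, 0 < s → s ≤ a → ∀ (g : ℝ → ℝ) (x γ : ℝ),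
    (∀ r ∈ Set.Ioo (1 / 2 : ℝ) (3 / 2), |g (x / r)| ≤ γ) → |D.average s g x| ≤ K * γ := by
  obtain ⟨m, hm, hmass⟩ := D.exists_le_mass a
  have hα : IntegrableOn (fun r => |D.α r|) (Set.Ioi 0) := by
    have := (D.integrableOn_α_mul_rpow 0).abs
    simp only [Real.rpow_zero, mul_one] at this
    exact this
  set I := ∫ r in Set.Ioi 0, |D.α r| with hI
  have hI0 : 0 ≤ I := integral_nonneg fun r => abs_nonneg _
  refine ⟨(I + 1) * 2 ^ a / m, by positivity, fun s hs hsa g x γ hγ => ?_⟩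
  have hγ0 : 0 ≤ γ := (abs_nonneg _).trans (hγ 1 (by norm_num))
  have h1 : |∫ r in Set.Ioi 0, D.α r * r ^ s * g (x / r)| ≤
      ∫ r in Set.Ioi 0, |D.α r| * (2 ^ a * γ) := by
    rw [← Real.norm_eq_abs]
    refine norm_integral_le_of_norm_le (hα.mul_const _) ?_
    refine ae_restrict_of_forall_mem measurableSet_Ioi fun r hr => ?_
    have hr : 0 < r := hr
    rw [Real.norm_eq_abs, abs_mul, abs_mul, mul_assoc]
    by_cases h : r ∈ Set.Ioo (1 / 2 : ℝ) (3 / 2)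
    · refine mul_le_mul_of_nonneg_left (mul_le_mul ?_ (hγ r h) (abs_nonneg _) (by positivity))
        (abs_nonneg _)
      rw [abs_of_pos (Real.rpow_pos_of_pos hr _)]
      calc r ^ s ≤ 2 ^ s := Real.rpow_le_rpow hr.le (by linarith [h.2]) hs.le
        _ ≤ 2 ^ a := Real.rpow_le_rpow_of_exponent_le (by norm_num) hsa
    · simp [D.α_support r h]
  rw [integral_mul_const, ← hI] at h1
  have hms := hmass s hs hsa
  rw [average, abs_div, abs_of_pos (hm.trans_le hms), div_le_iff₀ (hm.trans_le hms)]
  calc _ ≤ I * (2 ^ a * γ) := h1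
    _ ≤ (I + 1) * (2 ^ a * γ) := by gcongr; linarith
    _ = (I + 1) * 2 ^ a / m * γ * m := by field_simp
    _ ≤ _ := by gcongr

/-- As `α` is signed, even positivity is not evident. The scaling identity with g = 1 and u = 1
reads mass = I c, where I = ∫ p(1/x) x^(-s-1) dx and c = ∫ α(r) r^s dr. Since p is at most 1 and
vanishes beyond 1, I is at most ∫ x^(-s-1) dx over x > 1, which is 1/s. Hence c / mass ≥ s. -/
lemma le_average_one {s : ℝ} (hs : 0 < s) : s ≤ D.average s (fun _ => 1) 0 := by
  obtain ⟨m, hm, hmass⟩ := D.exists_le_mass s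
  have hm := hm.trans_le (hmass s hs le_rfl)
  have h := D.rpow_mul_integral_eq (g := fun _ => 1) measurable_const (G := 1) (by simp) hs one_pos
  simp only [Real.one_rpow, one_mul, mul_one] at h
  set c := ∫ r in Set.Ioi 0, D.α r * r ^ s with hc
  have e : ∀ x : ℝ, profile n (1 / x) * (x ^ (-s - 1) * c) = profile n (1 / x) * x ^ (-s - 1) * c :=
    fun x => by ring
  simp_rw [e] at h
  rw [integral_mul_const] at h
  set I := ∫ x in Set.Ioi 0, profile n (1 / x) * x ^ (-s - 1) with hI
  have hmI : D.mass s = I * c := h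
  have hI0 : 0 ≤ I := setIntegral_nonneg measurableSet_Ioi fun x hx =>
    mul_nonneg (profile_nonneg _ _) (Real.rpow_nonneg (le_of_lt hx) _)
  have hint : IntegrableOn (fun x : ℝ => x ^ (-s - 1)) (Set.Ioi 1) :=
    integrableOn_Ioi_rpow_of_lt (by linarith) one_pos
  have hI1 : I ≤ 1 / s := by
    have h2 : ∫ x in Set.Ioi 1, x ^ (-s - 1) = 1 / s := by
      rw [integral_Ioi_rpow_of_lt (by linarith) one_pos]
      rw [Real.one_rpow, show -s - 1 + 1 = -s by ring, neg_div_neg_eq]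
    rw [← h2, hI, setIntegral_eq_of_subset_of_ae_sdiff_eq_zero (s := Set.Ioi 1)
      measurableSet_Ioi.nullMeasurableSet (Set.Ioi_subset_Ioi zero_le_one)]
    · refine integral_mono_of_nonneg ?_ hint ?_
      · refine ae_restrict_of_forall_mem measurableSet_Ioi fun x hx => ?_
        exact mul_nonneg (profile_nonneg _ _) (Real.rpow_nonneg (zero_le_one.trans (le_of_lt hx)) _)
      · refine ae_restrict_of_forall_mem measurableSet_Ioi fun x hx => ?_
        exact mul_le_of_le_one_left (Real.rpow_nonneg (zero_le_one.trans (le_of_lt hx)) _)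
          (profile_le_one _ _)
    · have : ∀ᵐ x : ℝ, x ≠ 1 := by simp [ae_iff]
      filter_upwards [this] with x hx1 hx
      rw [profile_eq_zero, zero_mul]
      rw [one_lt_div hx.1]
      exact lt_of_le_of_ne (not_lt.1 hx.2) hx1
  have hc0 : 0 < c := by
    by_contra hc
    have := mul_nonpos_of_nonneg_of_nonpos hI0 (not_lt.1 hc)
    linarith
  have e2 : D.average s (fun _ => 1) 0 = c / D.mass s := by simp [average, hc]
  rw [e2, le_div_iff₀ hm, hmI]
  calc s * (I * c) ≤ s * (1 / s * c) := by gcongr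
    _ = c := by field_simp

lemma measurable_average {g : ℝ → ℝ} (hg : Measurable g) (s : ℝ) : Measurable (D.average s g) := by
  have mα := D.continuous_α.measurable
  have : StronglyMeasurable (fun x => ∫ r in Set.Ioi 0, D.α r * r ^ s * g (x / r)) := by
    apply StronglyMeasurable.integral_prod_right (f := fun x r => D.α r * r ^ s * g (x / r))
    apply Measurable.stronglyMeasurable
    unfold Function.uncurry
    fun_prop
  exact this.measurable.div_const _

end BumpRepr

end

/-! ### Positivity and size of the weight of the remainder -/

section

/-- Terms above 3 are dropped, and from the first retained one on the series is dominated by a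
geometric one. The minimum on the right is what lets the induction, which peels off the first term,
close. -/
lemma sum_geometric_le (M : ℕ) : ∀ f : ℕ → ℝ, (∀ i, 0 ≤ f i) → (∀ i, f (i + 1) ≤ f i / 2) →
    ∑ i ∈ Finset.range M, (if f i ≤ 3 then f i else 0) ≤ 2 * min (f 0) 3 := by
  induction M with
  | zero => intro f h0 _; simpa using h0 0
  | succ M ih =>
    intro f h0 h
    rw [Finset.sum_range_succ']
    have := ih (fun i => f (i + 1)) (fun i => h0 _) (fun i => h _)
    have h1 := h 0
    simp only [zero_add] at this h1
    split_ifs with hf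
    · rw [min_eq_left hf]
      linarith [min_le_left (f 1) 3]
    · rw [min_eq_right (not_le.1 hf).le]
      linarith [min_le_right (f 1) 3]

lemma sum_fin_geometric_le {M : ℕ} {L : ℝ} (hL : 2 ≤ L) {R₁ x : ℝ} (hR : 0 < R₁) (hx : 0 < x) :
    ∑ i : Fin M, (if x / (R₁ * L ^ (i : ℕ)) ≤ 3 then x / (R₁ * L ^ (i : ℕ)) else 0) ≤ 6 := by
  rw [Fin.sum_univ_eq_sum_range
    (fun i => if x / (R₁ * L ^ i) ≤ 3 then x / (R₁ * L ^ i) else 0)]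
  have hL0 : 0 < L := by linarith
  refine (sum_geometric_le M (fun i => x / (R₁ * L ^ i)) (fun i => by positivity)
    fun i => ?_).trans ?_
  · rw [pow_succ, div_div]
    refine div_le_div_of_nonneg_left hx.le (by positivity) ?_
    nlinarith [mul_pos hR (pow_pos hL0 i)]
  · linarith [min_le_right (x / (R₁ * L ^ 0)) 3]

namespace BumpRepr

variable {n : ℕ} (D : BumpRepr n)

/-- The `t`-average of the normalised overlap of two balls of radius `t`. -/
def overlapAverage (d : ℕ) (s u : ℝ) : ℝ :=
  ∫ t in Set.Ioi 0, D.density s t * ballOverlap d (u / t)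

lemma integrableOn_density_mul {g : ℝ → ℝ} (hg : Measurable g) {G : ℝ} (hG : ∀ x, |g x| ≤ G)
    (s u : ℝ) : IntegrableOn (fun t => D.density s t * g (u / t)) (Set.Ioi 0) := by
  have hm : Measurable (fun r => g (u / r)) := hg.comp (measurable_const.div measurable_id)
  exact ((D.integrableOn_rpow_mul_B (s - 1)).div_const _).mul_bdd (c := G) hm.aestronglyMeasurable
    (Filter.Eventually.of_forall fun r => hG _)

lemma integral_density {s : ℝ} (hs : 0 < s) : ∫ t in Set.Ioi 0, D.density s t = 1 := by
  obtain ⟨m, hm, hmass⟩ := D.exists_le_mass s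
  simp only [density]
  rw [integral_div, ← mass, div_self (hm.trans_le (hmass s hs le_rfl)).ne']

lemma density_nonneg {s t : ℝ} (ht : 0 < t) : 0 ≤ D.density s t :=
  div_nonneg (mul_nonneg (Real.rpow_nonneg ht.le _) (D.B_nonneg t))
    (setIntegral_nonneg measurableSet_Ioi fun x hx =>
      mul_nonneg (Real.rpow_nonneg (le_of_lt hx) _) (D.B_nonneg x))

lemma abs_ballOverlap_le (d : ℕ) (x : ℝ) : |ballOverlap d x| ≤ 1 := by
  rw [abs_of_nonneg (ballOverlap_nonneg d x)]; exact ballOverlap_le_one d x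

lemma overlapAverage_nonneg (d : ℕ) (s u : ℝ) : 0 ≤ D.overlapAverage d s u :=
  setIntegral_nonneg measurableSet_Ioi fun _ ht =>
    mul_nonneg (D.density_nonneg ht) (ballOverlap_nonneg _ _)

/-- This is `rpow_mul_integral_eq` for g(y) = K - ∑ c_i h(y/R_i), with h the overlap of unit balls.
-/
lemma rpow_mul_sub_sum_eq {d : ℕ} {M : ℕ} {s u : ℝ} (hs : 0 < s) (hu : 0 < u) (K : ℝ)
    (c R : Fin M → ℝ) :
    u ^ (-s) * (K - ∑ i, c i * D.overlapAverage d s (u / R i)) =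
      ∫ x in Set.Ioi 0, profile n (u / x) * (x ^ (-s - 1) *
        (K * D.average s (fun _ => 1) 0 - ∑ i, c i * D.average s (ballOverlap d) (x / R i))) := by
  obtain ⟨m, hm, hmass⟩ := D.exists_le_mass s
  have hm := hm.trans_le (hmass s hs le_rfl)
  have mh := measurable_ballOverlap d
  have mhR : ∀ i, Measurable (fun y => ballOverlap d (y / R i)) := fun i => by fun_prop
  set g : ℝ → ℝ := fun y => K - ∑ i, c i * ballOverlap d (y / R i) with hg
  have mg : Measurable g := by fun_prop
  have bg : ∀ x, |g x| ≤ |K| + ∑ i, |c i| := fun x => by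
    refine (abs_sub _ _).trans (add_le_add_right ((Finset.abs_sum_le_sum_abs _ _).trans
      (Finset.sum_le_sum fun i _ => ?_)) _)
    rw [abs_mul]
    exact mul_le_of_le_one_right (abs_nonneg _) (abs_ballOverlap_le _ _)
  have h := D.rpow_mul_integral_eq mg bg hs hu
  have e1 : ∫ t in Set.Ioi 0, t ^ (s - 1) * D.B t * g (u / t) =
      D.mass s * (K - ∑ i, c i * D.overlapAverage d s (u / R i)) := by
    have e : ∀ t, t ^ (s - 1) * D.B t * g (u / t) = D.mass s * (K * (D.density s t) -
        ∑ i, c i * (D.density s t * ballOverlap d (u / R i / t))) := fun t => by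
      simp only [density, hg, mul_sub, Finset.mul_sum, div_right_comm u]
      field_simp
    simp_rw [e]
    rw [integral_const_mul, integral_sub, integral_const_mul, D.integral_density hs, mul_one,
      integral_finsetSum]
    · simp_rw [integral_const_mul]
      rfl
    · intro i _
      exact (D.integrableOn_density_mul mh (abs_ballOverlap_le d) s _).const_mul _
    · exact (((D.integrableOn_rpow_mul_B (s - 1)).div_const _)).const_mul _
    · refine integrable_finsetSum _ fun i _ => ?_
      exact (D.integrableOn_density_mul mh (abs_ballOverlap_le d) s _).const_mul _
  have e2 : ∀ x, ∫ r in Set.Ioi 0, D.α r * r ^ s * g (x / r) = D.mass s *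
      (K * D.average s (fun _ => 1) 0 - ∑ i, c i * D.average s (ballOverlap d) (x / R i)) := by
    intro x
    have e : ∀ r, D.α r * r ^ s * g (x / r) = K * (D.α r * r ^ s) -
        ∑ i, c i * (D.α r * r ^ s * ballOverlap d (x / R i / r)) := fun t => by
      simp only [hg, mul_sub, Finset.mul_sum, div_right_comm x]
      congr 1
      · ring
      · exact Finset.sum_congr rfl fun i _ => by ring
    simp_rw [e]
    rw [integral_sub, integral_const_mul, integral_finsetSum]
    · simp_rw [integral_const_mul, average, mul_sub, Finset.mul_sum, mul_one]
      congr 1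
      · field_simp
      · exact Finset.sum_congr rfl fun i _ => by field_simp
    · intro i _
      exact (D.integrableOn_average mh (abs_ballOverlap_le d) s _).const_mul _
    · exact (D.integrableOn_α_mul_rpow s).const_mul _
    · refine integrable_finsetSum _ fun i _ => ?_
      exact (D.integrableOn_average mh (abs_ballOverlap_le d) s _).const_mul _
  rw [e1] at h
  simp_rw [e2] at h
  refine mul_left_cancel₀ hm.ne' ?_
  rw [← integral_const_mul]
  calc _ = _ := by ring
    _ = _ := h
    _ = _ := by
      refine integral_congr_ae (Filter.Eventually.of_forall fun x => ?_)
      simp only; ring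

/-- The weight of the rescaled profiles in the decomposition of the remainder kernel is of order
`M⁻¹ x^(-s-1)`, up to the number of scales below `x`. -/
theorem exists_weight {d : ℕ} (hd : 0 < d) {ε : ℝ} (hε : 0 < ε) {C₀ : ℝ} (hC₀ : 0 < C₀) :
    ∃ C C₂ : ℝ, 0 < C ∧ 0 < C₂ ∧ ∀ (M : ℕ), 0 < M → ∀ s, ε ≤ s → s ≤ (d : ℝ) → ∀ L R₁ : ℝ, 2 ≤ L →
      0 < R₁ → ∀ c : Fin M → ℝ, (∀ i, 0 ≤ c i) → (∀ i, c i ≤ 1 / M) → 1 - C₀ / M ≤ ∑ i, c i →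
      ∃ a : ℝ → ℝ, Measurable a ∧ (∀ x, 0 < x → 1 / M * x ^ (-s - 1) ≤ a x) ∧
        (∀ x, 0 < x → a x ≤ C₂ / M * x ^ (-s - 1) *
          (1 + ∑ i : Fin M, if R₁ * L ^ (i : ℕ) < x then 1 else 0)) ∧
        ∀ u, 0 < u → u ^ (-s) * ((M + C) / M -
          ∑ i : Fin M, c i * D.overlapAverage d s (u / (R₁ * L ^ (i : ℕ)))) =
            ∫ x in Set.Ioi 0, profile n (u / x) * a x := by
  obtain ⟨K, hK, hav⟩ := D.exists_average_bound (d : ℝ)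
  set C₁ := K * (2 * d) with hC₁
  have hC₁0 : 0 < C₁ := by positivity
  -- Since `c₀ ≥ s ≥ ε`, this gives `C * c₀ ≥ 1 + 6 * C₁`: the second summand absorbs the total
  -- error `6 * C₁ / M` of all scales, the first leaves the lower bound `1 / M`.
  set C := (1 + 6 * C₁) / ε with hC
  have hC0 : 0 < C := by positivity
  refine ⟨C, K * (C + C₀ + 1) + 6 * C₁, hC0, by positivity, ?_⟩
  intro M hM s hεs hsd L R₁ hL hR c hc0 hc1 hcsum
  have hs : 0 < s := hε.trans_le hεs
  have hM' : (0 : ℝ) < M := by exact_mod_cast hM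
  have hL0 : 0 < L := by linarith
  set c₀ := D.average s (fun _ => 1) 0 with hc₀
  have hc₀s : s ≤ c₀ := D.le_average_one hs
  have hc₀K : c₀ ≤ K := by
    have := hav s hs hsd (fun _ => 1) 0 1 (by simp)
    rw [mul_one] at this
    exact (le_abs_self _).trans this
  have mh := measurable_ballOverlap d
  set A := D.average s (ballOverlap d) with hA
  -- The overlap vanishes beyond 2, and `r < 3 / 2` on the support of `α`.
  have hA0 : ∀ x, 3 < x → A x = 0 := by
    intro x hx
    have := hav s hs hsd (ballOverlap d) x 0 fun r hr => by
      have : 0 < r := by linarith [hr.1]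
      rw [ballOverlap_eq_zero hd, abs_zero]
      rw [lt_div_iff₀ this]
      linarith [hr.2]
    rw [mul_zero] at this
    exact abs_nonpos_iff.1 this
  have hA1 : ∀ x, 0 < x → |A x - c₀| ≤ C₁ * x := by
    intro x hx
    have h1 : A x - c₀ = D.average s (fun y => ballOverlap d y - 1) x := by
      simp only [hA, hc₀, average, ← sub_div]
      rw [← integral_sub (D.integrableOn_average mh (abs_ballOverlap_le d) s _)
        (by simp only [mul_one]; exact D.integrableOn_α_mul_rpow s)]
      congr 1
      exact integral_congr_ae (Filter.Eventually.of_forall fun r => by ring_nf)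
    have := hav s hs hsd (fun y => ballOverlap d y - 1) x (d * (2 * x)) fun r hr => by
      have hr0 : 0 < r := by linarith [hr.1]
      rw [abs_sub_comm, abs_of_nonneg (by linarith [ballOverlap_le_one d (x / r)])]
      refine (one_sub_ballOverlap_le hd (by positivity)).trans ?_
      gcongr
      rw [div_le_iff₀ hr0]
      nlinarith [hr.1]
    rw [h1, hC₁]
    calc _ ≤ _ := this
      _ = _ := by ring
  have hRi : ∀ i : Fin M, 0 < R₁ * L ^ (i : ℕ) := fun i => by positivity
  have hsum_le : ∑ i, c i ≤ 1 := by
    calc ∑ i, c i ≤ ∑ i : Fin M, 1 / (M : ℝ) := Finset.sum_le_sum fun i _ => hc1 i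
      _ = 1 := by simp [hM'.ne']
  set b : ℝ → ℝ := fun x => (M + C) / M * c₀ - ∑ i : Fin M, c i * A (x / (R₁ * L ^ (i : ℕ))) with hb
  have mb : Measurable b := by
    have mA : Measurable A := D.measurable_average mh s
    simp only [hb]
    fun_prop
  have hgeo : ∀ x, 0 < x → ∑ i : Fin M, c i * (C₁ * (if x / (R₁ * L ^ (i : ℕ)) ≤ 3 then
      x / (R₁ * L ^ (i : ℕ)) else 0)) ≤ 6 * C₁ / M := by
    intro x hx
    calc _ ≤ ∑ i : Fin M, 1 / M * (C₁ * (if x / (R₁ * L ^ (i : ℕ)) ≤ 3 then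
          x / (R₁ * L ^ (i : ℕ)) else 0)) := by
          refine Finset.sum_le_sum fun i _ => mul_le_mul_of_nonneg_right (hc1 i) ?_
          have := hRi i
          split_ifs <;> positivity
      _ = 1 / M * (C₁ * ∑ i : Fin M, (if x / (R₁ * L ^ (i : ℕ)) ≤ 3 then
          x / (R₁ * L ^ (i : ℕ)) else 0)) := by rw [Finset.mul_sum, Finset.mul_sum]
      _ ≤ 1 / M * (C₁ * 6) := by gcongr; exact sum_fin_geometric_le hL hR hx
      _ = _ := by ring
  have hlow : ∀ x, 0 < x → 1 / M ≤ b x := by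
    intro x hx
    have h1 : ∑ i : Fin M, c i * A (x / (R₁ * L ^ (i : ℕ))) ≤ c₀ + 6 * C₁ / M := by
      calc _ ≤ ∑ i : Fin M, (c i * c₀ + c i * (C₁ * (if x / (R₁ * L ^ (i : ℕ)) ≤ 3 then
          x / (R₁ * L ^ (i : ℕ)) else 0))) := by
            refine Finset.sum_le_sum fun i _ => ?_
            rw [← mul_add]
            refine mul_le_mul_of_nonneg_left ?_ (hc0 i)
            split_ifs with h
            · linarith [(abs_le.1 (hA1 _ (div_pos hx (hRi i)))).2]
            · rw [hA0 _ (not_le.1 h)]; linarith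
        _ ≤ _ := by
            rw [Finset.sum_add_distrib, ← Finset.sum_mul]
            refine add_le_add ?_ (hgeo x hx)
            exact mul_le_of_le_one_left (by linarith) hsum_le
    have h2 : (M + C) / M * c₀ = c₀ + C * c₀ / M := by field_simp
    have h3 : 1 + 6 * C₁ ≤ C * c₀ := by
      rw [hC, div_mul_eq_mul_div, le_div_iff₀ hε]
      gcongr
      exact hεs.trans hc₀s
    have h4 : (1 + 6 * C₁) / M ≤ C * c₀ / M := by gcongr
    rw [add_div] at h4
    simp only [hb]
    linarith
  have hup : ∀ x, 0 < x → b x ≤ (K * (C + C₀ + 1) + 6 * C₁) / M *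
      (1 + ∑ i : Fin M, if R₁ * L ^ (i : ℕ) < x then 1 else 0) := by
    intro x hx
    -- A scale with `x / R_i > 3` contributes nothing to the right side. Its missing share, at most
    -- `c₀ / M`, is charged to the count of the scales below `x`.
    have h1 : c₀ * ∑ i, c i - c₀ / M * (∑ i : Fin M, if R₁ * L ^ (i : ℕ) < x then 1 else 0)
        - 6 * C₁ / M ≤ ∑ i : Fin M, c i * A (x / (R₁ * L ^ (i : ℕ))) := by
      calc _ ≤ ∑ i : Fin M, (c₀ * c i - c₀ / M * (if R₁ * L ^ (i : ℕ) < x then 1 else 0) -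
            c i * (C₁ * (if x / (R₁ * L ^ (i : ℕ)) ≤ 3 then x / (R₁ * L ^ (i : ℕ)) else 0))) := by
            rw [Finset.sum_sub_distrib, Finset.sum_sub_distrib, ← Finset.mul_sum, ← Finset.mul_sum]
            linarith [hgeo x hx]
        _ ≤ _ := by
            refine Finset.sum_le_sum fun i _ => ?_
            by_cases h : x / (R₁ * L ^ (i : ℕ)) ≤ 3
            · rw [if_pos h]
              have h2 := (abs_le.1 (hA1 _ (div_pos hx (hRi i)))).1
              have h3 : c i * (c₀ - C₁ * (x / (R₁ * L ^ (i : ℕ)))) ≤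
                c i * A (x / (R₁ * L ^ (i : ℕ))) :=
                mul_le_mul_of_nonneg_left (by linarith) (hc0 i)
              have h4 : 0 ≤ c₀ / M * (if R₁ * L ^ (i : ℕ) < x then 1 else 0) := by
                have : 0 < c₀ := hs.trans_le hc₀s
                split_ifs <;> positivity
              linarith
            · rw [if_neg h, hA0 _ (not_le.1 h), if_pos]
              · have h5 : c₀ * c i ≤ c₀ * (1 / M) :=
                  mul_le_mul_of_nonneg_left (hc1 i) (by linarith)
                have : c₀ * (1 / M) = c₀ / M * 1 := by ring
                linarith
              · rw [not_le, lt_div_iff₀ (hRi i)] at h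
                linarith [hRi i]
    set m : ℝ := ∑ i : Fin M, if R₁ * L ^ (i : ℕ) < x then 1 else 0 with hm
    have hm0 : 0 ≤ m := Finset.sum_nonneg fun i _ => by split_ifs <;> norm_num
    have h2 : (M + C) / M * c₀ = c₀ + C * c₀ / M := by field_simp
    have h3 : c₀ * (1 - C₀ / M) ≤ c₀ * ∑ i, c i :=
      mul_le_mul_of_nonneg_left hcsum (by linarith)
    have h4 : b x ≤ (c₀ * (C + C₀) + 6 * C₁ + c₀ * m) / M := by
      have : (c₀ * (C + C₀) + 6 * C₁ + c₀ * m) / M =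
        C * c₀ / M + c₀ * C₀ / M + 6 * C₁ / M + c₀ / M * m := by ring
      rw [this]
      have : c₀ * (1 - C₀ / M) = c₀ - c₀ * C₀ / M := by ring
      simp only [hb]
      linarith
    refine h4.trans ?_
    rw [div_mul_eq_mul_div]
    gcongr
    have h5 : c₀ * (C + C₀) ≤ K * (C + C₀) := by gcongr
    have h6 : c₀ * m ≤ K * m := by gcongr
    nlinarith [mul_nonneg hK.le hm0, mul_nonneg hC₁0.le hm0, mul_nonneg (mul_nonneg hK.le hC0.le) hm0,
      mul_nonneg (mul_nonneg hK.le hC₀.le) hm0]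
  refine ⟨fun x => x ^ (-s - 1) * b x, by fun_prop, fun x hx => ?_, fun x hx => ?_, fun u hu => ?_⟩
  · rw [mul_comm]
    exact mul_le_mul_of_nonneg_left (hlow x hx) (Real.rpow_nonneg hx.le _)
  · calc _ ≤ x ^ (-s - 1) * _ := mul_le_mul_of_nonneg_left (hup x hx) (Real.rpow_nonneg hx.le _)
      _ = _ := by ring
  · exact D.rpow_mul_sub_sum_eq hs hu _ _ _

end BumpRepr

end

/-! ### The remainder as a mixture of ball indicators -/

section

lemma exists_isometry_euc {d D : ℕ} (h : d ≤ D) : ∃ ι : Euc d → Euc D, Isometry ι := by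
  obtain ⟨k, rfl⟩ := Nat.exists_eq_add_of_le h
  refine ⟨fun x => WithLp.toLp 2 (Fin.append x (fun _ => 0)), Isometry.of_dist_eq fun x y => ?_⟩
  rw [EuclideanSpace.dist_eq, EuclideanSpace.dist_eq, Fin.sum_univ_add]
  simp

section BallIndicator

variable {d n : ℕ} {ι : Euc d → Euc (2 * n + 1)}

/-- The indicator of `ι x` lying in the ball with centre `t.2` and diameter `t.1`. -/
def ballIndicator (ι : Euc d → Euc (2 * n + 1)) (t : ℝ × Euc (2 * n + 1)) (x : Euc d) : ℝ≥0∞ :=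
  (closedBall t.2 (t.1 / 2)).indicator 1 (ι x)

lemma measurable_ballIndicator (hι : Isometry ι) :
    Measurable (Function.uncurry (ballIndicator ι)) := by
  have hc : Continuous ι := hι.continuous
  have hs : IsClosed {p : (ℝ × Euc (2 * n + 1)) × Euc d | dist (ι p.2) p.1.2 ≤ p.1.1 / 2} :=
    isClosed_le (by fun_prop) (by fun_prop)
  exact (measurable_one (α := ℝ≥0∞)).indicator hs.measurableSet

lemma measurable_ballIndicator_left (hι : Isometry ι) (r : ℝ) :
    Measurable fun p : Euc (2 * n + 1) × Euc d => ballIndicator ι (r, p.1) p.2 := by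
  have hc : Continuous ι := hι.continuous
  have hs : IsClosed {p : Euc (2 * n + 1) × Euc d | dist (ι p.2) p.1 ≤ r / 2} :=
    isClosed_le (by fun_prop) (by fun_prop)
  exact (measurable_one (α := ℝ≥0∞)).indicator hs.measurableSet

lemma ballIndicator_zero_or_one (t : ℝ × Euc (2 * n + 1)) (x : Euc d) :
    ballIndicator ι t x = 0 ∨ ballIndicator ι t x = 1 := by
  unfold ballIndicator
  by_cases h : ι x ∈ closedBall t.2 (t.1 / 2) <;> simp [h]

/-- The weight `1 / |B_{r/2}|` normalising the intersection of balls of radius `r/2`. -/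
def ballWeight (n : ℕ) (r : ℝ) : ℝ≥0∞ :=
  ENNReal.ofReal (((r / 2) ^ (2 * n + 1) * unitBallVol (2 * n + 1))⁻¹)

lemma measurable_ballWeight (n : ℕ) : Measurable (ballWeight n) := by
  unfold ballWeight; fun_prop

lemma ballWeight_mul_volume {r : ℝ} (hr : 0 < r) (z : Euc (2 * n + 1)) :
    ballWeight n r * volume (closedBall z (r / 2)) = 1 := by
  have := unitBallVol_pos (2 * n + 1)
  rw [ballWeight, volume_closedBall_euc _ (by positivity), ← ENNReal.ofReal_mul (by positivity),
    inv_mul_cancel₀ (by positivity), ENNReal.ofReal_one]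

lemma lintegral_ballIndicator (r : ℝ) (x : Euc d) :
    ∫⁻ z, ballIndicator ι (r, z) x = volume (closedBall (ι x) (r / 2)) := by
  rw [← lintegral_indicator_one isClosed_closedBall.measurableSet]
  refine lintegral_congr fun z => ?_
  simp only [ballIndicator, Set.indicator, mem_closedBall, dist_comm, Pi.one_apply]

lemma lintegral_ballIndicator_mul (r : ℝ) (x y : Euc d) :
    ∫⁻ z, ballIndicator ι (r, z) x * ballIndicator ι (r, z) y =
      volume (closedBall (ι x) (r / 2) ∩ closedBall (ι y) (r / 2)) := by
  rw [← lintegral_indicator_one (isClosed_closedBall.inter isClosed_closedBall).measurableSet]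
  refine lintegral_congr fun z => ?_
  rw [Set.inter_indicator_one]
  simp only [ballIndicator, Set.indicator, mem_closedBall, dist_comm, Pi.one_apply, Pi.mul_apply]

lemma lintegral_ballIndicator_mul_smul (hι : Isometry ι) {r : ℝ} (hr : 0 < r) (x y : Euc d) :
    ENNReal.ofReal (profile n (‖x - y‖ / r)) =
      ∫⁻ z, ballIndicator ι (r, z) x * ballIndicator ι (r, z) y ∂(ballWeight n r • volume) := by
  have := unitBallVol_pos (2 * n + 1)
  rw [lintegral_smul_measure, lintegral_ballIndicator_mul, volume_inter_closedBall_profile n _ _ hr,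
    hι.dist_eq, smul_eq_mul, ballWeight, ← ENNReal.ofReal_mul (by positivity), dist_eq_norm]
  congr 1
  field_simp

/-- The superposition of the rescaled profiles with weight `a`. -/
def mixture (d n : ℕ) (a : ℝ → ℝ) (x : Euc d) : ℝ≥0∞ :=
  ∫⁻ r in Set.Ioi 0, ENNReal.ofReal (profile n (‖x‖ / r)) * ENNReal.ofReal (a r)

lemma measurable_mixture {a : ℝ → ℝ} (ha : Measurable a) : Measurable (mixture d n a) := by
  have hp := measurable_profile n
  apply Measurable.lintegral_prod_right' (f := fun p : Euc d × ℝ =>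
    ENNReal.ofReal (profile n (‖p.1‖ / p.2)) * ENNReal.ofReal (a p.2))
  fun_prop

/-- The measure on the pairs (diameter, centre) that represents `mixture d n a`. -/
def mixtureMeasure (n : ℕ) (a : ℝ → ℝ) : Measure (ℝ × Euc (2 * n + 1)) :=
  ((volume.restrict (Set.Ioi 0)).withDensity
    fun r => ENNReal.ofReal (a r) * ballWeight n r).prod volume

instance (n : ℕ) (a : ℝ → ℝ) : SFinite (mixtureMeasure n a) := by
  unfold mixtureMeasure; infer_instance

lemma lintegral_mixtureMeasure {a : ℝ → ℝ} (ha : Measurable a)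
    {F : ℝ × Euc (2 * n + 1) → ℝ≥0∞} (hF : Measurable F) :
    ∫⁻ t, F t ∂(mixtureMeasure n a) =
      ∫⁻ r in Set.Ioi 0, ENNReal.ofReal (a r) * (ballWeight n r * ∫⁻ z, F (r, z)) := by
  have := measurable_ballWeight n
  have h2 : Measurable fun r => ∫⁻ z, F (r, z) := hF.lintegral_prod_right'
  rw [mixtureMeasure, lintegral_prod _ hF.aemeasurable,
    lintegral_withDensity_eq_lintegral_mul _ (by fun_prop) h2]
  refine lintegral_congr fun r => ?_
  simp only [Pi.mul_apply, mul_assoc]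

/-- Integrating a product of two ball indicators over the centre gives the overlap volume, and `ι`
preserves distances. This is the form of kernel to which `isPositiveDefinite_of_indicator` and
`energy_le_optTransportGC` apply. -/
lemma mixture_eq_lintegral (hι : Isometry ι) {a : ℝ → ℝ} (ha : Measurable a) (x y : Euc d) :
    mixture d n a (x - y) = ∫⁻ t, ballIndicator ι t x * ballIndicator ι t y ∂(mixtureMeasure n a) := by
  have hm := measurable_ballIndicator hι
  have hF : Measurable fun t => ballIndicator ι t x * ballIndicator ι t y :=
    hm.of_uncurry_right.mul hm.of_uncurry_right
  rw [lintegral_mixtureMeasure ha hF, mixture]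
  refine setLIntegral_congr_fun measurableSet_Ioi fun r hr => ?_
  rw [lintegral_ballIndicator_mul_smul hι hr, lintegral_smul_measure, smul_eq_mul, mul_comm]

lemma ballWeight_mul_lintegral_mass (hι : Isometry ι) {r : ℝ} (hr : 0 < r) (μ : Measure (Euc d))
    [SFinite μ] : ballWeight n r * ∫⁻ z, ∫⁻ x, ballIndicator ι (r, z) x ∂μ = μ Set.univ := by
  rw [lintegral_lintegral_swap]
  · simp_rw [lintegral_ballIndicator]
    rw [← lintegral_const_mul']
    · simp_rw [ballWeight_mul_volume hr]
      simp
    · exact ENNReal.ofReal_ne_top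
  · apply Measurable.aemeasurable
    exact measurable_ballIndicator_left hι r

/-- The left side is the energy of the kernel p(|x-y|/r), which is at most the indicator of |x-y| ≤
r. Using f(x)f(y) ≤ f(x)² + f(y)², each square is integrated against a ball of ℝ^d. Thus the power
of `r` is `d`, although the balls live in dimension 2n+1. -/
lemma ballWeight_mul_lintegral_sq_le (hι : Isometry ι) {r : ℝ} (hr : 0 < r) {f : Euc d → ℝ≥0∞}
    (hf : Measurable f) :
    ballWeight n r * ∫⁻ z, (∫⁻ x, ballIndicator ι (r, z) x ∂(volume.withDensity f)) ^ 2 ≤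
      2 * ENNReal.ofReal (r ^ d * unitBallVol d) * ∫⁻ x, f x ^ 2 := by
  have hm' : Measurable (Function.uncurry fun z x => ballIndicator ι (r, z) x) :=
    measurable_ballIndicator_left hι r
  have h1 := energy_eq_lintegral (m := ballWeight n r • (volume : Measure (Euc (2 * n + 1))))
    (w := fun x : Euc d => ENNReal.ofReal (profile n (‖x‖ / r))) hm'
    (fun x y => lintegral_ballIndicator_mul_smul hι hr x y) (volume.withDensity f)
    (volume.withDensity f)
  rw [lintegral_smul_measure, smul_eq_mul] at h1
  simp_rw [sq (lintegral _ _)]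
  rw [← h1]
  have hs : IsClosed {p : Euc d × Euc d | dist p.1 p.2 ≤ r} :=
    isClosed_le (by fun_prop) (by fun_prop)
  set χ : Euc d → Euc d → ℝ≥0∞ := fun x y => (closedBall x r).indicator 1 y with hχ
  have mχ : Measurable (Function.uncurry χ) := by
    have : Function.uncurry χ = {p : Euc d × Euc d | dist p.1 p.2 ≤ r}.indicator 1 := by
      ext p
      simp only [Function.uncurry, hχ, Set.indicator, mem_closedBall, Set.mem_ofPred_eq, dist_comm, Pi.one_apply]
    rw [this]
    exact measurable_one.indicator hs.measurableSet
  have mχ1 : ∀ x, Measurable (χ x) := fun x => mχ.of_uncurry_left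
  have hχsymm : ∀ x y, χ x y = χ y x := fun x y => by
    simp only [hχ, Set.indicator, mem_closedBall, dist_comm, Pi.one_apply]
  have hχint : ∀ x, ∫⁻ y, χ x y = ENNReal.ofReal (r ^ d * unitBallVol d) := fun x => by
    rw [← volume_closedBall_euc x hr.le]
    exact lintegral_indicator_one isClosed_closedBall.measurableSet
  have hk : ∀ x y : Euc d, ENNReal.ofReal (profile n (‖x - y‖ / r)) ≤ χ x y := by
    intro x y
    by_cases h : ‖x - y‖ ≤ r
    · have : y ∈ closedBall x r := by rwa [mem_closedBall, dist_comm, dist_eq_norm]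
      simp only [hχ, Set.indicator_of_mem this, Pi.one_apply]
      exact ENNReal.ofReal_le_one.2 (profile_le_one _ _)
    · rw [profile_eq_zero n ((one_lt_div hr).2 (not_le.1 h))]
      simp
  have mp : ∀ x : Euc d, Measurable fun y => ENNReal.ofReal (profile n (‖x - y‖ / r)) := fun x => by
    have := measurable_profile n
    fun_prop
  have mf2 : Measurable (Function.uncurry fun x y => f x ^ 2 * χ x y) :=
    ((hf.comp measurable_fst).pow_const 2).mul mχ
  calc energy (fun x : Euc d => ENNReal.ofReal (profile n (‖x‖ / r))) (volume.withDensity f)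
        (volume.withDensity f)
      ≤ ∫⁻ x, f x * ∫⁻ y, f y * χ x y := by
        unfold energy
        refine (lintegral_withDensity_le_lintegral_mul _ hf _).trans (lintegral_mono fun x => ?_)
        simp only [Pi.mul_apply]
        refine mul_le_mul_right ((lintegral_withDensity_le_lintegral_mul _ hf _).trans
          (lintegral_mono fun y => ?_)) _
        exact mul_le_mul_right (hk x y) _
    _ ≤ ∫⁻ x, ∫⁻ y, (f x ^ 2 * χ x y + f y ^ 2 * χ y x) := by
        refine lintegral_mono fun x => ?_
        simp only
        have := mχ1 x
        rw [← lintegral_const_mul _ (by fun_prop)]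
        refine lintegral_mono fun y => ?_
        simp only
        rw [hχsymm y x, ← add_mul, ← mul_assoc]
        refine mul_le_mul_left ?_ _
        exact le_self_add.trans (ennreal_two_mul_le_add_sq (f x) (f y))
    _ = (∫⁻ x, ∫⁻ y, f x ^ 2 * χ x y) + ∫⁻ x, ∫⁻ y, f y ^ 2 * χ y x := by
        have mI : Measurable fun x => ∫⁻ y, f x ^ 2 * χ x y := mf2.lintegral_prod_right'
        rw [← lintegral_add_left mI]
        refine lintegral_congr fun x => ?_
        rw [lintegral_add_left ((mχ1 x).const_mul _)]
    _ = _ := by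
        rw [lintegral_lintegral_swap (f := fun x y => f y ^ 2 * χ y x)
          (mf2.comp measurable_swap).aemeasurable]
        have : ∀ x, ∫⁻ y, f x ^ 2 * χ x y = f x ^ 2 * ENNReal.ofReal (r ^ d * unitBallVol d) :=
          fun x => by rw [lintegral_const_mul _ (mχ1 x), hχint]
        simp_rw [this]
        rw [lintegral_mul_const _ (hf.pow_const 2)]
        ring

lemma min_add_sq_le (a b : ℝ≥0∞) : min (a + b) ((a + b) ^ 2) ≤ 4 * a ^ 2 + 2 * b := by
  rcases le_total b a with h | h
  · refine (min_le_right _ _).trans (le_trans ?_ le_self_add)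
    calc (a + b) ^ 2 ≤ (a + a) ^ 2 := by gcongr
      _ = 4 * a ^ 2 := by ring
  · refine (min_le_left _ _).trans (le_trans ?_ le_add_self)
    calc a + b ≤ b + b := by gcongr
      _ = 2 * b := by ring

/-- The density is cut at height r^(-d). The low part goes through the quadratic bound and the high
part through its mass; `min_add_sq_le` allows the two to be treated separately. -/
lemma ballWeight_mul_lintegral_min_le (hι : Isometry ι) {r : ℝ} (hr : 0 < r) {F : Euc d → ℝ}
    (hF : Measurable F) :
    ballWeight n r * ∫⁻ z, min
      (∫⁻ x, ballIndicator ι (r, z) x ∂(volume.withDensity fun x => ENNReal.ofReal (F x)))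
      ((∫⁻ x, ballIndicator ι (r, z) x ∂(volume.withDensity fun x => ENNReal.ofReal (F x))) ^ 2) ≤
    ∫⁻ x, (if F x * r ^ d ≤ 1 then
      8 * ENNReal.ofReal (r ^ d * unitBallVol d) * ENNReal.ofReal (F x) ^ 2
      else 2 * ENNReal.ofReal (F x)) := by
  have hm' : Measurable (Function.uncurry fun z x => ballIndicator ι (r, z) x) :=
    measurable_ballIndicator_left hι r
  have hs : MeasurableSet {x | F x * r ^ d ≤ 1} := measurableSet_le (by fun_prop) (by fun_prop)
  set f₁ : Euc d → ℝ≥0∞ := fun x => if F x * r ^ d ≤ 1 then ENNReal.ofReal (F x) else 0 with hf₁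
  set f₂ : Euc d → ℝ≥0∞ := fun x => if F x * r ^ d ≤ 1 then 0 else ENNReal.ofReal (F x) with hf₂
  have m₁ : Measurable f₁ := Measurable.ite hs (by fun_prop) (by fun_prop)
  have m₂ : Measurable f₂ := Measurable.ite hs (by fun_prop) (by fun_prop)
  have hadd : (fun x => ENNReal.ofReal (F x)) = f₁ + f₂ := by
    ext x
    simp only [hf₁, hf₂, Pi.add_apply]
    split_ifs <;> simp
  rw [hadd, withDensity_add_left m₁]
  simp_rw [lintegral_add_measure]
  have mG : ∀ μ : Measure (Euc d), SFinite μ →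
      Measurable fun z => ∫⁻ x, ballIndicator ι (r, z) x ∂μ :=
    fun μ _ => hm'.lintegral_prod_right'
  have mG1 := mG (volume.withDensity f₁) inferInstance
  have mG2 := mG (volume.withDensity f₂) inferInstance
  calc _ ≤ ballWeight n r * ∫⁻ z, (4 * (∫⁻ x, ballIndicator ι (r, z) x ∂(volume.withDensity f₁)) ^ 2
        + 2 * ∫⁻ x, ballIndicator ι (r, z) x ∂(volume.withDensity f₂)) := by
        gcongr with z
        exact min_add_sq_le _ _
    _ = 4 * (ballWeight n r *
          ∫⁻ z, (∫⁻ x, ballIndicator ι (r, z) x ∂(volume.withDensity f₁)) ^ 2)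
        + 2 * (ballWeight n r * ∫⁻ z, ∫⁻ x, ballIndicator ι (r, z) x ∂(volume.withDensity f₂)) := by
        rw [lintegral_add_left (by fun_prop), lintegral_const_mul _ (by fun_prop),
          lintegral_const_mul _ (by fun_prop)]
        ring
    _ ≤ 4 * (2 * ENNReal.ofReal (r ^ d * unitBallVol d) * ∫⁻ x, f₁ x ^ 2) +
        2 * ∫⁻ x, f₂ x := by
        refine add_le_add (mul_le_mul_right (ballWeight_mul_lintegral_sq_le hι hr m₁) _)
          (mul_le_mul_right (le_of_eq ?_) _)
        · rw [ballWeight_mul_lintegral_mass hι hr, withDensity_apply _ MeasurableSet.univ,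
            Measure.restrict_univ]
    _ = ∫⁻ x, (8 * ENNReal.ofReal (r ^ d * unitBallVol d) * f₁ x ^ 2 + 2 * f₂ x) := by
        rw [lintegral_add_left (by fun_prop), lintegral_const_mul _ (by fun_prop),
          lintegral_const_mul _ (by fun_prop)]
        ring
    _ = _ := by
        refine lintegral_congr fun x => ?_
        simp only [hf₁, hf₂]
        split_ifs <;> simp

end BallIndicator

end

/-! ### Integration over the diameters of the balls -/

section

lemma lintegral_Ioc_rpow {p q : ℝ} (hp : 0 < p) (hq : 0 ≤ q) :
    ∫⁻ r in Set.Ioc 0 q, ENNReal.ofReal (r ^ (p - 1)) = ENNReal.ofReal (q ^ p / p) := by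
  have hi := intervalIntegral.intervalIntegrable_rpow' (a := 0) (b := q) (by linarith : -1 < p - 1)
  rw [← ofReal_integral_eq_lintegral_ofReal
    ((intervalIntegrable_iff_integrableOn_Ioc_of_le hq).1 hi)
    (ae_restrict_of_forall_mem measurableSet_Ioc fun r hr => Real.rpow_nonneg hr.1.le _),
    ← intervalIntegral.integral_of_le hq, integral_rpow (Or.inl (by linarith)), sub_add_cancel,
    Real.zero_rpow hp.ne', sub_zero]

lemma lintegral_Ioi_rpow {s q : ℝ} (hs : 0 < s) (hq : 0 < q) :
    ∫⁻ r in Set.Ioi q, ENNReal.ofReal (r ^ (-s - 1)) = ENNReal.ofReal (q ^ (-s) / s) := by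
  rw [← ofReal_integral_eq_lintegral_ofReal (integrableOn_Ioi_rpow_of_lt (by linarith) hq)
    (ae_restrict_of_forall_mem measurableSet_Ioi fun r hr =>
      Real.rpow_nonneg (hq.le.trans (le_of_lt hr)) _),
    integral_Ioi_rpow_of_lt (by linarith) hq, sub_add_cancel, neg_div_neg_eq]

/-- The threshold is q = F^(-1/d). Below it r^(d-s-1) is integrable because s < d, above it r^(-s-1)
is integrable because s > 0, and both pieces scale like F^(1+s/d). -/
lemma lintegral_level_split {d : ℕ} {s F v : ℝ} (hs : 0 < s) (hsd : s < d) (hF : 0 ≤ F)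
    (hv : 0 ≤ v) :
    ∫⁻ r in Set.Ioi (0 : ℝ), ENNReal.ofReal (r ^ (-s - 1)) * (if F * r ^ d ≤ 1 then
      8 * ENNReal.ofReal (r ^ d * v) * ENNReal.ofReal F ^ 2 else 2 * ENNReal.ofReal F) ≤
    ENNReal.ofReal ((8 * v / (d - s) + 2 / s) * F ^ (1 + s / d)) := by
  have hd : (0 : ℝ) < d := hs.trans hsd
  have hd' : d ≠ 0 := by rintro rfl; simp at hd
  rcases hF.eq_or_lt with rfl | hF
  · simp
  set q : ℝ := F ^ (-(1 / d) : ℝ) with hq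
  have hq0 : 0 < q := Real.rpow_pos_of_pos hF _
  have hqd : F * q ^ d = 1 := by
    rw [hq, ← Real.rpow_natCast, ← Real.rpow_mul hF.le]
    have : (-(1 / d) * d : ℝ) = -1 := by field_simp
    rw [this, Real.rpow_neg_one, mul_inv_cancel₀ hF.ne']
  have hle : ∀ r, 0 < r → (F * r ^ d ≤ 1 ↔ r ≤ q) := fun r hr => by
    rw [← hqd, mul_le_mul_iff_right₀ hF, pow_le_pow_iff_left₀ hr.le hq0.le hd']
  rw [← Set.Ioc_union_Ioi_eq_Ioi hq0.le]
  refine (lintegral_union_le _ _ _).trans ?_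
  have e1 : ∫⁻ r in Set.Ioc 0 q, ENNReal.ofReal (r ^ (-s - 1)) * (if F * r ^ d ≤ 1 then
      8 * ENNReal.ofReal (r ^ d * v) * ENNReal.ofReal F ^ 2 else 2 * ENNReal.ofReal F) =
      ENNReal.ofReal (8 * v * F ^ 2) * ∫⁻ r in Set.Ioc 0 q, ENNReal.ofReal (r ^ ((d - s) - 1)) := by
    rw [← lintegral_const_mul _ (by fun_prop)]
    refine setLIntegral_congr_fun measurableSet_Ioc fun r hr => ?_
    rw [if_pos ((hle r hr.1).2 hr.2), ← ENNReal.ofReal_pow hF.le]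
    have h8 : (8 : ℝ≥0∞) = ENNReal.ofReal 8 := by simp
    have hr0 := hr.1
    rw [h8, ← ENNReal.ofReal_mul (by positivity), ← ENNReal.ofReal_mul (by positivity),
      ← ENNReal.ofReal_mul (by positivity), ← ENNReal.ofReal_mul (by positivity),
      show ((d - s) - 1 : ℝ) = d + (-s - 1) by ring, Real.rpow_add hr.1, Real.rpow_natCast]
    congr 1; ring
  have e2 : ∫⁻ r in Set.Ioi q, ENNReal.ofReal (r ^ (-s - 1)) * (if F * r ^ d ≤ 1 then
      8 * ENNReal.ofReal (r ^ d * v) * ENNReal.ofReal F ^ 2 else 2 * ENNReal.ofReal F) =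
      ENNReal.ofReal (2 * F) * ∫⁻ r in Set.Ioi q, ENNReal.ofReal (r ^ (-s - 1)) := by
    rw [← lintegral_const_mul _ (by fun_prop)]
    refine setLIntegral_congr_fun measurableSet_Ioi fun r hr => ?_
    have hr0 : 0 < r := hq0.trans hr
    rw [if_neg (fun h => not_le.2 hr ((hle r hr0).1 h)), ENNReal.ofReal_mul zero_le_two,
      ENNReal.ofReal_ofNat, mul_comm]
  rw [e1, e2, lintegral_Ioc_rpow (by linarith) hq0.le, lintegral_Ioi_rpow hs hq0,
    ← ENNReal.ofReal_mul (by positivity), ← ENNReal.ofReal_mul (by positivity),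
    ← ENNReal.ofReal_add]
  · refine le_of_eq ?_
    congr 1
    have p1 : F ^ 2 * q ^ (d - s : ℝ) = F ^ (1 + s / d) := by
      rw [hq, ← Real.rpow_mul hF.le, ← Real.rpow_natCast, ← Real.rpow_add hF]
      congr 1; push_cast; field_simp; ring
    have p2 : F * q ^ (-s) = F ^ (1 + s / d) := by
      rw [hq, ← Real.rpow_mul hF.le, Real.rpow_add hF, Real.rpow_one]
      congr 2; field_simp
    calc _ = 8 * v / (d - s) * (F ^ 2 * q ^ (d - s : ℝ)) + 2 / s * (F * q ^ (-s)) := by ring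
      _ = _ := by rw [p1, p2]; ring
  · have : 0 < d - s := by linarith
    positivity
  · positivity

/-- The condition `2 ≤ L ^ ε` makes the ratio L^(-s) at most 1/2 for all s ≥ ε. -/
lemma sum_rpow_geometric_le {M : ℕ} {ε s L R₁ : ℝ} (hs : ε ≤ s) (hL : 2 ≤ L)
    (hLε : 2 ≤ L ^ ε) (hR : 0 < R₁) :
    ∑ i : Fin M, (R₁ * L ^ (i : ℕ)) ^ (-s) ≤ 2 * R₁ ^ (-s) := by
  have hL0 : 0 < L := by linarith
  have h1 : L ^ (-s) ≤ 1 / 2 := by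
    rw [Real.rpow_neg hL0.le, one_div]
    apply inv_anti₀ two_pos
    exact hLε.trans (Real.rpow_le_rpow_of_exponent_le (by linarith) hs)
  have h0 : 0 ≤ L ^ (-s) := Real.rpow_nonneg hL0.le _
  calc _ ≤ ∑ i : Fin M, R₁ ^ (-s) * (1 / 2) ^ (i : ℕ) := by
        refine Finset.sum_le_sum fun i _ => ?_
        rw [Real.mul_rpow hR.le (by positivity), ← Real.rpow_natCast, ← Real.rpow_mul hL0.le,
          mul_comm ((i : ℕ) : ℝ), Real.rpow_mul hL0.le, Real.rpow_natCast]
        gcongr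
    _ = R₁ ^ (-s) * ∑ i ∈ Finset.range M, (1 / 2) ^ i := by
        rw [← Finset.mul_sum, Fin.sum_univ_eq_sum_range (fun i => (1 / 2 : ℝ) ^ i)]
    _ ≤ R₁ ^ (-s) * 2 := by
        gcongr
        exact sum_geometric_two_le M
    _ = _ := mul_comm _ _

section

variable {d n : ℕ} {ι : Euc d → Euc (2 * n + 1)}

/-- The summand 1 in the bound for `a` is handled pointwise in `x` by `lintegral_level_split`. For
the count of scales, the integral over centres is bounded by the total mass, and what remains, the
integral of r^(-s-1) over r > R_i, is R_i^(-s)/s, a geometric sequence in i. -/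
theorem lintegral_min_mixtureMeasure_le (hι : Isometry ι) {ε s : ℝ} (hε : 0 < ε) (hεs : ε ≤ s)
    (hsd : s ≤ d - ε) {M : ℕ} {L R₁ : ℝ} (hL : 2 ≤ L) (hLε : 2 ≤ L ^ ε) (hR : 0 < R₁)
    {a : ℝ → ℝ} (ha : Measurable a) {A : ℝ} (hA : 0 ≤ A)
    (haA : ∀ x, 0 < x → a x ≤ A * x ^ (-s - 1) *
      (1 + ∑ i : Fin M, if R₁ * L ^ (i : ℕ) < x then 1 else 0))
    {F : Euc d → ℝ} (hF : Measurable F) (hF0 : ∀ x, 0 ≤ F x) :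
    ∫⁻ t, min
      (∫⁻ x, ballIndicator ι t x ∂(volume.withDensity fun x => ENNReal.ofReal (F x)))
      ((∫⁻ x, ballIndicator ι t x ∂(volume.withDensity fun x => ENNReal.ofReal (F x))) ^ 2)
        ∂(mixtureMeasure n a) ≤
      ENNReal.ofReal (A * ((8 * unitBallVol d + 2) / ε)) *
        (∫⁻ x, ENNReal.ofReal (F x ^ (1 + s / d))) +
      ENNReal.ofReal (A * (2 / ε) * R₁ ^ (-s)) * ∫⁻ x, ENNReal.ofReal (F x) := by
  have hs : 0 < s := hε.trans_le hεs
  have hv := unitBallVol_pos d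
  have hL0 : 0 < L := by linarith
  set μ := volume.withDensity fun x => ENNReal.ofReal (F x) with hμ
  have hμ1 : μ Set.univ = ∫⁻ x, ENNReal.ofReal (F x) := by
    rw [hμ, withDensity_apply _ MeasurableSet.univ, Measure.restrict_univ]
  have mb := measurable_ballIndicator (n := n) hι
  have mG : Measurable fun t => ∫⁻ x, ballIndicator ι t x ∂μ := mb.lintegral_prod_right'
  have mw := measurable_ballWeight n
  set V : ℝ → ℝ≥0∞ := fun r => ballWeight n r * ∫⁻ z, min (∫⁻ x, ballIndicator ι (r, z) x ∂μ)
    ((∫⁻ x, ballIndicator ι (r, z) x ∂μ) ^ 2) with hV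
  have mmin : Measurable fun t => min (∫⁻ x, ballIndicator ι t x ∂μ)
    ((∫⁻ x, ballIndicator ι t x ∂μ) ^ 2) := mG.min (mG.pow_const 2)
  have mV : Measurable V := mw.mul mmin.lintegral_prod_right'
  rw [lintegral_mixtureMeasure ha mmin]
  have hV1 : ∀ r, 0 < r → V r ≤ ∫⁻ x, (if F x * r ^ d ≤ 1 then
      8 * ENNReal.ofReal (r ^ d * unitBallVol d) * ENNReal.ofReal (F x) ^ 2
      else 2 * ENNReal.ofReal (F x)) := fun r hr => ballWeight_mul_lintegral_min_le hι hr hF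
  have hV2 : ∀ r, 0 < r → V r ≤ μ Set.univ := fun r hr => by
    rw [← ballWeight_mul_lintegral_mass (n := n) hι hr μ]
    simp only [hV]
    gcongr with z
    exact min_le_left _ _
  set χ : Fin M → ℝ → ℝ≥0∞ := fun i => (Set.Ioi (R₁ * L ^ (i : ℕ))).indicator 1 with hχ
  have mχ : ∀ i, Measurable (χ i) := fun i => measurable_one.indicator measurableSet_Ioi
  have key : ∀ r ∈ Set.Ioi (0 : ℝ), ENNReal.ofReal (a r) * V r ≤
      ENNReal.ofReal A * (ENNReal.ofReal (r ^ (-s - 1)) * V r) +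
      ENNReal.ofReal A * μ Set.univ * ∑ i, χ i r * ENNReal.ofReal (r ^ (-s - 1)) := by
    intro r hr
    have hr : 0 < r := hr
    have h1 : ENNReal.ofReal (a r) ≤ ENNReal.ofReal A * ENNReal.ofReal (r ^ (-s - 1)) *
        (1 + ∑ i, χ i r) := by
      refine (ENNReal.ofReal_le_ofReal (haA r hr)).trans (le_of_eq ?_)
      rw [ENNReal.ofReal_mul (by positivity), ENNReal.ofReal_mul hA, ENNReal.ofReal_add zero_le_one,
        ENNReal.ofReal_sum_of_nonneg, ENNReal.ofReal_one]
      · congr 2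
        refine Finset.sum_congr rfl fun i _ => ?_
        simp only [hχ, Set.indicator, Set.mem_Ioi, Pi.one_apply]
        split_ifs <;> simp
      · intro i _; split_ifs <;> norm_num
      · exact Finset.sum_nonneg fun i _ => by split_ifs <;> norm_num
    calc _ ≤ ENNReal.ofReal A * ENNReal.ofReal (r ^ (-s - 1)) * (1 + ∑ i, χ i r) * V r := by gcongr
      _ = ENNReal.ofReal A * (ENNReal.ofReal (r ^ (-s - 1)) * V r) +
          ENNReal.ofReal A * V r * ∑ i, χ i r * ENNReal.ofReal (r ^ (-s - 1)) := by
          rw [← Finset.sum_mul]; ring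
      _ ≤ _ := by gcongr; exact hV2 r hr
  refine (setLIntegral_mono' measurableSet_Ioi key).trans ?_
  rw [lintegral_add_left (by fun_prop), lintegral_const_mul _ (by fun_prop),
    lintegral_const_mul _ (by fun_prop), lintegral_finsetSum _ (fun i _ => by
      have := mχ i; fun_prop)]
  refine add_le_add ?_ ?_
  · rw [ENNReal.ofReal_mul hA, mul_assoc]
    refine mul_le_mul_right ?_ _
    calc ∫⁻ r in Set.Ioi 0, ENNReal.ofReal (r ^ (-s - 1)) * V r
        ≤ ∫⁻ r in Set.Ioi 0, ∫⁻ x, ENNReal.ofReal (r ^ (-s - 1)) * (if F x * r ^ d ≤ 1 then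
            8 * ENNReal.ofReal (r ^ d * unitBallVol d) * ENNReal.ofReal (F x) ^ 2
            else 2 * ENNReal.ofReal (F x)) := by
          refine setLIntegral_mono' measurableSet_Ioi fun r hr => ?_
          rw [lintegral_const_mul' _ _ ENNReal.ofReal_ne_top]
          exact mul_le_mul_right (hV1 r hr) _
      _ = ∫⁻ x, ∫⁻ r in Set.Ioi 0, ENNReal.ofReal (r ^ (-s - 1)) * (if F x * r ^ d ≤ 1 then
            8 * ENNReal.ofReal (r ^ d * unitBallVol d) * ENNReal.ofReal (F x) ^ 2
            else 2 * ENNReal.ofReal (F x)) := by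
          rw [lintegral_lintegral_swap]
          apply Measurable.aemeasurable
          unfold Function.uncurry
          refine Measurable.mul (by fun_prop) (Measurable.ite ?_ (by fun_prop) (by fun_prop))
          exact measurableSet_le (by fun_prop) (by fun_prop)
      _ ≤ ∫⁻ x, ENNReal.ofReal ((8 * unitBallVol d + 2) / ε) * ENNReal.ofReal (F x ^ (1 + s / d)) := by
          refine lintegral_mono fun x => ?_
          refine (lintegral_level_split hs (by linarith) (hF0 x) hv.le).trans ?_
          rw [← ENNReal.ofReal_mul (by positivity)]
          refine ENNReal.ofReal_le_ofReal ?_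
          refine mul_le_mul_of_nonneg_right ?_ (Real.rpow_nonneg (hF0 x) _)
          rw [add_div]
          gcongr
          linarith
      _ = _ := by rw [lintegral_const_mul _ (by fun_prop)]
  · rw [← hμ1]
    have e : ∀ i, ∫⁻ r in Set.Ioi 0, χ i r * ENNReal.ofReal (r ^ (-s - 1)) =
        ENNReal.ofReal ((R₁ * L ^ (i : ℕ)) ^ (-s) / s) := fun i => by
      have hRi : 0 < R₁ * L ^ (i : ℕ) := by positivity
      rw [← lintegral_Ioi_rpow hs hRi]
      have e2 : ∀ r, χ i r * ENNReal.ofReal (r ^ (-s - 1)) =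
          (Set.Ioi (R₁ * L ^ (i : ℕ))).indicator (fun r => ENNReal.ofReal (r ^ (-s - 1))) r :=
        fun r => by
          by_cases h : r ∈ Set.Ioi (R₁ * L ^ (i : ℕ)) <;> simp [hχ, h]
      simp_rw [e2]
      rw [lintegral_indicator measurableSet_Ioi, Measure.restrict_restrict measurableSet_Ioi,
        Set.inter_eq_left.2 (Set.Ioi_subset_Ioi hRi.le)]
    simp_rw [e]
    rw [← ENNReal.ofReal_sum_of_nonneg (fun i _ => by positivity), ← Finset.sum_div,
      mul_right_comm, ← ENNReal.ofReal_mul hA]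
    refine mul_le_mul_left (ENNReal.ofReal_le_ofReal ?_) _
    rw [mul_assoc]
    refine mul_le_mul_of_nonneg_left ?_ hA
    calc _ ≤ (2 * R₁ ^ (-s)) / s := by
          gcongr
          exact sum_rpow_geometric_le hεs hL hLε hR
      _ ≤ (2 * R₁ ^ (-s)) / ε := by gcongr
      _ = _ := by ring

theorem le_excEnergyGC_mixture (hι : Isometry ι) {ε s : ℝ} (hε : 0 < ε) (hεs : ε ≤ s)
    (hsd : s ≤ d - ε) {M : ℕ} {L R₁ : ℝ} (hL : 2 ≤ L) (hLε : 2 ≤ L ^ ε) (hR : 0 < R₁)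
    {a : ℝ → ℝ} (ha : Measurable a) {A : ℝ} (hA : 0 ≤ A)
    (haA : ∀ x, 0 < x → a x ≤ A * x ^ (-s - 1) *
      (1 + ∑ i : Fin M, if R₁ * L ^ (i : ℕ) < x then 1 else 0))
    {F : Euc d → ℝ} (hF : Measurable F) (hF0 : ∀ x, 0 ≤ F x) {μ : Measure (Euc d)}
    [IsProbabilityMeasure μ] (hμ : μ = volume.withDensity fun x => ENNReal.ofReal (F x))
    (hint : Integrable fun x => F x ^ (1 + s / d)) {N : ℝ} (hN : 2 ≤ N) :
    ((-(A * ((8 * unitBallVol d + 2) / ε) * N ^ (1 + s / d) * (∫ x, F x ^ (1 + s / d)) +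
      A * (4 / ε) * R₁ ^ (-s) * (N - 1)) : ℝ) : EReal) ≤ excEnergyGC N (mixture d n a) μ := by
  have hs : 0 < s := hε.trans_le hεs
  have hv := unitBallVol_pos d
  have mb := measurable_ballIndicator (n := n) hι
  have hw := mixture_eq_lintegral (n := n) hι ha
  have hI0 : 0 ≤ ∫ x, F x ^ (1 + s / d) := integral_nonneg fun x => Real.rpow_nonneg (hF0 x) _
  have hmass : ∫⁻ x, ENNReal.ofReal (F x) = 1 := by
    rw [← measure_univ (μ := μ), hμ, withDensity_apply _ MeasurableSet.univ, Measure.restrict_univ]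
  have bound : ∀ N : ℝ, 0 ≤ N → ∫⁻ t, min (ENNReal.ofReal N * ∫⁻ x, ballIndicator ι t x ∂μ)
      ((ENNReal.ofReal N * ∫⁻ x, ballIndicator ι t x ∂μ) ^ 2) ∂(mixtureMeasure n a) ≤
      ENNReal.ofReal (A * ((8 * unitBallVol d + 2) / ε) * N ^ (1 + s / d) *
        (∫ x, F x ^ (1 + s / d)) + A * (2 / ε) * R₁ ^ (-s) * N) := by
    intro N hN
    have h := lintegral_min_mixtureMeasure_le (n := n) hι hε hεs hsd hL hLε hR ha hA haA
      (F := fun x => N * F x) (by fun_prop) (fun x => mul_nonneg hN (hF0 x))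
    have e : (volume.withDensity fun x => ENNReal.ofReal (N * F x)) = ENNReal.ofReal N • μ := by
      rw [hμ, ← withDensity_smul _ (by fun_prop)]
      congr 1
      ext x
      rw [ENNReal.ofReal_mul hN]
      rfl
    rw [e] at h
    simp_rw [lintegral_smul_measure, smul_eq_mul] at h
    refine h.trans (le_of_eq ?_)
    have e1 : ∫⁻ x, ENNReal.ofReal ((N * F x) ^ (1 + s / d)) =
        ENNReal.ofReal (N ^ (1 + s / d) * ∫ x, F x ^ (1 + s / d)) := by
      rw [← integral_const_mul, ofReal_integral_eq_lintegral_ofReal (hint.const_mul _)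
        (Filter.Eventually.of_forall fun x =>
          mul_nonneg (Real.rpow_nonneg hN _) (Real.rpow_nonneg (hF0 x) _))]
      refine lintegral_congr fun x => ?_
      rw [Real.mul_rpow hN (hF0 x)]
    have e2 : ∫⁻ x, ENNReal.ofReal (N * F x) = ENNReal.ofReal N := by
      simp_rw [ENNReal.ofReal_mul hN]
      rw [lintegral_const_mul _ (by fun_prop), hmass, mul_one]
    have hNp : 0 ≤ N ^ (1 + s / d) := Real.rpow_nonneg hN _
    rw [e1, e2, ← ENNReal.ofReal_mul (by positivity), ← ENNReal.ofReal_mul (by positivity),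
      ← ENNReal.ofReal_add (by positivity) (by positivity)]
    congr 1
    ring
  -- The bound with `N = 1` also shows that the energy is finite: a ball has mass at most 1, so the
  -- minimum is the square.
  have hE : energy (mixture d n a) μ μ ≠ ⊤ := by
    rw [energy_eq_lintegral mb hw]
    refine ne_top_of_le_ne_top ENNReal.ofReal_ne_top (le_trans (le_of_eq ?_) (bound 1 zero_le_one))
    refine lintegral_congr fun t => ?_
    rw [ENNReal.ofReal_one, one_mul, ← sq, min_eq_right]
    refine (sq _).trans_le (mul_le_of_le_one_right' ?_)
    calc ∫⁻ x, ballIndicator ι t x ∂μ ≤ ∫⁻ x, 1 ∂μ := by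
          refine lintegral_mono fun x => ?_
          rcases ballIndicator_zero_or_one (ι := ι) t x with h | h <;> simp [h]
      _ = 1 := by simp
  have hB := (energy_le_optTransportGC mb ballIndicator_zero_or_one hw μ hE N).trans
    (add_le_add_right (bound N (by linarith)) _)
  have hN0 : 0 ≤ N := by linarith
  have hNp : 0 ≤ N ^ (1 + s / d) := Real.rpow_nonneg hN0 _
  refine le_trans ?_ (le_excEnergyGC hE (by positivity) hB)
  -- For `N ≥ 2` one has N ≤ 2(N - 1), which doubles the constant.
  have h4 : A * (2 / ε) * R₁ ^ (-s) * N ≤ A * (4 / ε) * R₁ ^ (-s) * (N - 1) := by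
    have : A * (4 / ε) * R₁ ^ (-s) * (N - 1) = A * (2 / ε) * R₁ ^ (-s) * (2 * (N - 1)) := by ring
    rw [this]
    gcongr
    linarith
  exact_mod_cast neg_le_neg (add_le_add_right h4 _)

end

end

/-! ### Greedy placement of balls on grids -/

section

/-- The half-open cube with lower corner `c` and side `a`. -/
def box {d : ℕ} (c : Fin d → ℝ) (a : ℝ) : Set (Euc d) := {x | ∀ i, x i ∈ Set.Ico (c i) (c i + a)}

lemma box_eq_preimage {d : ℕ} (c : Fin d → ℝ) (a : ℝ) :
    box c a = WithLp.ofLp ⁻¹' (Set.univ.pi fun i => Set.Ico (c i) (c i + a)) := by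
  ext x; simp [box]

lemma measurableSet_box {d : ℕ} (c : Fin d → ℝ) (a : ℝ) : MeasurableSet (box c a) := by
  rw [box_eq_preimage]
  exact (PiLp.volume_preserving_ofLp (Fin d)).measurable
    (MeasurableSet.univ_pi fun i => measurableSet_Ico)

lemma volume_box {d : ℕ} (c : Fin d → ℝ) {a : ℝ} (ha : 0 ≤ a) :
    volume (box c a) = ENNReal.ofReal (a ^ d) := by
  rw [box_eq_preimage, (PiLp.volume_preserving_ofLp (Fin d)).measure_preimage
    (MeasurableSet.univ_pi fun i => measurableSet_Ico).nullMeasurableSet, Real.volume_pi_Ico]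
  simp [ENNReal.ofReal_pow ha]

lemma dist_le_of_mem_box {d : ℕ} {c : Fin d → ℝ} {a : ℝ} (ha : 0 ≤ a) {x y : Euc d}
    (hx : x ∈ box c a) (hy : y ∈ box c a) : dist x y ≤ √d * a := by
  rw [EuclideanSpace.dist_eq, ← Real.sqrt_sq ha, ← Real.sqrt_mul (Nat.cast_nonneg d)]
  apply Real.sqrt_le_sqrt
  calc ∑ i, dist (x i) (y i) ^ 2 ≤ ∑ _i : Fin d, a ^ 2 := by
        refine Finset.sum_le_sum fun i _ => ?_
        have := hx i; have := hy i
        simp only [Set.mem_Ico] at *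
        rw [Real.dist_eq, sq_abs]
        apply sq_le_sq'  <;> linarith
    _ = d * a ^ 2 := by simp

lemma abs_sub_apply_le_dist {d : ℕ} (x y : Euc d) (i : Fin d) : |x i - y i| ≤ dist x y := by
  rw [dist_eq_norm]
  exact (PiLp.norm_apply_le (x - y) i)

/-- The half-open cube `[-ℓ/2, ℓ/2)^d`. -/
def halfOpenCube (d : ℕ) (ℓ : ℝ) : Set (Euc d) := box (fun _ => -ℓ / 2) ℓ

lemma halfOpenCube_subset_cube (d : ℕ) (ℓ : ℝ) : halfOpenCube d ℓ ⊆ cube d ℓ := fun x hx i => by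
  have := hx i
  simp only [Set.mem_Ico] at this
  rw [abs_le]
  constructor <;> linarith

section Cells

variable {d m : ℕ}

/-- The cells of side `a` of the regular subdivision of `[-ℓ/2, ℓ/2)^d`. -/
def cell (a ℓ : ℝ) (q : Fin d → Fin m) : Set (Euc d) := box (fun i => -ℓ / 2 + a * (q i : ℕ)) a

/-- The centre of a cell. -/
def cellCenter (a ℓ : ℝ) (q : Fin d → Fin m) : Euc d :=
  WithLp.toLp 2 fun i => -ℓ / 2 + a * (q i : ℕ) + a / 2

lemma closedBall_cellCenter_subset {a R : ℝ} (hR : R < a / 2) (ℓ : ℝ) (q : Fin d → Fin m) :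
    closedBall (cellCenter a ℓ q) R ⊆ cell a ℓ q := by
  intro x hx i
  have h1 := (abs_sub_apply_le_dist x (cellCenter a ℓ q) i).trans (mem_closedBall.1 hx)
  have h2 : (cellCenter a ℓ q) i = -ℓ / 2 + a * (q i : ℕ) + a / 2 := rfl
  rw [h2, abs_le] at h1
  simp only [Set.mem_Ico]
  constructor <;> linarith [h1.1, h1.2]

lemma disjoint_cell {a : ℝ} (ha : 0 < a) (ℓ : ℝ) {q q' : Fin d → Fin m} (h : q ≠ q') :
    Disjoint (cell a ℓ q) (cell a ℓ q') := by
  rw [Set.disjoint_left]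
  intro x hx hx'
  apply h
  ext i
  have h1 := hx i; have h2 := hx' i
  simp only [Set.mem_Ico] at h1 h2
  have h3 : ((q i : ℕ) : ℝ) < (q' i : ℕ) + 1 := by
    have : a * (q i : ℕ) < a * ((q' i : ℕ) + 1) := by linarith [h1.1, h2.2]
    exact lt_of_mul_lt_mul_left this ha.le
  have h4 : ((q' i : ℕ) : ℝ) < (q i : ℕ) + 1 := by
    have : a * (q' i : ℕ) < a * ((q i : ℕ) + 1) := by linarith [h1.2, h2.1]
    exact lt_of_mul_lt_mul_left this ha.le
  have h5 : (q i : ℕ) < (q' i : ℕ) + 1 := by exact_mod_cast h3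
  have h6 : (q' i : ℕ) < (q i : ℕ) + 1 := by exact_mod_cast h4
  omega

lemma cell_subset_halfOpenCube {a ℓ : ℝ} (ha : 0 < a) (hℓ : ℓ = a * m) (q : Fin d → Fin m) :
    cell a ℓ q ⊆ halfOpenCube d ℓ := by
  intro x hx i
  have h1 := hx i
  simp only [Set.mem_Ico] at h1 ⊢
  have h2 : ((q i : ℕ) : ℝ) + 1 ≤ m := by exact_mod_cast (q i).2
  have h3 : a * ((q i : ℕ) + 1) ≤ a * m := mul_le_mul_of_nonneg_left h2 ha.le
  have h4 : 0 ≤ a * (q i : ℕ) := by positivity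
  constructor <;> linarith [h1.1, h1.2]

lemma exists_mem_cell {a ℓ : ℝ} (ha : 0 < a) (hℓ : ℓ = a * m) {x : Euc d}
    (hx : x ∈ halfOpenCube d ℓ) : ∃ q : Fin d → Fin m, x ∈ cell a ℓ q := by
  have h0 : ∀ i, 0 ≤ (x i + ℓ / 2) / a := fun i => by
    have := (hx i).1
    simp only at this
    exact div_nonneg (by linarith) ha.le
  have hlt : ∀ i, ⌊(x i + ℓ / 2) / a⌋₊ < m := fun i => by
    rw [Nat.floor_lt (h0 i), div_lt_iff₀ ha]
    have := (hx i).2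
    simp only at this
    linarith
  refine ⟨fun i => ⟨_, hlt i⟩, fun i => ?_⟩
  have h1 := Nat.floor_le (h0 i)
  have h2 := Nat.lt_floor_add_one ((x i + ℓ / 2) / a)
  rw [le_div_iff₀ ha] at h1
  rw [div_lt_iff₀ ha] at h2
  simp only [Set.mem_Ico]
  constructor <;> linarith

/-- If the balls of a finite family leave enough room, then `K` disjoint balls of radius `R` can be
placed at centres of cells of side `a > 2R` that do not meet that family. -/
lemma exists_free_centers {β : Type*} {a ℓ R : ℝ} (hℓ : ℓ = a * m) (hR : 0 < R) (hRa : R < a / 2)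
    (big : Finset β) (ctr : β → Euc d) (rad : β → ℝ) (hrad : ∀ b ∈ big, 0 ≤ rad b) (K : ℕ)
    (h : ∑ b ∈ big, (rad b + √d * a) ^ d * unitBallVol d + K * a ^ d ≤ ℓ ^ d) :
    ∃ S : Finset (Euc d), S.card = K ∧ (∀ x ∈ S, closedBall x R ⊆ halfOpenCube d ℓ) ∧
      (∀ x ∈ S, ∀ y ∈ S, x ≠ y → Disjoint (closedBall x R) (closedBall y R)) ∧
      ∀ x ∈ S, ∀ b ∈ big, Disjoint (closedBall x R) (closedBall (ctr b) (rad b)) := by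
  classical
  have ha : 0 < a := by linarith
  have hℓ0 : 0 ≤ ℓ := by rw [hℓ]; positivity
  have hv := unitBallVol_pos d
  let free : Finset (Fin d → Fin m) := Finset.univ.filter fun q =>
    ∀ b ∈ big, Disjoint (cell a ℓ q) (closedBall (ctr b) (rad b))
  -- A cell that is not free meets a ball of the family. As its diameter is at most √d a, it lies in
  -- that ball enlarged by √d a.
  have hcover : halfOpenCube d ℓ ⊆ (⋃ q ∈ free, cell a ℓ q) ∪
      ⋃ b ∈ big, closedBall (ctr b) (rad b + √d * a) := by
    intro x hx
    obtain ⟨q, hq⟩ := exists_mem_cell ha hℓ hx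
    by_cases hf : q ∈ free
    · exact Or.inl (Set.mem_biUnion hf hq)
    · right
      simp only [free, Finset.mem_filter, Finset.mem_univ, true_and, not_forall] at hf
      obtain ⟨b, hb, hnd⟩ := hf
      obtain ⟨y, hy, hyb⟩ := Set.not_disjoint_iff.1 hnd
      refine Set.mem_biUnion hb ?_
      rw [mem_closedBall] at hyb ⊢
      linarith [dist_triangle x y (ctr b), dist_le_of_mem_box ha.le hq hy]
  have h1 : ENNReal.ofReal (ℓ ^ d) ≤ ENNReal.ofReal (free.card * a ^ d +
      ∑ b ∈ big, (rad b + √d * a) ^ d * unitBallVol d) := by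
    have hpos : ∀ b ∈ big, 0 ≤ (rad b + √d * a) ^ d * unitBallVol d := fun b hb => by
      have := hrad b hb; positivity
    calc ENNReal.ofReal (ℓ ^ d) = volume (halfOpenCube d ℓ) := (volume_box _ hℓ0).symm
      _ ≤ ∑ q ∈ free, volume (cell a ℓ q) +
          ∑ b ∈ big, volume (closedBall (ctr b) (rad b + √d * a)) :=
          (measure_mono hcover).trans ((measure_union_le _ _).trans
            (add_le_add (measure_biUnion_finset_le _ _) (measure_biUnion_finset_le _ _)))
      _ = _ := by
          rw [ENNReal.ofReal_add (by positivity) (Finset.sum_nonneg hpos),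
            ENNReal.ofReal_sum_of_nonneg hpos]
          congr 1
          · simp only [cell, volume_box _ ha.le, Finset.sum_const, nsmul_eq_mul]
            rw [ENNReal.ofReal_mul (by positivity), ENNReal.ofReal_natCast]
          · refine Finset.sum_congr rfl fun b hb => ?_
            have := hrad b hb
            rw [volume_closedBall_euc _ (by positivity)]
  have h2 : ℓ ^ d ≤ free.card * a ^ d + ∑ b ∈ big, (rad b + √d * a) ^ d * unitBallVol d := by
    rw [ENNReal.ofReal_le_ofReal_iff] at h1
    · exact h1
    · refine add_nonneg (by positivity) (Finset.sum_nonneg fun b hb => ?_)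
      have := hrad b hb; positivity
  have h3 : K ≤ free.card := by
    have : (K : ℝ) * a ^ d ≤ free.card * a ^ d := by linarith
    exact_mod_cast le_of_mul_le_mul_right this (by positivity)
  obtain ⟨T, hT, hTK⟩ := Finset.exists_subset_card_eq h3
  have hsub : ∀ q : Fin d → Fin m, closedBall (cellCenter a ℓ q) R ⊆ cell a ℓ q :=
    closedBall_cellCenter_subset hRa ℓ
  have hinj : Function.Injective (cellCenter a ℓ : (Fin d → Fin m) → Euc d) := by
    intro q q' hqq
    by_contra hne
    refine Set.disjoint_left.1 (disjoint_cell ha ℓ hne) (hsub q (mem_closedBall_self hR.le)) ?_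
    rw [hqq]
    exact hsub q' (mem_closedBall_self hR.le)
  refine ⟨T.image (cellCenter a ℓ), ?_, ?_, ?_, ?_⟩
  · rw [Finset.card_image_of_injective _ hinj, hTK]
  · simp only [Finset.mem_image, forall_exists_index, and_imp]
    rintro _ q _ rfl
    exact (hsub q).trans (cell_subset_halfOpenCube ha hℓ q)
  · simp only [Finset.mem_image, forall_exists_index, and_imp]
    rintro _ q _ rfl _ q' _ rfl hne
    exact (disjoint_cell ha ℓ (fun h => hne (by rw [h]))).mono (hsub q) (hsub q')
  · simp only [Finset.mem_image, forall_exists_index, and_imp]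
    rintro _ q hq rfl b hb
    have := hT hq
    simp only [free, Finset.mem_filter, Finset.mem_univ, true_and] at this
    exact (this b hb).mono_left (hsub q)

end Cells

/-- Successive placement of the balls of a packing, from the largest to the smallest scale. -/
lemma exists_multiscale_centers {d M : ℕ} {ℓ : ℝ} (R a : ℕ → ℝ) (m K : ℕ → ℕ)
    (hℓ : ∀ i < M, ℓ = a i * m i) (hR : ∀ i, 0 < R i) (hRa : ∀ i, R i < a i / 2)
    (h : ∀ i < M, ∑ j ∈ Finset.Ioo i M, K j * ((R j + √d * a i) ^ d * unitBallVol d) +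
      K i * a i ^ d ≤ ℓ ^ d) (t : ℕ) (ht : t ≤ M) :
    ∃ cent : ℕ → Finset (Euc d), ∀ i, M - t ≤ i → i < M → (cent i).card = K i ∧
      (∀ x ∈ cent i, closedBall x (R i) ⊆ halfOpenCube d ℓ) ∧
      ∀ j, i ≤ j → j < M → ∀ x ∈ cent i, ∀ y ∈ cent j, (i, x) ≠ (j, y) →
        Disjoint (closedBall x (R i)) (closedBall y (R j)) := by
  induction t with
  | zero => exact ⟨fun _ => ∅, fun i h1 h2 => by omega⟩
  | succ t ih =>
    obtain ⟨cent, hc⟩ := ih (by omega)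
    -- The next scale down; the balls of all larger scales, already placed, are the obstacles.
    obtain ⟨i₀, hi₀⟩ : ∃ i₀, i₀ = M - (t + 1) := ⟨_, rfl⟩
    obtain ⟨S, hS1, hS2, hS3, hS4⟩ := exists_free_centers (hℓ i₀ (by omega)) (hR i₀) (hRa i₀)
      ((Finset.Ioo i₀ M).sigma cent) (fun b => b.2) (fun b => R b.1) (fun b _ => (hR _).le) (K i₀)
      (by
        rw [Finset.sum_sigma]
        refine le_trans (le_of_eq ?_) (h i₀ (by omega))
        congr 1
        refine Finset.sum_congr rfl fun j hj => ?_
        rw [Finset.mem_Ioo] at hj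
        simp only [Finset.sum_const, nsmul_eq_mul]
        rw [(hc j (by omega) hj.2).1])
    refine ⟨Function.update cent i₀ S, fun i hi hiM => ?_⟩
    rcases eq_or_ne i i₀ with hii | hne
    · subst hii
      rw [Function.update_self]
      refine ⟨hS1, hS2, fun j hij hjM x hx y hy hxy => ?_⟩
      rcases eq_or_ne j i with hj | hj
      · rw [hj, Function.update_self] at hy
        rw [hj]
        exact hS3 x hx y hy fun h => hxy (by rw [h, hj])
      · rw [Function.update_of_ne hj] at hy
        exact hS4 x hx ⟨j, y⟩
          (Finset.mem_sigma.2 ⟨Finset.mem_Ioo.2 ⟨lt_of_le_of_ne hij hj.symm, hjM⟩, hy⟩)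
    · have hi' : M - t ≤ i := by omega
      rw [Function.update_of_ne hne]
      refine ⟨(hc i hi' hiM).1, (hc i hi' hiM).2.1, fun j hij hjM x hx y hy hxy => ?_⟩
      rw [Function.update_of_ne (by omega)] at hy
      exact (hc i hi' hiM).2.2 j hij hjM x hx y hy hxy

lemma latticePoint_apply {d : ℕ} (ℓ : ℝ) (p : Fin d → ℤ) (i : Fin d) :
    latticePoint ℓ p i = ℓ * p i := rfl

/-- In each coordinate two points of a half-open interval of length `ℓ` differ by less than `ℓ`.
Hence disjointness of the periodized packing reduces to disjointness inside one half-open cube. -/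
lemma eq_of_sub_latticePoint_mem {d : ℕ} {ℓ : ℝ} {x : Euc d} {p q : Fin d → ℤ}
    (hp : x - latticePoint ℓ p ∈ halfOpenCube d ℓ) (hq : x - latticePoint ℓ q ∈ halfOpenCube d ℓ) :
    p = q := by
  ext i
  have h1 := hp i; have h2 := hq i
  simp only [Set.mem_Ico, PiLp.sub_apply, latticePoint_apply] at h1 h2
  have hℓ : 0 < ℓ := by linarith [h1.1, h1.2]
  have h3 : (p i : ℝ) < q i + 1 := by
    have : ℓ * p i < ℓ * (q i + 1) := by linarith [h1.1, h2.2]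
    exact lt_of_mul_lt_mul_left this hℓ.le
  have h4 : (q i : ℝ) < p i + 1 := by
    have : ℓ * q i < ℓ * (p i + 1) := by linarith [h1.2, h2.1]
    exact lt_of_mul_lt_mul_left this hℓ.le
  have h5 : p i < q i + 1 := by exact_mod_cast h3
  have h6 : q i < p i + 1 := by exact_mod_cast h4
  omega

lemma mem_closedBall_add_iff {d : ℕ} {x v z : Euc d} {r : ℝ} :
    z ∈ closedBall (x + v) r ↔ z - v ∈ closedBall x r := by
  rw [mem_closedBall, mem_closedBall, dist_eq_norm, dist_eq_norm]
  congr! 2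
  abel

end

/-! ### Existence of Swiss-cheese packings -/

section

lemma cheeseConst_pos (d : ℕ) : 0 < cheeseConst d :=
  div_pos (by positivity) (unitBallVol_pos d)

/-- A dilation ratio between successive scales that makes the boundary effects negligible. -/
lemma exists_scale_ratio {ε : ℝ} (hε : 0 < ε) (b c δ : ℝ) (hδ : 0 < δ) (d : ℕ) :
    ∃ L : ℕ, 2 ≤ L ∧ 2 ≤ (L : ℝ) ^ ε ∧ b < L ∧ (1 + c / L) ^ d ≤ 1 + δ := by
  have h1 : ∀ᶠ L : ℕ in Filter.atTop, 2 ≤ (L : ℝ) ^ ε :=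
    ((tendsto_rpow_atTop hε).comp tendsto_natCast_atTop_atTop).eventually_ge_atTop 2
  have h2 : ∀ᶠ L : ℕ in Filter.atTop, b < (L : ℝ) :=
    tendsto_natCast_atTop_atTop.eventually_gt_atTop b
  have h3 : Filter.Tendsto (fun L : ℕ => (1 + c / (L : ℝ)) ^ d) Filter.atTop (nhds ((1 + 0) ^ d)) :=
    ((tendsto_const_div_atTop_nhds_zero_nat c).const_add 1).pow d
  have h4 : ∀ᶠ L : ℕ in Filter.atTop, (1 + c / (L : ℝ)) ^ d < 1 + δ :=
    h3.eventually_lt_const (by simpa using hδ)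
  obtain ⟨L, a1, a2, a3, a4⟩ := ((Filter.eventually_ge_atTop 2).and (h1.and (h2.and h4))).exists
  exact ⟨L, a1, a2, a3, a4.le⟩

lemma exists_mul_mem_Ioo {lo hi ν : ℝ} (hlo : 0 ≤ lo) (hν : 0 < ν) (h : ν < hi - lo) :
    ∃ K : ℕ, lo < K * ν ∧ K * ν < hi := by
  refine ⟨⌊lo / ν⌋₊ + 1, ?_, ?_⟩
  · have := Nat.lt_floor_add_one (lo / ν)
    rw [div_lt_iff₀ hν] at this
    exact_mod_cast this
  · have := Nat.floor_le (div_nonneg hlo hν.le)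
    rw [le_div_iff₀ hν] at this
    push_cast
    linarith

/-- Cells of side 2θR are strictly wider than a ball of radius R and have volume 2^(d+1) R^d = C_d
|B_1| R^d; this is where C_d comes from. -/
lemma exists_two_root {d : ℕ} (hd : 0 < d) : ∃ θ : ℝ, 1 < θ ∧ θ ^ d = 2 := by
  refine ⟨2 ^ ((1 : ℝ) / d), Real.one_lt_rpow one_lt_two (by positivity), ?_⟩
  rw [← Real.rpow_natCast, ← Real.rpow_mul two_pos.le, one_div_mul_cancel (by positivity),
    Real.rpow_one]

/-- The volume bound that leaves room for the balls of the `i`-th scale. -/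
lemma multiscale_volume_le {d M i : ℕ} {L θ ℓ R₁ : ℝ} (hi : i < M) (hL : 1 ≤ L)
    (hR₁ : 0 < R₁) (hθ : 0 < θ) (hθd : θ ^ d = 2) (hℓ : 0 < ℓ)
    (hLd : (1 + 2 * θ * √d / L) ^ d ≤ 1 + 1 / M) (K : ℕ → ℕ)
    (hK : ∀ j < M, K j * ((R₁ * L ^ j) ^ d * unitBallVol d / ℓ ^ d) < 1 / (M + cheeseConst d)) :
    ∑ j ∈ Finset.Ioo i M,
        K j * ((R₁ * L ^ j + √d * (2 * θ * (R₁ * L ^ i))) ^ d * unitBallVol d) +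
      K i * (2 * θ * (R₁ * L ^ i)) ^ d ≤ ℓ ^ d := by
  have hv := unitBallVol_pos d
  have hC := cheeseConst_pos d
  have hM : (0 : ℝ) < M := by exact_mod_cast (by omega : 0 < M)
  have hL0 : 0 < L := by linarith
  have hK' : ∀ j < M, K j * ((R₁ * L ^ j) ^ d * unitBallVol d) ≤
      1 / (M + cheeseConst d) * ℓ ^ d := fun j hj => by
    have := (hK j hj).le
    rwa [← mul_div_assoc, div_le_iff₀ (by positivity)] at this
  have h1 : ∀ j ∈ Finset.Ioo i M,
      K j * ((R₁ * L ^ j + √d * (2 * θ * (R₁ * L ^ i))) ^ d * unitBallVol d) ≤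
        (1 + 1 / M) * (1 / (M + cheeseConst d) * ℓ ^ d) := fun j hj => by
    rw [Finset.mem_Ioo] at hj
    have h2 : L ^ i * L ≤ L ^ j := by
      rw [← pow_succ]; exact pow_le_pow_right₀ hL hj.1
    have h3 : R₁ * L ^ j + √d * (2 * θ * (R₁ * L ^ i)) ≤
        (R₁ * L ^ j) * (1 + 2 * θ * √d / L) := by
      have : L ^ i ≤ L ^ j / L := by rwa [le_div_iff₀ hL0]
      calc R₁ * L ^ j + √d * (2 * θ * (R₁ * L ^ i))
          ≤ R₁ * L ^ j + √d * (2 * θ * (R₁ * (L ^ j / L))) := by gcongr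
        _ = _ := by ring
    calc K j * ((R₁ * L ^ j + √d * (2 * θ * (R₁ * L ^ i))) ^ d * unitBallVol d)
        ≤ K j * (((R₁ * L ^ j) * (1 + 2 * θ * √d / L)) ^ d * unitBallVol d) := by gcongr
      _ = (1 + 2 * θ * √d / L) ^ d * (K j * ((R₁ * L ^ j) ^ d * unitBallVol d)) := by
          rw [mul_pow]; ring
      _ ≤ _ := by
          apply mul_le_mul hLd (hK' j hj.2) (by positivity) (by positivity)
  -- The cells taken by scale `i` occupy exactly C_d times the volume of its balls.
  have h2 : K i * (2 * θ * (R₁ * L ^ i)) ^ d ≤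
      cheeseConst d * (1 / (M + cheeseConst d) * ℓ ^ d) := by
    calc K i * (2 * θ * (R₁ * L ^ i)) ^ d
        = cheeseConst d * (K i * ((R₁ * L ^ i) ^ d * unitBallVol d)) := by
          rw [mul_pow, mul_pow 2, hθd, cheeseConst]; field_simp; ring
      _ ≤ _ := mul_le_mul_of_nonneg_left (hK' i hi) hC.le
  have h3 : ((Finset.Ioo i M).card : ℝ) ≤ M - 1 := by
    rw [Nat.card_Ioo, le_sub_iff_add_le]
    exact_mod_cast (by omega : M - i - 1 + 1 ≤ M)
  have h4 := Finset.sum_le_card_nsmul _ _ _ h1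
  rw [nsmul_eq_mul] at h4
  -- There are at most M - 1 larger scales, each enlarged by a factor at most 1 + 1/M, and (M - 1)(1
  -- + 1/M) ≤ M.
  have h5 : ((Finset.Ioo i M).card : ℝ) * ((1 + 1 / M) * (1 / (M + cheeseConst d) * ℓ ^ d)) ≤
      M * (1 / (M + cheeseConst d) * ℓ ^ d) := by
    rw [← mul_assoc]
    refine mul_le_mul_of_nonneg_right ?_ (by positivity)
    calc ((Finset.Ioo i M).card : ℝ) * (1 + 1 / M) ≤ (M - 1) * (1 + 1 / M) := by gcongr
      _ = M - 1 / M := by field_simp; ring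
      _ ≤ M := by linarith [show (0 : ℝ) < 1 / M by positivity]
  calc _ ≤ M * (1 / (M + cheeseConst d) * ℓ ^ d) +
        cheeseConst d * (1 / (M + cheeseConst d) * ℓ ^ d) := add_le_add (h4.trans h5) h2
    _ = ℓ ^ d := by field_simp

/-- There are Swiss-cheese packings with radii `R₁ L^i`, for suitable large `L`. -/
theorem exists_swissCheese {d M : ℕ} (hd : 0 < d) (hM : 0 < M) {ε R₁ : ℝ} (hε : 0 < ε)
    (hR₁ : 0 < R₁) : ∃ (S : SwissCheese d M) (L : ℝ), 2 ≤ L ∧ 2 ≤ L ^ ε ∧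
      ∀ i, S.R i = R₁ * L ^ (i : ℕ) := by
  have hv := unitBallVol_pos d
  have hC := cheeseConst_pos d
  have hM' : (0 : ℝ) < M := by exact_mod_cast hM
  obtain ⟨θ, hθ, hθd⟩ := exists_two_root hd
  obtain ⟨L, hL2, hLε, hLb, hLd⟩ := exists_scale_ratio hε (1 + 4 * √d * unitBallVol d)
    (2 * θ * √d) (1 / M) (by positivity) d
  have hL2' : (2 : ℝ) ≤ L := by exact_mod_cast hL2
  have hL1 : (1 : ℝ) ≤ L := by linarith
  have hgap : 0 < 1 / (M + cheeseConst d) - 1 / (M + cheeseConst d + 1) := by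
    rw [sub_pos]
    exact one_div_lt_one_div_of_lt (by positivity) (by linarith)
  -- The three lower bounds serve, in order, to have `1 / k ≤ 1`, to make the period large enough,
  -- and to make one ball cover less than the gap between the two permitted fractions, so that some
  -- integer number of balls falls in between.
  obtain ⟨k, hk⟩ := exists_nat_gt (max 1 (max (8 * √d * unitBallVol d * (M + cheeseConst d))
    (unitBallVol d / (1 / (M + cheeseConst d) - 1 / (M + cheeseConst d + 1)))))
  rw [max_lt_iff, max_lt_iff, div_lt_iff₀ hgap] at hk
  obtain ⟨hk1, hk2, hk3⟩ := hk
  -- Because the ratio `L` is an integer, `ℓ` is the multiple L^(M-i) k of the cell side of every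
  -- scale `i`.
  set ℓ : ℝ := 2 * θ * (R₁ * (L : ℝ) ^ M) * k with hℓ
  have hk0 : (0 : ℝ) < k := by linarith
  have hℓ0 : 0 < ℓ := by positivity
  have hRX : ∀ i < M, R₁ * (L : ℝ) ^ i ≤ R₁ * (L : ℝ) ^ M := fun i hi =>
    mul_le_mul_of_nonneg_left (pow_le_pow_right₀ hL1 hi.le) hR₁.le
  have hRk : ∀ i < M, R₁ * (L : ℝ) ^ i * k ≤ ℓ := fun i hi => by
    calc R₁ * (L : ℝ) ^ i * k ≤ 1 * (R₁ * (L : ℝ) ^ M) * k := by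
          rw [one_mul]; gcongr
      _ ≤ _ := by rw [hℓ]; gcongr; linarith
  have hν : ∀ i < M, (R₁ * (L : ℝ) ^ i) ^ d * unitBallVol d / ℓ ^ d <
      1 / (M + cheeseConst d) - 1 / (M + cheeseConst d + 1) := fun i hi => by
    have h1 : R₁ * (L : ℝ) ^ i / ℓ ≤ 1 / k := by
      rw [div_le_div_iff₀ hℓ0 hk0, one_mul]; exact hRk i hi
    have h2 : (R₁ * (L : ℝ) ^ i / ℓ) ^ d ≤ 1 / k :=
      (pow_le_of_le_one (by positivity) (h1.trans (by rw [div_le_one hk0]; exact hk1.le))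
        hd.ne').trans h1
    calc (R₁ * (L : ℝ) ^ i) ^ d * unitBallVol d / ℓ ^ d
        = (R₁ * (L : ℝ) ^ i / ℓ) ^ d * unitBallVol d := by rw [div_pow]; ring
      _ ≤ 1 / k * unitBallVol d := by gcongr
      _ < _ := by
        rw [one_div_mul_eq_div, div_lt_iff₀ hk0]
        linarith
  have hK : ∀ i, ∃ K : ℕ, i < M →
      1 / (M + cheeseConst d + 1) < K * ((R₁ * (L : ℝ) ^ i) ^ d * unitBallVol d / ℓ ^ d) ∧
      K * ((R₁ * (L : ℝ) ^ i) ^ d * unitBallVol d / ℓ ^ d) < 1 / (M + cheeseConst d) := by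
    intro i
    by_cases hi : i < M
    · obtain ⟨K, hK⟩ := exists_mul_mem_Ioo (by positivity) (by positivity) (hν i hi)
      exact ⟨K, fun _ => hK⟩
    · exact ⟨0, fun h => absurd h hi⟩
  choose K hK using hK
  obtain ⟨cent, hc⟩ := exists_multiscale_centers (d := d) (M := M) (ℓ := ℓ)
    (fun i => R₁ * (L : ℝ) ^ i)
    (fun i => 2 * θ * (R₁ * (L : ℝ) ^ i)) (fun i => L ^ (M - i) * k) K
    (fun i hi => by
      push_cast
      rw [hℓ, ← Nat.add_sub_cancel' hi.le, pow_add, Nat.add_sub_cancel_left]; ring)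
    (fun i => by positivity)
    (fun i => by
      have : 0 < R₁ * (L : ℝ) ^ i := by positivity
      nlinarith)
    (fun i hi => multiscale_volume_le hi hL1 hR₁ (by linarith) hθd hℓ0 hLd K
      fun j hj => (hK j hj).2) M le_rfl
  have hc' := fun i (hi : i < M) => hc i (by omega) hi
  have hfrac : ∀ i : Fin M, ((cent i).card : ℝ) *
      (volume (closedBall (0 : Euc d) (R₁ * (L : ℝ) ^ (i : ℕ)))).toReal / ℓ ^ d =
      K i * ((R₁ * (L : ℝ) ^ (i : ℕ)) ^ d * unitBallVol d / ℓ ^ d) := fun i => by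
    rw [(hc' i i.2).1, volume_closedBall_euc _ (by positivity),
      ENNReal.toReal_ofReal (by positivity), mul_div_assoc]
  have hdisj : ∀ i j : Fin M, ∀ x ∈ cent i, ∀ y ∈ cent j, (i, x) ≠ (j, y) →
      Disjoint (closedBall x (R₁ * (L : ℝ) ^ (i : ℕ)))
        (closedBall y (R₁ * (L : ℝ) ^ (j : ℕ))) := by
    intro i j x hx y hy hne
    rcases le_total (i : ℕ) j with hij | hij
    · refine (hc' i i.2).2.2 j hij j.2 x hx y hy fun h => hne ?_
      rw [Prod.mk.injEq] at h ⊢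
      exact ⟨Fin.ext h.1, h.2⟩
    · refine ((hc' j j.2).2.2 i hij i.2 y hy x hx fun h => hne ?_).symm
      rw [Prod.mk.injEq] at h ⊢
      exact ⟨Fin.ext h.1.symm, h.2.symm⟩
  refine ⟨
    { R := fun i => R₁ * (L : ℝ) ^ (i : ℕ)
      ℓ := ℓ
      centers := fun i => cent i
      R_pos := fun i => by positivity
      R_growth := fun i j hij => ?_
      ℓ_large := fun i => ?_
      subset_cube := fun i x hx =>
        ((hc' i i.2).2.1 x hx).trans (halfOpenCube_subset_cube d ℓ)
      disjoint := fun i j x hx y hy p q hne => ?_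
      fraction_lower := fun i => (hfrac i) ▸ (hK i i.2).1
      fraction_upper := fun i => (hfrac i) ▸ (hK i i.2).2 },
    L, hL2', hLε, fun i => rfl⟩
  · have : 0 < R₁ * (L : ℝ) ^ (i : ℕ) := by positivity
    rw [← hij, pow_succ]
    nlinarith
  · have : 0 < R₁ * (L : ℝ) ^ (i : ℕ) := by positivity
    calc _ < k * (R₁ * (L : ℝ) ^ (i : ℕ)) := mul_lt_mul_of_pos_right hk2 this
      _ ≤ ℓ := by rw [mul_comm]; exact hRk i i.2
  · rw [Set.disjoint_left]
    intro z hz hz'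
    rw [mem_closedBall_add_iff] at hz hz'
    have hpq : p = q := eq_of_sub_latticePoint_mem ((hc' i i.2).2.1 x hx hz)
      ((hc' j j.2).2.1 y hy hz')
    subst hpq
    refine Set.disjoint_left.1 (hdisj i j x hx y hy fun h => hne ?_) hz hz'
    rw [Prod.mk.injEq] at h
    rw [h.1, h.2]

end

/-! ### Averaging the packing over dilations and translations -/

section

variable {d M : ℕ}

lemma mem_closedBall_dilated {t : ℝ} (ht : 0 < t) {c y z : Euc d} {R : ℝ} :
    z ∈ closedBall (t • c + y) (t * R) ↔ t⁻¹ • (z - y) ∈ closedBall c R := by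
  have h : z - (t • c + y) = t • (t⁻¹ • (z - y) - c) := by
    rw [smul_sub, smul_inv_smul₀ ht.ne']; abel
  rw [mem_closedBall, mem_closedBall, dist_eq_norm, dist_eq_norm, h, norm_smul, Real.norm_eq_abs,
    abs_of_pos ht, mul_le_mul_iff_right₀ ht]

/-- Translates of the half-open cube by the lattice tile the space. -/
lemma iUnion_latticePoint_sub_preimage {ℓ : ℝ} (hℓ : 0 < ℓ) :
    ⋃ p : Fin d → ℤ, {x : Euc d | x - latticePoint ℓ p ∈ halfOpenCube d ℓ} = Set.univ := by
  refine Set.eq_univ_of_forall fun x => Set.mem_iUnion.2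
    ⟨fun i => ⌊(x i + ℓ / 2) / ℓ⌋, fun i => ?_⟩
  have h1 := Int.floor_le ((x i + ℓ / 2) / ℓ)
  have h2 := Int.lt_floor_add_one ((x i + ℓ / 2) / ℓ)
  rw [le_div_iff₀ hℓ] at h1
  rw [div_lt_iff₀ hℓ] at h2
  simp only [Set.mem_Ico, PiLp.sub_apply, latticePoint_apply]
  constructor <;> linarith

lemma lintegral_halfOpenCube_tsum {ℓ : ℝ} (hℓ : 0 < ℓ) {f : Euc d → ℝ≥0∞} (hf : Measurable f) :
    ∫⁻ z in halfOpenCube d ℓ, ∑' p : Fin d → ℤ, f (z + latticePoint ℓ p) = ∫⁻ z, f z := by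
  have hm : ∀ p : Fin d → ℤ, MeasurableSet {x : Euc d | x - latticePoint ℓ p ∈ halfOpenCube d ℓ} :=
    fun p => (measurable_id.sub_const _) (measurableSet_box _ _)
  rw [← setLIntegral_univ f, ← iUnion_latticePoint_sub_preimage hℓ, lintegral_iUnion hm,
    lintegral_tsum fun p => (by fun_prop)]
  · refine tsum_congr fun p => ?_
    have hc : MeasurableSet (halfOpenCube d ℓ) := measurableSet_box _ _
    rw [← lintegral_indicator hc, ← lintegral_indicator (hm p),
      ← lintegral_add_right_eq_self
        ({x : Euc d | x - latticePoint ℓ p ∈ halfOpenCube d ℓ}.indicator f) (latticePoint ℓ p)]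
    refine lintegral_congr fun z => ?_
    refine Set.indicator_eq_indicator ?_ rfl
    rw [Set.mem_ofPred_eq, add_sub_cancel_right]
  · intro p q hpq
    exact Set.disjoint_left.2 fun x hp hq => hpq (eq_of_sub_latticePoint_mem hp hq)

namespace SwissCheese

variable (S : SwissCheese d M)

/-- The labels of the balls of the periodized packing. -/
abbrev Label : Type := Σ i : Fin M, (S.centers i) × (Fin d → ℤ)

/-- The dilated and translated ball with a given label. -/
def ball (ω : ℝ × Euc d) (k : S.Label) : Set (Euc d) :=
  closedBall (ω.1 • ((k.2.1 : Euc d) + latticePoint S.ℓ k.2.2) + ω.2) (ω.1 * S.R k.1)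

lemma ball_injective {ω : ℝ × Euc d} (hω : 0 < ω.1) : Function.Injective (S.ball ω) := by
  rintro ⟨i, x, p⟩ ⟨j, y, q⟩ h
  by_contra hne
  have hd := S.disjoint i j x x.2 y y.2 p q fun h => hne (by
    simp only [Prod.mk.injEq] at h
    obtain ⟨rfl, h2, rfl⟩ := h
    rw [Subtype.ext h2])
  have hx : (x : Euc d) + latticePoint S.ℓ p ∈
      closedBall ((x : Euc d) + latticePoint S.ℓ p) (S.R i) :=
    mem_closedBall_self (S.R_pos i).le
  have h1 : ω.1 • ((x : Euc d) + latticePoint S.ℓ p) + ω.2 ∈ S.ball ω ⟨i, x, p⟩ :=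
    mem_closedBall_self (mul_pos hω (S.R_pos i)).le
  rw [h] at h1
  have h2 := (mem_closedBall_dilated hω).1 h1
  rw [add_sub_cancel_right, inv_smul_smul₀ hω.ne'] at h2
  exact Set.disjoint_left.1 hd hx h2

/-- Summing over the set of balls loses no multiplicity, since balls with distinct labels are
nonempty and disjoint, hence different. -/
lemma tsum_family {ω : ℝ × Euc d} (hω : 0 < ω.1) (g : Set (Euc d) → ℝ≥0∞) :
    ∑' A : S.family ω, g A = ∑' k, g (S.ball ω k) := by
  have hmem : ∀ k, S.ball ω k ∈ S.family ω := fun k => ⟨k.1, k.2.1, k.2.1.2, k.2.2, rfl⟩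
  let e : S.Label ≃ S.family ω := Equiv.ofBijective (fun k => ⟨S.ball ω k, hmem k⟩)
    ⟨fun k k' h => S.ball_injective hω (Subtype.ext_iff.1 h), fun A => by
      obtain ⟨A, i, x, hx, p, rfl⟩ := A
      exact ⟨⟨i, ⟨x, hx⟩, p⟩, rfl⟩⟩
  exact (e.tsum_eq fun A : S.family ω => g A).symm

lemma measurable_indicator_ball (k : S.Label) (x : Euc d) :
    Measurable fun ω => (S.ball ω k).indicator (1 : Euc d → ℝ≥0∞) x := by
  have : MeasurableSet {ω : ℝ × Euc d | x ∈ S.ball ω k} := by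
    simp only [ball, mem_closedBall]
    exact measurableSet_le (by fun_prop) (by fun_prop)
  exact (measurable_one (α := ℝ≥0∞)).indicator this

lemma ℓ_pos (i : Fin M) : 0 < S.ℓ := lt_of_le_of_lt (by
  have := S.R_pos i
  have := unitBallVol_pos d
  have := cheeseConst_pos d
  positivity) (S.ℓ_large i)

/-- Writing the translation as `t • z` moves the dilation onto `x` and leaves a function of `z` plus
a lattice point, ready to be unfolded over the periods. -/
lemma indicator_ball_smul {t : ℝ} (ht : 0 < t) (k : S.Label) (x z : Euc d) :
    (S.ball (t, t • z) k).indicator (1 : Euc d → ℝ≥0∞) x =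
      (closedBall (t⁻¹ • x - (k.2.1 : Euc d)) (S.R k.1)).indicator 1
        (z + latticePoint S.ℓ k.2.2) := by
  refine Set.indicator_eq_indicator ?_ rfl
  rw [ball, mem_closedBall_dilated ht, smul_sub, inv_smul_smul₀ ht.ne', mem_closedBall,
    mem_closedBall, dist_comm, dist_eq_norm, dist_eq_norm]
  congr! 2
  abel

/-- The fraction of the cube covered by the balls of the `i`-th scale. -/
def fraction (i : Fin M) : ℝ :=
  ((S.centers i).card : ℝ) * (volume (closedBall (0 : Euc d) (S.R i))).toReal / S.ℓ ^ d

lemma fraction_nonneg (i : Fin M) : 0 ≤ S.fraction i := by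
  have := S.ℓ_pos i
  unfold fraction; positivity

/-- The average over translations of the number of balls that contain two given points. -/
lemma lintegral_tsum_ball (hd : 0 < d) {t : ℝ} (ht : 0 < t) (x y : Euc d) :
    ∫⁻ z in halfOpenCube d S.ℓ, ∑' k, (S.ball (t, t • z) k).indicator (1 : Euc d → ℝ≥0∞) x *
        (S.ball (t, t • z) k).indicator (1 : Euc d → ℝ≥0∞) y =
      ENNReal.ofReal (S.ℓ ^ d) * ∑ i, ENNReal.ofReal (S.fraction i) *
        ENNReal.ofReal (ballOverlap d (dist x y / S.R i / t)) := by
  have hterm : ∀ i (c : S.centers i), ∫⁻ z in halfOpenCube d S.ℓ, ∑' p : Fin d → ℤ,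
      (S.ball (t, t • z) ⟨i, c, p⟩).indicator (1 : Euc d → ℝ≥0∞) x *
        (S.ball (t, t • z) ⟨i, c, p⟩).indicator (1 : Euc d → ℝ≥0∞) y =
      ENNReal.ofReal (S.R i ^ d * unitBallVol d * ballOverlap d (dist x y / S.R i / t)) := by
    intro i c
    simp only [S.indicator_ball_smul ht]
    rw [lintegral_halfOpenCube_tsum (S.ℓ_pos i) (f := fun z =>
      (closedBall (t⁻¹ • x - (c : Euc d)) (S.R i)).indicator 1 z *
        (closedBall (t⁻¹ • y - (c : Euc d)) (S.R i)).indicator 1 z)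
      ((measurable_one.indicator isClosed_closedBall.measurableSet).mul
        (measurable_one.indicator isClosed_closedBall.measurableSet))]
    have : ∀ z : Euc d, (closedBall (t⁻¹ • x - (c : Euc d)) (S.R i)).indicator (1 : Euc d → ℝ≥0∞) z *
        (closedBall (t⁻¹ • y - (c : Euc d)) (S.R i)).indicator 1 z =
        (closedBall (t⁻¹ • x - (c : Euc d)) (S.R i) ∩
          closedBall (t⁻¹ • y - (c : Euc d)) (S.R i)).indicator 1 z := fun z => by
      rw [Set.inter_indicator_one]; rfl
    simp only [this]
    rw [lintegral_indicator_one
      (isClosed_closedBall.measurableSet.inter isClosed_closedBall.measurableSet),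
      volume_inter_closedBall hd _ _ (S.R_pos i), dist_sub_right, dist_smul₀, norm_inv,
      Real.norm_eq_abs, abs_of_pos ht]
    congr 3
    rw [div_right_comm]
    ring
  have hmeas : ∀ k : S.Label, Measurable fun z : Euc d =>
      (S.ball (t, t • z) k).indicator (1 : Euc d → ℝ≥0∞) x *
        (S.ball (t, t • z) k).indicator (1 : Euc d → ℝ≥0∞) y := fun k => by
    have h : Measurable fun z : Euc d => (t, t • z) := by fun_prop
    exact ((S.measurable_indicator_ball k x).comp h).mul ((S.measurable_indicator_ball k y).comp h)
  have hsplit : ∀ z, ∑' k, (S.ball (t, t • z) k).indicator (1 : Euc d → ℝ≥0∞) x *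
        (S.ball (t, t • z) k).indicator (1 : Euc d → ℝ≥0∞) y =
      ∑ i, ∑ c : S.centers i, ∑' p : Fin d → ℤ,
        (S.ball (t, t • z) ⟨i, c, p⟩).indicator (1 : Euc d → ℝ≥0∞) x *
        (S.ball (t, t • z) ⟨i, c, p⟩).indicator (1 : Euc d → ℝ≥0∞) y := fun z => by
    rw [ENNReal.tsum_sigma', tsum_fintype]
    refine Finset.sum_congr rfl fun i _ => ?_
    rw [ENNReal.tsum_prod', tsum_fintype]
  simp only [hsplit]
  rw [lintegral_finsetSum _ fun i _ => Finset.measurable_sum _ fun c _ =>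
    Measurable.tsum fun p => hmeas _, Finset.mul_sum]
  refine Finset.sum_congr rfl fun i _ => ?_
  rw [lintegral_finsetSum _ fun c _ => Measurable.tsum fun p => hmeas _]
  simp only [hterm, Finset.sum_const, nsmul_eq_mul, Finset.card_univ, Fintype.card_coe]
  have hℓ := S.ℓ_pos i
  have hR := S.R_pos i
  have hv := unitBallVol_pos d
  rw [← ENNReal.ofReal_natCast, ← ENNReal.ofReal_mul (by positivity),
    ← ENNReal.ofReal_mul (S.fraction_nonneg i), ← ENNReal.ofReal_mul (by positivity), fraction,
    volume_closedBall_euc _ hR.le, ENNReal.toReal_ofReal (by positivity)]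
  congr 1
  field_simp

end SwissCheese

/-- The law of the dilation factor. -/
def BumpRepr.dilationLaw {n : ℕ} (D : BumpRepr n) (s : ℝ) : Measure ℝ :=
  (volume.restrict (Set.Ioi 0)).withDensity fun t => ENNReal.ofReal (D.density s t)

/-- The uniform probability measure on the cube `[-ℓ/2, ℓ/2)^d`. -/
def uniformCube (d : ℕ) (ℓ : ℝ) : Measure (Euc d) :=
  (ENNReal.ofReal (ℓ ^ d))⁻¹ • volume.restrict (halfOpenCube d ℓ)

/-- The law of the pair (dilation factor, translation) of a randomized packing of period `ℓ`. -/
def BumpRepr.packingLaw {n : ℕ} (D : BumpRepr n) (s : ℝ) (d : ℕ) (ℓ : ℝ) : Measure (ℝ × Euc d) :=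
  ((D.dilationLaw s).prod (uniformCube d ℓ)).map fun q => (q.1, q.1 • q.2)

lemma isProbabilityMeasure_uniformCube {ℓ : ℝ} (hℓ : 0 < ℓ) :
    IsProbabilityMeasure (uniformCube d ℓ) := ⟨by
  rw [uniformCube, Measure.smul_apply, Measure.restrict_apply_univ, halfOpenCube,
    volume_box _ hℓ.le, smul_eq_mul,
    ENNReal.inv_mul_cancel (by simpa using pow_pos hℓ d) ENNReal.ofReal_ne_top]⟩

namespace BumpRepr

variable {n : ℕ} (D : BumpRepr n)

@[fun_prop]
lemma measurable_density (s : ℝ) : Measurable (D.density s) := by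
  have := D.continuous_B.measurable
  unfold density
  fun_prop

/-- A function that is not integrable would have integral 0 instead of 1. -/
lemma integrableOn_density {s : ℝ} (hs : 0 < s) : IntegrableOn (D.density s) (Set.Ioi 0) := by
  by_contra h
  have := D.integral_density hs
  rw [integral_undef h] at this
  exact zero_ne_one this

lemma isProbabilityMeasure_dilationLaw {s : ℝ} (hs : 0 < s) :
    IsProbabilityMeasure (D.dilationLaw s) := ⟨by
  rw [dilationLaw, withDensity_apply _ MeasurableSet.univ, Measure.restrict_univ,
    ← ofReal_integral_eq_lintegral_ofReal (D.integrableOn_density hs)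
      ((ae_restrict_iff' measurableSet_Ioi).2 (ae_of_all _ fun t ht => D.density_nonneg ht)),
    D.integral_density hs, ENNReal.ofReal_one]⟩

lemma ae_dilationLaw (s : ℝ) : ∀ᵐ t ∂(D.dilationLaw s), t ∈ Set.Ioo (1 / 2 : ℝ) (3 / 2) := by
  rw [dilationLaw, ae_withDensity_iff (by fun_prop)]
  refine ae_of_all _ fun t ht => ?_
  by_contra h
  exact ht (by simp [density, D.B_support t h])

lemma isProbabilityMeasure_packingLaw {s ℓ : ℝ} (hs : 0 < s) (hℓ : 0 < ℓ) :
    IsProbabilityMeasure (D.packingLaw s d ℓ) := by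
  have := D.isProbabilityMeasure_dilationLaw hs
  have := isProbabilityMeasure_uniformCube (d := d) hℓ
  exact Measure.isProbabilityMeasure_map (by fun_prop)

lemma ae_prod_packing {s ℓ : ℝ} (hs : 0 < s) (hℓ : 0 < ℓ) :
    ∀ᵐ q ∂((D.dilationLaw s).prod (uniformCube d ℓ)),
      q.1 ∈ Set.Ioo (1 / 2 : ℝ) (3 / 2) ∧ q.2 ∈ halfOpenCube d ℓ := by
  have := D.isProbabilityMeasure_dilationLaw hs
  have := isProbabilityMeasure_uniformCube (d := d) hℓ
  have h1 := Measure.quasiMeasurePreserving_fst (μ := D.dilationLaw s) (ν := uniformCube d ℓ)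
    |>.ae (D.ae_dilationLaw s)
  have h2 : ∀ᵐ z ∂(uniformCube d ℓ), z ∈ halfOpenCube d ℓ :=
    Measure.ae_smul_measure (ae_restrict_mem (measurableSet_box _ _)) _
  exact h1.and (Measure.quasiMeasurePreserving_snd.ae h2)

lemma measurableSet_cube_prod (ℓ : ℝ) :
    MeasurableSet {ω : ℝ × Euc d | ω.2 ∈ cube d (ω.1 * ℓ)} := by
  have : {ω : ℝ × Euc d | ω.2 ∈ cube d (ω.1 * ℓ)} = ⋂ i, {ω | |ω.2 i| ≤ ω.1 * ℓ / 2} := by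
    ext; simp [cube]
  rw [this]
  exact MeasurableSet.iInter fun i => measurableSet_le (by fun_prop) (by fun_prop)

lemma ae_packingLaw_mem_params {s : ℝ} (hs : 0 < s) (S : SwissCheese d M) (hℓ : 0 < S.ℓ) :
    ∀ᵐ ω ∂(D.packingLaw s d S.ℓ), ω ∈ S.params := by
  have hm : MeasurableSet {ω : ℝ × Euc d | ω ∈ S.params} := by
    have h1 : MeasurableSet {ω : ℝ × Euc d | 1 / 2 ≤ ω.1} :=
      measurableSet_le (by fun_prop) (by fun_prop)
    have h2 : MeasurableSet {ω : ℝ × Euc d | ω.1 ≤ 3 / 2} :=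
      measurableSet_le (by fun_prop) (by fun_prop)
    exact h1.inter (h2.inter (measurableSet_cube_prod S.ℓ))
  rw [packingLaw, ae_map_iff (by fun_prop) hm]
  filter_upwards [D.ae_prod_packing hs hℓ] with q hq
  refine ⟨hq.1.1.le, hq.1.2.le, fun i => ?_⟩
  have h0 : 0 < q.1 := by linarith [hq.1.1]
  have := halfOpenCube_subset_cube d S.ℓ hq.2 i
  simp only [PiLp.smul_apply, smul_eq_mul, abs_mul, abs_of_pos h0]
  calc q.1 * |q.2 i| ≤ q.1 * (S.ℓ / 2) := mul_le_mul_of_nonneg_left this h0.le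
    _ = _ := by ring

/-- The average of the packing kernel over random dilations and translations. -/
theorem lintegral_packing (hd : 0 < d) {s : ℝ} (hs : 0 < s) (S : SwissCheese d M) (hℓ : 0 < S.ℓ)
    (x y : Euc d) (r : ℝ≥0∞) :
    ∫⁻ ω, ∑' A : S.family ω, (A : Set (Euc d)).indicator 1 x *
        (A : Set (Euc d)).indicator 1 y * r ∂(D.packingLaw s d S.ℓ) =
      r * ENNReal.ofReal (∑ i, S.fraction i * D.overlapAverage d s (dist x y / S.R i)) := by
  have hP1 := D.isProbabilityMeasure_dilationLaw hs
  have hP2 := isProbabilityMeasure_uniformCube (d := d) hℓ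
  have hG : Measurable fun ω : ℝ × Euc d => ∑' k, (S.ball ω k).indicator (1 : Euc d → ℝ≥0∞) x *
      (S.ball ω k).indicator (1 : Euc d → ℝ≥0∞) y :=
    Measurable.tsum fun k =>
      (S.measurable_indicator_ball k x).mul (S.measurable_indicator_ball k y)
  have hφ : Measurable fun q : ℝ × Euc d => (q.1, q.1 • q.2) := by fun_prop
  have hGφ : Measurable fun q : ℝ × Euc d =>
      ∑' k, (S.ball (q.1, q.1 • q.2) k).indicator (1 : Euc d → ℝ≥0∞) x *
        (S.ball (q.1, q.1 • q.2) k).indicator (1 : Euc d → ℝ≥0∞) y := hG.comp hφ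
  have h1 : ∀ᵐ ω ∂(D.packingLaw s d S.ℓ), ∑' A : S.family ω, (A : Set (Euc d)).indicator 1 x *
        (A : Set (Euc d)).indicator 1 y * r =
      (∑' k, (S.ball ω k).indicator (1 : Euc d → ℝ≥0∞) x *
        (S.ball ω k).indicator (1 : Euc d → ℝ≥0∞) y) * r := by
    filter_upwards [D.ae_packingLaw_mem_params hs S hℓ] with ω hω
    rw [S.tsum_family (by linarith [hω.1]) fun A => A.indicator 1 x * A.indicator 1 y * r,
      ENNReal.tsum_mul_right]
  have hO := measurable_ballOverlap d
  rw [lintegral_congr_ae h1, lintegral_mul_const _ hG, mul_comm, packingLaw,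
    lintegral_map hG hφ, lintegral_prod _ hGφ.aemeasurable, dilationLaw,
    lintegral_withDensity_eq_lintegral_mul _ (by fun_prop) hGφ.lintegral_prod_right']
  congr 1
  have h2 : ∀ t ∈ Set.Ioi (0 : ℝ), ((fun t => ENNReal.ofReal (D.density s t)) * fun t =>
      ∫⁻ z, ∑' k, (S.ball (t, t • z) k).indicator (1 : Euc d → ℝ≥0∞) x *
        (S.ball (t, t • z) k).indicator (1 : Euc d → ℝ≥0∞) y ∂(uniformCube d S.ℓ)) t =
      ENNReal.ofReal (∑ i, S.fraction i *
        (D.density s t * ballOverlap d (dist x y / S.R i / t))) := by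
    intro t ht
    rw [Pi.mul_apply, uniformCube, lintegral_smul_measure, S.lintegral_tsum_ball hd ht,
      smul_eq_mul, ← mul_assoc (ENNReal.ofReal (S.ℓ ^ d))⁻¹,
      ENNReal.inv_mul_cancel (by simpa using pow_pos hℓ d) ENNReal.ofReal_ne_top, one_mul,
      Finset.mul_sum, ENNReal.ofReal_sum_of_nonneg fun i _ => mul_nonneg (S.fraction_nonneg i)
        (mul_nonneg (D.density_nonneg ht) (ballOverlap_nonneg _ _))]
    refine Finset.sum_congr rfl fun i _ => ?_
    rw [ENNReal.ofReal_mul (S.fraction_nonneg i), ENNReal.ofReal_mul (D.density_nonneg ht)]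
    ring
  rw [setLIntegral_congr_fun measurableSet_Ioi h2]
  have hint : ∀ i ∈ Finset.univ, IntegrableOn (fun t => S.fraction i *
      (D.density s t * ballOverlap d (dist x y / S.R i / t))) (Set.Ioi 0) := fun i _ =>
    (D.integrableOn_density_mul hO (abs_ballOverlap_le d) s _).const_mul _
  rw [← ofReal_integral_eq_lintegral_ofReal (integrable_finsetSum _ hint)
    ((ae_restrict_iff' measurableSet_Ioi).2 (ae_of_all _ fun t ht => Finset.sum_nonneg fun i _ =>
      mul_nonneg (S.fraction_nonneg i)
        (mul_nonneg (D.density_nonneg ht) (ballOverlap_nonneg _ _)))),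
    integral_finsetSum _ hint]
  simp only [integral_const_mul, overlapAverage]

end BumpRepr

end

/-! ### Covered fractions, values of the remainder, and the conclusion -/

section

variable {d M : ℕ}

lemma BumpRepr.overlapAverage_le_one {n : ℕ} (D : BumpRepr n) (d : ℕ) {s : ℝ} (hs : 0 < s)
    (u : ℝ) : D.overlapAverage d s u ≤ 1 := by
  rw [← D.integral_density hs]
  refine setIntegral_mono_on
    (D.integrableOn_density_mul (measurable_ballOverlap d) (abs_ballOverlap_le d) s u)
    (D.integrableOn_density hs) measurableSet_Ioi fun t ht => ?_
  exact mul_le_of_le_one_right (D.density_nonneg ht) (ballOverlap_le_one d _)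

namespace SwissCheese

variable (S : SwissCheese d M)

lemma fraction_le (hM : 0 < M) (i : Fin M) : S.fraction i ≤ 1 / M := by
  have hM' : (0 : ℝ) < M := by exact_mod_cast hM
  refine (S.fraction_upper i).le.trans (one_div_le_one_div_of_le hM' ?_)
  linarith [cheeseConst_pos d]

lemma sum_fraction_le_one (hM : 0 < M) : ∑ i, S.fraction i ≤ 1 := by
  have hM' : (M : ℝ) ≠ 0 := by exact_mod_cast hM.ne'
  calc ∑ i, S.fraction i ≤ ∑ _i : Fin M, 1 / (M : ℝ) :=
        Finset.sum_le_sum fun i _ => S.fraction_le hM i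
    _ = 1 := by simp [hM']

/-- The sum exceeds M/(M + C_d + 1) = 1 - (C_d + 1)/(M + C_d + 1). -/
lemma le_sum_fraction (hM : 0 < M) : 1 - (cheeseConst d + 1) / M ≤ ∑ i, S.fraction i := by
  have hM' : (0 : ℝ) < M := by exact_mod_cast hM
  have hC := cheeseConst_pos d
  calc 1 - (cheeseConst d + 1) / M ≤ ∑ _i : Fin M, 1 / (M + cheeseConst d + 1) := by
        rw [Finset.sum_const, Finset.card_univ, Fintype.card_fin, nsmul_eq_mul, mul_one_div,
          one_sub_div hM'.ne', div_le_div_iff₀ hM' (by positivity)]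
        nlinarith
    _ ≤ ∑ i, S.fraction i := Finset.sum_le_sum fun i _ => (S.fraction_lower i).le

end SwissCheese

lemma riesz_zero {s : ℝ} (hs : 0 < s) : riesz s (0 : Euc d) = ⊤ := by
  rw [riesz, enorm_zero, ENNReal.zero_rpow_of_neg (by linarith)]

lemma riesz_of_ne_zero {s : ℝ} {x : Euc d} (hx : x ≠ 0) :
    riesz s x = ENNReal.ofReal (‖x‖ ^ (-s)) := by
  rw [riesz, ← ENNReal.ofReal_rpow_of_pos (norm_pos_iff.2 hx), ofReal_norm]

/-- At the origin all profiles equal 1, so the mixture is the total weight, which is infinite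
because r^(-s-1) is not integrable on (0, ∞). -/
lemma mixture_zero {n : ℕ} {a : ℝ → ℝ} {s κ : ℝ} (hκ : 0 < κ)
    (ha : ∀ x, 0 < x → κ * x ^ (-s - 1) ≤ a x) : mixture d n a 0 = ⊤ := by
  by_contra h
  have h1 : ∫⁻ r in Set.Ioi 0, ENNReal.ofReal (κ * r ^ (-s - 1)) ≤ mixture d n a 0 := by
    refine setLIntegral_mono' measurableSet_Ioi fun r hr => ?_
    rw [norm_zero, zero_div, profile_zero, ENNReal.ofReal_one, one_mul]
    exact ENNReal.ofReal_le_ofReal (ha r hr)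
  have h2 : IntegrableOn (fun r : ℝ => κ * r ^ (-s - 1)) (Set.Ioi 0) := by
    refine ⟨by fun_prop, ?_⟩
    rw [hasFiniteIntegral_iff_ofReal ((ae_restrict_iff' measurableSet_Ioi).2
      (ae_of_all _ fun r hr => mul_nonneg hκ.le (Real.rpow_nonneg (le_of_lt hr) _)))]
    exact h1.trans_lt (lt_top_iff_ne_top.2 h)
  refine not_integrableOn_Ioi_rpow (-s - 1) ?_
  have := h2.const_mul κ⁻¹
  simpa [IntegrableOn, ← mul_assoc, inv_mul_cancel₀ hκ.ne'] using this

/-- Positivity of `q` supplies integrability, since the integral of a non-integrable function is 0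
by convention. -/
lemma mixture_eq_ofReal {n : ℕ} {a : ℝ → ℝ} (ha0 : ∀ x, 0 < x → 0 ≤ a x)
    {x : Euc d} {q : ℝ} (hq : 0 < q) (h : q = ∫ r in Set.Ioi 0, profile n (‖x‖ / r) * a r) :
    mixture d n a x = ENNReal.ofReal q := by
  have hint : IntegrableOn (fun r => profile n (‖x‖ / r) * a r) (Set.Ioi 0) := by
    by_contra hni
    rw [integral_undef hni] at h
    exact hq.ne' h
  rw [h, ofReal_integral_eq_lintegral_ofReal hint ((ae_restrict_iff' measurableSet_Ioi).2
    (ae_of_all _ fun r hr => mul_nonneg (profile_nonneg _ _) (ha0 r hr)))]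
  simp only [mixture, ENNReal.ofReal_mul (profile_nonneg _ _)]

/-- The lower bound for densities that are only almost everywhere measurable. -/
lemma le_excEnergyGC_mixture_of_memLp {n : ℕ} {ι : Euc d → Euc (2 * n + 1)} (hι : Isometry ι)
    (hd : 0 < d) {ε s : ℝ} (hε : 0 < ε) (hεs : ε ≤ s) (hsd : s ≤ d - ε) {L R₁ A : ℝ}
    (hL : 2 ≤ L) (hLε : 2 ≤ L ^ ε) (hR : 0 < R₁) {a : ℝ → ℝ} (ha : Measurable a) (hA : 0 ≤ A)
    (haA : ∀ x, 0 < x → a x ≤ A * x ^ (-s - 1) *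
      (1 + ∑ i : Fin M, if R₁ * L ^ (i : ℕ) < x then 1 else 0))
    {μ : Measure (Euc d)} [IsProbabilityMeasure μ] {ρ : Euc d → ℝ} (hρ0 : ∀ x, 0 ≤ ρ x)
    (hμ : μ = volume.withDensity fun x => ENNReal.ofReal (ρ x))
    (hρ : MemLp ρ (ENNReal.ofReal (1 + s / d)) volume) {N : ℝ} (hN : 2 ≤ N) :
    ((-(A * ((8 * unitBallVol d + 2) / ε + 4 / ε)) * N ^ (1 + s / d) * (∫ x, ρ x ^ (1 + s / d))
      - (A * ((8 * unitBallVol d + 2) / ε + 4 / ε)) * R₁ ^ (-s) * (N - 1) : ℝ) : EReal) ≤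
      excEnergyGC N (mixture d n a) μ := by
  have hs : 0 < s := by linarith
  have hv := unitBallVol_pos d
  -- The measurable version is cut off at zero so that it is nonnegative everywhere and not only
  -- almost everywhere.
  let F : Euc d → ℝ := fun x => max (hρ.1.mk ρ x) 0
  have hFρ : ρ =ᵐ[volume] F := by
    filter_upwards [hρ.1.ae_eq_mk] with x hx
    simp only [F]
    rw [← hx, max_eq_left (hρ0 x)]
  have hp : 0 < 1 + s / d := by positivity
  have hI : (∫ x, ρ x ^ (1 + s / d)) = ∫ x, F x ^ (1 + s / d) :=
    integral_congr_ae (hFρ.fun_comp fun r => r ^ (1 + s / d))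
  have hint : Integrable fun x => F x ^ (1 + s / d) := by
    have := hρ.integrable_norm_rpow (by simpa using hp) ENNReal.ofReal_ne_top
    rw [ENNReal.toReal_ofReal hp.le] at this
    refine this.congr ?_
    filter_upwards [hFρ] with x hx
    rw [Real.norm_of_nonneg (hρ0 x), hx]
  have hμ' : μ = volume.withDensity fun x => ENNReal.ofReal (F x) := by
    rw [hμ]
    exact withDensity_congr_ae (hFρ.fun_comp ENNReal.ofReal)
  have hF : Measurable F := hρ.1.stronglyMeasurable_mk.measurable.max measurable_const
  refine le_trans ?_ (le_excEnergyGC_mixture hι hε hεs hsd hL hLε hR ha hA haA hF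
    (fun x => le_max_right _ _) hμ' hint hN)
  rw [EReal.coe_le_coe_iff, hI]
  have h1 : 0 ≤ N ^ (1 + s / d) * ∫ x, F x ^ (1 + s / d) :=
    mul_nonneg (by positivity)
      (integral_nonneg fun x => Real.rpow_nonneg (le_max_right _ _) _)
  have h2 : 0 ≤ R₁ ^ (-s) * (N - 1) := mul_nonneg (by positivity) (by linarith)
  have h3 : 0 ≤ A * ((8 * unitBallVol d + 2) / ε) := by positivity
  have h4 : 0 ≤ A * (4 / ε) := by positivity
  have := mul_nonneg h4 h1
  have := mul_nonneg h3 h2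
  linarith

end

end FeffermanGregg

end

open FeffermanGregg

theorem proposition1p7 (d : ℕ) (ε : ℝ) (hε : 0 < ε) (hεd : ε < (d : ℝ) / 2) :
    ∃ C C' : ℝ, 0 < C ∧ 0 < C' ∧
      ∀ (M : ℕ) (hM : 0 < M) (s : ℝ), ε ≤ s → s ≤ (d : ℝ) - ε → ∀ R₁ : ℝ, 0 < R₁ →
        ∃ (S : FeffermanGregg.SwissCheese d M) (P : Measure (ℝ × FeffermanGregg.Euc d))
          (w : FeffermanGregg.Euc d → ℝ≥0∞),
          S.R ⟨0, hM⟩ = R₁ ∧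
          IsProbabilityMeasure P ∧ (∀ᵐ ω ∂P, ω ∈ S.params) ∧
          Measurable w ∧ w 0 = ⊤ ∧
          (∀ x y : FeffermanGregg.Euc d,
            FeffermanGregg.riesz s (x - y) =
              ENNReal.ofReal ((M : ℝ) / ((M : ℝ) + C)) *
                ((∫⁻ ω, ∑' A : S.family ω,
                    (A : Set (FeffermanGregg.Euc d)).indicator 1 x *
                      (A : Set (FeffermanGregg.Euc d)).indicator 1 y *
                        FeffermanGregg.riesz s (x - y) ∂P)
                  + w (x - y))) ∧
          FeffermanGregg.IsPositiveDefinite w ∧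
          ∀ (μ : Measure (FeffermanGregg.Euc d)) (ρ : FeffermanGregg.Euc d → ℝ),
            IsProbabilityMeasure μ → (∀ x, 0 ≤ ρ x) →
            μ = volume.withDensity (fun x => ENNReal.ofReal (ρ x)) →
            MemLp ρ (ENNReal.ofReal (1 + s / d)) volume →
              (∀ N : ℕ, 2 ≤ N →
                FeffermanGregg.excEnergyGC N w μ ≤ FeffermanGregg.excEnergy N w μ) ∧
              (∀ N : ℝ, 2 ≤ N →
                ((-(C' / M) * N ^ (1 + s / d) * (∫ x, ρ x ^ (1 + s / d))
                    - (C' / M) * R₁ ^ (-s) * (N - 1) : ℝ) : EReal) ≤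
                  FeffermanGregg.excEnergyGC N w μ) := by
  have hd : 0 < d := by
    rcases Nat.eq_zero_or_pos d with rfl | h
    · norm_num at hεd; linarith
    · exact h
  have hv := unitBallVol_pos d
  have hC₀ := cheeseConst_pos d
  -- Any positive n with d ≤ 2n + 1 would serve; n = d is the simplest choice.
  obtain ⟨D⟩ := nonempty_bumpRepr d hd
  obtain ⟨ι, hι⟩ := exists_isometry_euc (show d ≤ 2 * d + 1 by omega)
  obtain ⟨C, C₂, hC, hC₂, hweight⟩ := D.exists_weight (d := d) hd hε
    (show 0 < cheeseConst d + 1 by linarith)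
  refine ⟨C, C₂ * ((8 * unitBallVol d + 2) / ε + 4 / ε), hC, by positivity,
    fun M hM s hεs hsd R₁ hR₁ => ?_⟩
  have hs : 0 < s := by linarith
  have hM' : (0 : ℝ) < M := by exact_mod_cast hM
  obtain ⟨S, L, hL, hLε, hSR⟩ := exists_swissCheese (d := d) hd hM hε hR₁
  have hℓ : 0 < S.ℓ := S.ℓ_pos ⟨0, hM⟩
  obtain ⟨a, ham, halo, haup, hid⟩ := hweight M hM s hεs (by linarith) L R₁ hL hR₁ S.fraction
    S.fraction_nonneg (S.fraction_le hM) (S.le_sum_fraction hM)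
  have ha0 : ∀ x, 0 < x → 0 ≤ a x := fun x hx =>
    le_trans (by positivity) (halo x hx)
  have hw0 : mixture d d a 0 = ⊤ := mixture_zero (by positivity) halo
  have hmix := mixture_eq_lintegral hι ham
  refine ⟨S, D.packingLaw s d S.ℓ, mixture d d a, by simp [hSR],
    D.isProbabilityMeasure_packingLaw hs hℓ, D.ae_packingLaw_mem_params hs S hℓ,
    measurable_mixture ham, hw0, fun x y => ?_,
    isPositiveDefinite_of_indicator (measurable_ballIndicator hι) hmix,
    fun μ ρ hμp hρ0 hμ hρ => ⟨fun N _ => excEnergyGC_le_excEnergy N _ μ, fun N hN => ?_⟩⟩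
  · rw [D.lintegral_packing hd hs S hℓ x y]
    have hK : 0 < (M : ℝ) / (M + C) := by positivity
    -- On the diagonal both sides are infinite.
    rcases eq_or_ne x y with rfl | hxy
    · rw [sub_self, riesz_zero hs, hw0, add_top, ENNReal.mul_top (by simpa using hK)]
    · have hxy' : x - y ≠ 0 := sub_ne_zero.2 hxy
      have hu : 0 < ‖x - y‖ := norm_pos_iff.2 hxy'
      set T := ∑ i, S.fraction i * D.overlapAverage d s (dist x y / S.R i) with hT
      have hT0 : 0 ≤ T := Finset.sum_nonneg fun i _ =>
        mul_nonneg (S.fraction_nonneg i) (D.overlapAverage_nonneg d s _)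
      have hT1 : T ≤ 1 := (Finset.sum_le_sum fun i _ => mul_le_of_le_one_right
        (S.fraction_nonneg i) (D.overlapAverage_le_one d hs _)).trans (S.sum_fraction_le_one hM)
      -- The remainder is strictly positive off the diagonal, as `mixture_eq_ofReal` demands.
      have hTK : T < (M + C) / M := hT1.trans_lt (by rw [one_lt_div hM']; linarith)
      have hid' := hid ‖x - y‖ hu
      simp only [← hSR, ← dist_eq_norm x y] at hid'
      rw [← hT] at hid'
      have hq : 0 < dist x y ^ (-s) * ((M + C) / M - T) :=
        mul_pos (Real.rpow_pos_of_pos (dist_pos.2 hxy) _) (sub_pos.2 hTK)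
      rw [mixture_eq_ofReal ha0 hq (by rw [← dist_eq_norm]; exact hid'),
        riesz_of_ne_zero hxy', ← dist_eq_norm,
        ← ENNReal.ofReal_mul (by positivity), ← ENNReal.ofReal_add (by positivity) hq.le,
        ← ENNReal.ofReal_mul hK.le]
      congr 1
      field_simp
      ring
  · have := le_excEnergyGC_mixture_of_memLp (A := C₂ / M) hι hd hε hεs hsd hL hLε hR₁ ham
      (by positivity) haup hρ0 hμ hρ hN
    convert this using 6 <;> ring
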